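/- \textbf{The theory.} $\mathbf{IKP}(\mathcal E)$ (intuitionistic exponentiation Kripke--Platek set theory) has formulas built from atoms $a\in b$ by $\neg,\wedge,\vee,\to$, the unbounded quantifiers $\forall x,\exists x$, the bounded quantifiers $(\forall x\in a),(\exists x\in a)$ and the exponentiation bounded quantifiers $(\forall x\in{}^{a}b),(\exists x\in{}^{a}b)$, all of them primitive; $a=b$ abbreviates $(\forall x\in a)(x\in b)\wedge(\forall x\in b)(x\in a)$, and $\mathrm{fun}(x,a,b)$ is the bounded formula saying that $x$ is a function from $a$ to $b$ (with Kuratowski pairs). A formula is $\Delta_0^{\mathcal E}$ if it has no unbounded quantifier. The $\Sigma^{\mathcal E}$- and $\Pi^{\mathcal E}$-formulas are the least classes that contain the $\Delta_0^{\mathcal E}$-formulas, are closed under $\wedge$, $\vee$, bounded and exponentiation bounded quantification, and such that: if $A$ is $\Sigma^{\mathcal E}$ and $C$ is $\Pi^{\mathcal E}$, then $\exists x A$, $\neg C$, $C\to A$ are $\Sigma^{\mathcal E}$; if $A$ is $\Pi^{\mathcal E}$ and $C$ is $\Sigma^{\mathcal E}$, then $\forall xA$, $\neg C$, $C\to A$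 are $\Pi^{\mathcal E}$. A sentence is a formula without free variables. $\mathbf{IKP}(\mathcal E)$ derives sequents $\Gamma\Rightarrow\Delta$ of finite sets of formulas, $\Delta$ having at most one element, by the intuitionistic sequent calculus with cut, where $(\exists x\in b)F(x)$ and $(\forall x\in b)F(x)$ are introduced from $a\in b\wedge F(a)$ and $a\in b\to F(a)$, and $(\exists x\in{}^{a}b)F(x)$ and $(\forall x\in{}^{a}b)F(x)$ from $\mathrm{fun}(c,a,b)\wedge F(c)$ and $\mathrm{fun}(c,a,b)\to F(c)$, with the usual eigenvariable conditions. Its axioms, with arbitrary side formulas $\Gamma$ on the left, are \begin{itemize} \item $\Gamma,A\Rightarrow A$ for $A\in\Delta_0^{\mathcal E}$; \item Extensionality: $a=b\wedge B(a)\to B(b)$ for $B\in\Delta_0^{\mathcal E}$; \item Pair: $\exists x[a\in x\wedge b\in x]$; \item Union: $\exists x(\forall y\in a)(\forall z\in y)(z\in x)$; \item Infinity: $\exists x[(\exists y\in x)\,y\in x\wedge(\forall y\in x)(\exists z\in x)\,y\in z]$; \item $\Delta_0^{\mathcal E}$-Separation: $\exists x\big((\forall y\in x)(y\in a\wedge A(y))\wedge(\forall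 y\in a)(A(y)\to y\in x)\big)$ for $A\in\Delta_0^{\mathcal E}$; \item $\Delta_0^{\mathcal E}$-Collection: $(\forall x\in a)\exists y\,B(x,y)\to\exists z(\forall x\in a)(\exists y\in z)B(x,y)$ for $B\in\Delta_0^{\mathcal E}$; \item Set Induction: $\forall u[(\forall x\in u)G(x)\to G(u)]\to\forall u\,G(u)$ for all formulas $G$; \item Exponentiation: $\exists z(\forall x\in{}^{a}b)(x\in z)$. \end{itemize} \textbf{Ordinals.} Let $\Omega=\aleph_1$, let $\varphi$ be the binary Veblen function ($\varphi 0\eta=\omega^\eta$), and define by simultaneous recursion on $\alpha$: $B^\Omega(\alpha)$ is the closure of $\{0,\Omega\}$ under $+$, $\varphi$ and $\xi\mapsto\psi_\Omega(\xi)$ for $\xi<\alpha$, and $\psi_\Omega(\alpha)=\min\{\rho<\Omega:\rho\notin B^\Omega(\alpha)\}$. Let $\varepsilon_{\Omega+1}$ be the least $\eta>\Omega$ with $\omega^\eta=\eta$. Ordinal terms are the terms in normal form built from $0,\Omega,+,\varphi,\psi_\Omega$ that denote the elements of $B^\Omega(\varepsilon_{\Omega+1})$; a term is in normal form if all its subterms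 are and: a sum $s+t$ has $s$ additively indecomposable, $t\neq 0$ and $t<s+t$; in $\varphi st$ one has $s,t<\varphi st$; in $\psi_\Omega(t)$ one has $t<\varepsilon_{\Omega+1}$ and $t\in B^\Omega(t)$. \textbf{The exponentiation hierarchy.} $E_0=\emptyset$; $E_1=\{\emptyset\}$; $E_{\alpha+2}$ consists of the sets definable over $\langle E_{\alpha+1},\in\rangle$ with parameters and of all functions $f\colon a\to b$ with $a,b\in E_\alpha$; for limit $\lambda$, $E_\lambda=\bigcup_{\beta<\lambda}E_\beta$ and $E_{\lambda+1}$ consists of the sets definable over $\langle E_\lambda,\in\rangle$ with parameters. $E_\alpha\models A$ means that $A$ holds in the structure $\langle E_\alpha,\in\rangle$, where $(\forall x\in{}^{a}b)$ and $(\exists x\in{}^{a}b)$ range over the elements of $E_\alpha$ that are functions from $a$ to $b$. \textbf{Theorem.} If $A$ is a $\Sigma^{\mathcal E}$-sentence and $\mathbf{IKP}(\mathcal E)\vdash\;\Rightarrow A$, then there is an ordinal term $\alpha<\psi_\Omega(\varepsilon_{\Omega+1})$, computable from the derivation, such that $E_\alpha\models A$. That is, there is a computable function $f$ such that for every $\Sigma^{\mathcal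 E}$-sentence $A$ and every derivation $d$ of $\Rightarrow A$ in $\mathbf{IKP}(\mathcal E)$, $f$ maps the Gödel number of $d$ to the Gödel number of an ordinal term denoting some $\alpha<\psi_\Omega(\varepsilon_{\Omega+1})$ with $E_\alpha\models A$. -/

import Mathlib

namespace IKPE

/-! ### The language of intuitionistic exponentiation Kripke–Platek set theory -/

/-- Variables available under `n` quantifiers: the free variables `a₀, a₁, …` and the bound
variables, given by de Bruijn indices (`bv 0` belongs to the innermost quantifier). -/
inductive Tm (n : ℕ) : Type
  | fv (i : ℕ) : Tm n
  | bv (k : Fin n) : Tm n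
  deriving DecidableEq

/-- Formulas of `IKP(𝓔)` under `n` quantifiers. The bounded quantifiers `(∀x ∈ t)`, `(∃x ∈ t)` and
the exponentiation bounded quantifiers `(∀x ∈ ˢt)`, `(∃x ∈ ˢt)` are primitive. -/
inductive Fml : ℕ → Type
  | mem {n : ℕ} (s t : Tm n) : Fml n
  | neg {n : ℕ} (A : Fml n) : Fml n
  | and {n : ℕ} (A B : Fml n) : Fml n
  | or {n : ℕ} (A B : Fml n) : Fml n
  | imp {n : ℕ} (A B : Fml n) : Fml n
  | all {n : ℕ} (F : Fml (n + 1)) : Fml n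
  | ex {n : ℕ} (F : Fml (n + 1)) : Fml n
  | ball {n : ℕ} (t : Tm n) (F : Fml (n + 1)) : Fml n
  | bex {n : ℕ} (t : Tm n) (F : Fml (n + 1)) : Fml n
  | eall {n : ℕ} (s t : Tm n) (F : Fml (n + 1)) : Fml n
  | eex {n : ℕ} (s t : Tm n) (F : Fml (n + 1)) : Fml n
  deriving DecidableEq

/-- Formulas in the proper sense: no dangling bound variable. -/
abbrev Formula : Type := Fml 0

/-- Simultaneous replacement of the bound variables. -/
def Tm.subst {n m : ℕ} (σ : Fin n → Tm m) : Tm n → Tm m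
  | .fv i => .fv i
  | .bv k => σ k

/-- Passing under one more quantifier. -/
def Tm.shift {n : ℕ} : Tm n → Tm (n + 1) := Tm.subst fun k => .bv k.succ

def upSubst {n m : ℕ} (σ : Fin n → Tm m) : Fin (n + 1) → Tm (m + 1) :=
  Fin.cases (.bv 0) fun k => (σ k).shift

def Fml.subst : {n m : ℕ} → (Fin n → Tm m) → Fml n → Fml m
  | _, _, σ, .mem s t => .mem (s.subst σ) (t.subst σ)
  | _, _, σ, .neg A => .neg (A.subst σ)
  | _, _, σ, .and A B => .and (A.subst σ) (B.subst σ)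
  | _, _, σ, .or A B => .or (A.subst σ) (B.subst σ)
  | _, _, σ, .imp A B => .imp (A.subst σ) (B.subst σ)
  | _, _, σ, .all F => .all (F.subst (upSubst σ))
  | _, _, σ, .ex F => .ex (F.subst (upSubst σ))
  | _, _, σ, .ball t F => .ball (t.subst σ) (F.subst (upSubst σ))
  | _, _, σ, .bex t F => .bex (t.subst σ) (F.subst (upSubst σ))
  | _, _, σ, .eall s t F => .eall (s.subst σ) (t.subst σ) (F.subst (upSubst σ))
  | _, _, σ, .eex s t F => .eex (s.subst σ) (t.subst σ) (F.subst (upSubst σ))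

/-- `F.app t` is `F(t)`, for a formula `F(x)` with one designated variable. -/
def Fml.app {m : ℕ} (F : Fml 1) (t : Tm m) : Fml m := F.subst fun _ => t

/-- `G.app₂ s t` is `G(s, t)`, for a formula `G(x, y)`; `x` is `bv 1` and `y` is `bv 0` in `G`. -/
def Fml.app₂ {m : ℕ} (G : Fml 2) (s t : Tm m) : Fml m := G.subst ![t, s]

/-- The free variables of a formula. -/
def Tm.fvs {n : ℕ} : Tm n → Finset ℕ
  | .fv i => {i}
  | .bv _ => ∅

def Fml.fvs : {n : ℕ} → Fml n → Finset ℕ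
  | _, .mem s t => s.fvs ∪ t.fvs
  | _, .neg A => A.fvs
  | _, .and A B => A.fvs ∪ B.fvs
  | _, .or A B => A.fvs ∪ B.fvs
  | _, .imp A B => A.fvs ∪ B.fvs
  | _, .all F => F.fvs
  | _, .ex F => F.fvs
  | _, .ball t F => t.fvs ∪ F.fvs
  | _, .bex t F => t.fvs ∪ F.fvs
  | _, .eall s t F => s.fvs ∪ t.fvs ∪ F.fvs
  | _, .eex s t F => s.fvs ∪ t.fvs ∪ F.fvs

/-- A sentence is a formula without free variables. -/
def IsSentence (A : Formula) : Prop := A.fvs = ∅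

/-- `Δ₀^𝓔`-formulas: no unbounded quantifier occurs. -/
def Fml.IsDelta0 : {n : ℕ} → Fml n → Prop
  | _, .mem _ _ => True
  | _, .neg A => A.IsDelta0
  | _, .and A B => A.IsDelta0 ∧ B.IsDelta0
  | _, .or A B => A.IsDelta0 ∧ B.IsDelta0
  | _, .imp A B => A.IsDelta0 ∧ B.IsDelta0
  | _, .all _ => False
  | _, .ex _ => False
  | _, .ball _ F => F.IsDelta0
  | _, .bex _ F => F.IsDelta0
  | _, .eall _ _ F => F.IsDelta0
  | _, .eex _ _ F => F.IsDelta0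

inductive Polarity : Type
  | sigma
  | pi

def Polarity.dual : Polarity → Polarity
  | .sigma => .pi
  | .pi => .sigma

/-- Simultaneous definition of the `Σ^𝓔`-formulas (`InClass .sigma`) and of the `Π^𝓔`-formulas
(`InClass .pi`). -/
inductive InClass : Polarity → {n : ℕ} → Fml n → Prop
  | delta0 {p : Polarity} {n : ℕ} {A : Fml n} : A.IsDelta0 → InClass p A
  | and {p : Polarity} {n : ℕ} {A B : Fml n} : InClass p A → InClass p B → InClass p (.and A B)
  | or {p : Polarity} {n : ℕ} {A B : Fml n} : InClass p A → InClass p B → InClass p (.or A B)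
  | ball {p : Polarity} {n : ℕ} {t : Tm n} {F : Fml (n + 1)} :
      InClass p F → InClass p (.ball t F)
  | bex {p : Polarity} {n : ℕ} {t : Tm n} {F : Fml (n + 1)} :
      InClass p F → InClass p (.bex t F)
  | eall {p : Polarity} {n : ℕ} {s t : Tm n} {F : Fml (n + 1)} :
      InClass p F → InClass p (.eall s t F)
  | eex {p : Polarity} {n : ℕ} {s t : Tm n} {F : Fml (n + 1)} :
      InClass p F → InClass p (.eex s t F)
  | ex {n : ℕ} {F : Fml (n + 1)} : InClass .sigma F → InClass .sigma (.ex F)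
  | all {n : ℕ} {F : Fml (n + 1)} : InClass .pi F → InClass .pi (.all F)
  | neg {p : Polarity} {n : ℕ} {C : Fml n} : InClass p.dual C → InClass p (.neg C)
  | imp {p : Polarity} {n : ℕ} {C A : Fml n} :
      InClass p.dual C → InClass p A → InClass p (.imp C A)

/-- `Σ^𝓔`-formulas. -/
def IsSigma (A : Formula) : Prop := InClass .sigma A

/-! ### Defined formulas -/

/-- `s = t`, i.e. `(∀x ∈ s)(x ∈ t) ∧ (∀x ∈ t)(x ∈ s)`. -/
def eqF {n : ℕ} (s t : Tm n) : Fml n :=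
  .and (.ball s (.mem (.bv 0) t.shift)) (.ball t (.mem (.bv 0) s.shift))

/-- `u = {y, z}`. -/
def upairF {n : ℕ} (u y z : Tm n) : Fml n :=
  .and (.mem y u) (.and (.mem z u) (.ball u (.or (eqF (.bv 0) y.shift) (eqF (.bv 0) z.shift))))

/-- `w = (y, z)`, with `(y, z) = {{y, z}, {y}}`: for some `u, v ∈ w`, `u = {y, z}`, `v = {y}` and
each `r ∈ w` is `u` or `v`. -/
def opairF {n : ℕ} (w y z : Tm n) : Fml n :=
  .bex w (.bex w.shift (.and (upairF (.bv 1) y.shift.shift z.shift.shift)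
    (.and (upairF (.bv 0) y.shift.shift y.shift.shift)
      (.ball w.shift.shift (.or (eqF (.bv 0) (.bv 2)) (eqF (.bv 0) (.bv 1)))))))

/-- `(y, z) ∈ x`. -/
def opairMemF {n : ℕ} (y z x : Tm n) : Fml n := .bex x (opairF (.bv 0) y.shift z.shift)

/-- `fun(x, a, b)`: `x ⊆ a × b`, `(∀y ∈ a)(∃z ∈ b) (y, z) ∈ x`, and
`(∀y ∈ a)(∀z₁ ∈ b)(∀z₂ ∈ b)[(y, z₁) ∈ x ∧ (y, z₂) ∈ x → z₁ = z₂]`. -/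
def funF {n : ℕ} (x a b : Tm n) : Fml n :=
  .and (.ball x (.bex a.shift (.bex b.shift.shift (opairF (.bv 2) (.bv 1) (.bv 0)))))
    (.and (.ball a (.bex b.shift (opairMemF (.bv 1) (.bv 0) x.shift.shift)))
      (.ball a (.ball b.shift (.ball b.shift.shift
        (.imp
          (.and (opairMemF (.bv 2) (.bv 1) x.shift.shift.shift)
            (opairMemF (.bv 2) (.bv 0) x.shift.shift.shift))
          (eqF (.bv 1) (.bv 0)))))))

/-! ### The axioms -/

/-- `a = b ∧ B(a) → B(b)`. -/
def extAx (a b : ℕ) (B : Fml 1) : Formula :=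
  .imp (.and (eqF (.fv a) (.fv b)) (B.app (.fv a))) (B.app (.fv b))

/-- `∃x[a ∈ x ∧ b ∈ x]`. -/
def pairAx (a b : ℕ) : Formula := .ex (.and (.mem (.fv a) (.bv 0)) (.mem (.fv b) (.bv 0)))

/-- `∃x(∀y ∈ a)(∀z ∈ y)(z ∈ x)`. -/
def unionAx (a : ℕ) : Formula :=
  .ex (.ball (.fv a) (.ball (.bv 0) (.mem (.bv 0) (.bv 2))))

/-- `∃x[(∃y ∈ x) y ∈ x ∧ (∀y ∈ x)(∃z ∈ x) y ∈ z]`. -/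
def infAx : Formula :=
  .ex (.and (.bex (.bv 0) (.mem (.bv 0) (.bv 1)))
    (.ball (.bv 0) (.bex (.bv 1) (.mem (.bv 1) (.bv 0)))))

/-- `∃x((∀y ∈ x)(y ∈ a ∧ A(y)) ∧ (∀y ∈ a)(A(y) → y ∈ x))`. -/
def sepAx (a : ℕ) (A : Fml 1) : Formula :=
  .ex (.and (.ball (.bv 0) (.and (.mem (.bv 0) (.fv a)) (A.app (.bv 0))))
    (.ball (.fv a) (.imp (A.app (.bv 0)) (.mem (.bv 0) (.bv 1)))))

/-- `(∀x ∈ a)∃y B(x, y) → ∃z(∀x ∈ a)(∃y ∈ z)B(x, y)`. -/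
def collAx (a : ℕ) (B : Fml 2) : Formula :=
  .imp (.ball (.fv a) (.ex (B.app₂ (.bv 1) (.bv 0))))
    (.ex (.ball (.fv a) (.bex (.bv 1) (B.app₂ (.bv 1) (.bv 0)))))

/-- `∀u[(∀x ∈ u)G(x) → G(u)] → ∀u G(u)`. -/
def indAx (G : Fml 1) : Formula :=
  .imp (.all (.imp (.ball (.bv 0) (G.app (.bv 0))) (G.app (.bv 0)))) (.all (G.app (.bv 0)))

/-- `∃z(∀x ∈ ᵃb)(x ∈ z)`. -/
def expAx (a b : ℕ) : Formula := .ex (.eall (.fv a) (.fv b) (.mem (.bv 0) (.bv 1)))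

/-! ### Derivations -/

/-- The variable `c` does not occur in the sequent `Γ ⇒ Δ`. -/
def Fresh (c : ℕ) (Γ : Finset Formula) (Δ : Option Formula) : Prop :=
  (∀ A ∈ Γ, c ∉ A.fvs) ∧ ∀ A ∈ Δ, c ∉ A.fvs

/-- Derivations of the intuitionistic sequent `Γ ⇒ Δ` in `IKP(𝓔)`: `Γ` is a finite set of formulas
and `Δ` has at most one element. -/
inductive Deriv : Finset Formula → Option Formula → Type
  -- axioms
  | logical (Γ : Finset Formula) (A : Formula) (h : A.IsDelta0) : Deriv (insert A Γ) (some A)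
  | ext (Γ : Finset Formula) (a b : ℕ) (B : Fml 1) (h : B.IsDelta0) : Deriv Γ (some (extAx a b B))
  | pair (Γ : Finset Formula) (a b : ℕ) : Deriv Γ (some (pairAx a b))
  | union (Γ : Finset Formula) (a : ℕ) : Deriv Γ (some (unionAx a))
  | infinity (Γ : Finset Formula) : Deriv Γ (some infAx)
  | sep (Γ : Finset Formula) (a : ℕ) (A : Fml 1) (h : A.IsDelta0) : Deriv Γ (some (sepAx a A))
  | coll (Γ : Finset Formula) (a : ℕ) (B : Fml 2) (h : B.IsDelta0) : Deriv Γ (some (collAx a B))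
  | ind (Γ : Finset Formula) (G : Fml 1) : Deriv Γ (some (indAx G))
  | exp (Γ : Finset Formula) (a b : ℕ) : Deriv Γ (some (expAx a b))
  -- propositional rules
  | andL₁ (Γ : Finset Formula) (Δ : Option Formula) (A B : Formula)
      (d : Deriv (insert A Γ) Δ) : Deriv (insert (.and A B) Γ) Δ
  | andL₂ (Γ : Finset Formula) (Δ : Option Formula) (A B : Formula)
      (d : Deriv (insert B Γ) Δ) : Deriv (insert (.and A B) Γ) Δ
  | andR (Γ : Finset Formula) (A B : Formula)
      (d : Deriv Γ (some A)) (e : Deriv Γ (some B)) : Deriv Γ (some (.and A B))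
  | orL (Γ : Finset Formula) (Δ : Option Formula) (A B : Formula)
      (d : Deriv (insert A Γ) Δ) (e : Deriv (insert B Γ) Δ) : Deriv (insert (.or A B) Γ) Δ
  | orR₁ (Γ : Finset Formula) (A B : Formula) (d : Deriv Γ (some A)) : Deriv Γ (some (.or A B))
  | orR₂ (Γ : Finset Formula) (A B : Formula) (d : Deriv Γ (some B)) : Deriv Γ (some (.or A B))
  | negL (Γ : Finset Formula) (A : Formula) (d : Deriv Γ (some A)) : Deriv (insert (.neg A) Γ) none
  | negR (Γ : Finset Formula) (A : Formula) (d : Deriv (insert A Γ) none) : Deriv Γ (some (.neg A))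
  | bot (Γ : Finset Formula) (A : Formula) (d : Deriv Γ none) : Deriv Γ (some A)
  | impL (Γ : Finset Formula) (Δ : Option Formula) (A B : Formula)
      (d : Deriv (insert B Γ) Δ) (e : Deriv Γ (some A)) : Deriv (insert (.imp A B) Γ) Δ
  | impR (Γ : Finset Formula) (A B : Formula)
      (d : Deriv (insert A Γ) (some B)) : Deriv Γ (some (.imp A B))
  -- rules for the bounded quantifiers
  | bexL (Γ : Finset Formula) (Δ : Option Formula) (a b : ℕ) (F : Fml 1)
      (h : Fresh a (insert (.bex (.fv b) F) Γ) Δ)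
      (d : Deriv (insert (.and (.mem (.fv a) (.fv b)) (F.app (.fv a))) Γ) Δ) :
      Deriv (insert (.bex (.fv b) F) Γ) Δ
  | bexR (Γ : Finset Formula) (a b : ℕ) (F : Fml 1)
      (d : Deriv Γ (some (.and (.mem (.fv a) (.fv b)) (F.app (.fv a))))) :
      Deriv Γ (some (.bex (.fv b) F))
  | ballL (Γ : Finset Formula) (Δ : Option Formula) (a b : ℕ) (F : Fml 1)
      (d : Deriv (insert (.imp (.mem (.fv a) (.fv b)) (F.app (.fv a))) Γ) Δ) :
      Deriv (insert (.ball (.fv b) F) Γ) Δ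
  | ballR (Γ : Finset Formula) (a b : ℕ) (F : Fml 1)
      (h : Fresh a Γ (some (.ball (.fv b) F)))
      (d : Deriv Γ (some (.imp (.mem (.fv a) (.fv b)) (F.app (.fv a))))) :
      Deriv Γ (some (.ball (.fv b) F))
  -- rules for the unbounded quantifiers
  | exL (Γ : Finset Formula) (Δ : Option Formula) (a : ℕ) (F : Fml 1)
      (h : Fresh a (insert (.ex F) Γ) Δ)
      (d : Deriv (insert (F.app (.fv a)) Γ) Δ) : Deriv (insert (.ex F) Γ) Δ
  | exR (Γ : Finset Formula) (a : ℕ) (F : Fml 1)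
      (d : Deriv Γ (some (F.app (.fv a)))) : Deriv Γ (some (.ex F))
  | allL (Γ : Finset Formula) (Δ : Option Formula) (a : ℕ) (F : Fml 1)
      (d : Deriv (insert (F.app (.fv a)) Γ) Δ) : Deriv (insert (.all F) Γ) Δ
  | allR (Γ : Finset Formula) (a : ℕ) (F : Fml 1)
      (h : Fresh a Γ (some (.all F)))
      (d : Deriv Γ (some (F.app (.fv a)))) : Deriv Γ (some (.all F))
  -- rules for the exponentiation bounded quantifiers
  | eexL (Γ : Finset Formula) (Δ : Option Formula) (c a b : ℕ) (F : Fml 1)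
      (h : Fresh c (insert (.eex (.fv a) (.fv b) F) Γ) Δ)
      (d : Deriv (insert (.and (funF (.fv c) (.fv a) (.fv b)) (F.app (.fv c))) Γ) Δ) :
      Deriv (insert (.eex (.fv a) (.fv b) F) Γ) Δ
  | eexR (Γ : Finset Formula) (c a b : ℕ) (F : Fml 1)
      (d : Deriv Γ (some (.and (funF (.fv c) (.fv a) (.fv b)) (F.app (.fv c))))) :
      Deriv Γ (some (.eex (.fv a) (.fv b) F))
  | eallL (Γ : Finset Formula) (Δ : Option Formula) (c a b : ℕ) (F : Fml 1)
      (d : Deriv (insert (.imp (funF (.fv c) (.fv a) (.fv b)) (F.app (.fv c))) Γ) Δ) :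
      Deriv (insert (.eall (.fv a) (.fv b) F) Γ) Δ
  | eallR (Γ : Finset Formula) (c a b : ℕ) (F : Fml 1)
      (h : Fresh c Γ (some (.eall (.fv a) (.fv b) F)))
      (d : Deriv Γ (some (.imp (funF (.fv c) (.fv a) (.fv b)) (F.app (.fv c))))) :
      Deriv Γ (some (.eall (.fv a) (.fv b) F))
  -- cut
  | cut (Γ : Finset Formula) (Δ : Option Formula) (A : Formula)
      (d : Deriv Γ (some A)) (e : Deriv (insert A Γ) Δ) : Deriv Γ Δ

/-! ### Gödel numbers -/

/-- The code of a finite sequence of natural numbers. -/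
def seqCode (l : List ℕ) : ℕ := Encodable.encode l

def Tm.code {n : ℕ} : Tm n → ℕ
  | .fv i => seqCode [0, i]
  | .bv k => seqCode [1, k.val]

def Fml.code : {n : ℕ} → Fml n → ℕ
  | _, .mem s t => seqCode [0, s.code, t.code]
  | _, .neg A => seqCode [1, A.code]
  | _, .and A B => seqCode [2, A.code, B.code]
  | _, .or A B => seqCode [3, A.code, B.code]
  | _, .imp A B => seqCode [4, A.code, B.code]
  | _, .all F => seqCode [5, F.code]
  | _, .ex F => seqCode [6, F.code]
  | _, .ball t F => seqCode [7, t.code, F.code]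
  | _, .bex t F => seqCode [8, t.code, F.code]
  | _, .eall s t F => seqCode [9, s.code, t.code, F.code]
  | _, .eex s t F => seqCode [10, s.code, t.code, F.code]

/-- The canonical index of a finite set of formulas. -/
def setCode (Γ : Finset Formula) : ℕ := ∑ A ∈ Γ, 2 ^ A.code

def optCode : Option Formula → ℕ
  | none => 0
  | some A => A.code + 1

/-- The Gödel number of a derivation: the rule of the last inference, the data of its instance and
the Gödel numbers of the derivations of its premises. -/
def Deriv.code : {Γ : Finset Formula} → {Δ : Option Formula} → Deriv Γ Δ → ℕ
  | _, _, .logical Γ A _ => seqCode [0, setCode Γ, A.code]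
  | _, _, .ext Γ a b B _ => seqCode [1, setCode Γ, a, b, B.code]
  | _, _, .pair Γ a b => seqCode [2, setCode Γ, a, b]
  | _, _, .union Γ a => seqCode [3, setCode Γ, a]
  | _, _, .infinity Γ => seqCode [4, setCode Γ]
  | _, _, .sep Γ a A _ => seqCode [5, setCode Γ, a, A.code]
  | _, _, .coll Γ a B _ => seqCode [6, setCode Γ, a, B.code]
  | _, _, .ind Γ G => seqCode [7, setCode Γ, G.code]
  | _, _, .exp Γ a b => seqCode [8, setCode Γ, a, b]
  | _, _, .andL₁ Γ Δ A B d => seqCode [9, setCode Γ, optCode Δ, A.code, B.code, d.code]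
  | _, _, .andL₂ Γ Δ A B d => seqCode [10, setCode Γ, optCode Δ, A.code, B.code, d.code]
  | _, _, .andR Γ A B d e => seqCode [11, setCode Γ, A.code, B.code, d.code, e.code]
  | _, _, .orL Γ Δ A B d e => seqCode [12, setCode Γ, optCode Δ, A.code, B.code, d.code, e.code]
  | _, _, .orR₁ Γ A B d => seqCode [13, setCode Γ, A.code, B.code, d.code]
  | _, _, .orR₂ Γ A B d => seqCode [14, setCode Γ, A.code, B.code, d.code]
  | _, _, .negL Γ A d => seqCode [15, setCode Γ, A.code, d.code]
  | _, _, .negR Γ A d => seqCode [16, setCode Γ, A.code, d.code]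
  | _, _, .bot Γ A d => seqCode [17, setCode Γ, A.code, d.code]
  | _, _, .impL Γ Δ A B d e => seqCode [18, setCode Γ, optCode Δ, A.code, B.code, d.code, e.code]
  | _, _, .impR Γ A B d => seqCode [19, setCode Γ, A.code, B.code, d.code]
  | _, _, .bexL Γ Δ a b F _ d => seqCode [20, setCode Γ, optCode Δ, a, b, F.code, d.code]
  | _, _, .bexR Γ a b F d => seqCode [21, setCode Γ, a, b, F.code, d.code]
  | _, _, .ballL Γ Δ a b F d => seqCode [22, setCode Γ, optCode Δ, a, b, F.code, d.code]
  | _, _, .ballR Γ a b F _ d => seqCode [23, setCode Γ, a, b, F.code, d.code]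
  | _, _, .exL Γ Δ a F _ d => seqCode [24, setCode Γ, optCode Δ, a, F.code, d.code]
  | _, _, .exR Γ a F d => seqCode [25, setCode Γ, a, F.code, d.code]
  | _, _, .allL Γ Δ a F d => seqCode [26, setCode Γ, optCode Δ, a, F.code, d.code]
  | _, _, .allR Γ a F _ d => seqCode [27, setCode Γ, a, F.code, d.code]
  | _, _, .eexL Γ Δ c a b F _ d => seqCode [28, setCode Γ, optCode Δ, c, a, b, F.code, d.code]
  | _, _, .eexR Γ c a b F d => seqCode [29, setCode Γ, c, a, b, F.code, d.code]
  | _, _, .eallL Γ Δ c a b F d => seqCode [30, setCode Γ, optCode Δ, c, a, b, F.code, d.code]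
  | _, _, .eallR Γ c a b F _ d => seqCode [31, setCode Γ, c, a, b, F.code, d.code]
  | _, _, .cut Γ Δ A d e => seqCode [32, setCode Γ, optCode Δ, A.code, d.code, e.code]

/-! ### Ordinals and ordinal terms -/

/-- `Ω = ℵ₁`. -/
noncomputable def Om : Ordinal.{0} := Ordinal.omega 1

/-- The closure of `{0, Ω}` under `+`, the Veblen function `φ` and `ξ ↦ p ξ` for `ξ < α`. -/
inductive Clos (α : Ordinal.{0}) (p : ∀ ξ : Ordinal.{0}, ξ < α → Ordinal.{0}) :
    Ordinal.{0} → Prop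
  | zero : Clos α p 0
  | Omega : Clos α p Om
  | add {ξ η : Ordinal.{0}} : Clos α p ξ → Clos α p η → Clos α p (ξ + η)
  | phi {ξ η : Ordinal.{0}} : Clos α p ξ → Clos α p η → Clos α p (Ordinal.veblen ξ η)
  | psi {ξ : Ordinal.{0}} (h : ξ < α) : Clos α p ξ → Clos α p (p ξ h)

/-- The collapsing function `ψ_Ω`: `psi α` is the least `ρ < Ω` outside `B^Ω(α)`. -/
noncomputable def psi (α : Ordinal.{0}) : Ordinal.{0} :=
  sInf {ρ | ρ < Om ∧ ¬ Clos α (fun ξ _ => psi ξ) ρ}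
termination_by α

/-- The set `B^Ω(α)`. -/
def BSet (α : Ordinal.{0}) : Set Ordinal.{0} := {ρ | Clos α (fun ξ _ => psi ξ) ρ}

/-- `ε_{Ω+1}`: the least `η > Ω` with `ω^η = η`. -/
noncomputable def epsOm : Ordinal.{0} := sInf {η | Om < η ∧ Ordinal.omega0 ^ η = η}

/-- Terms built from `0`, `Ω` by `+`, `φ`, `ψ_Ω`. -/
inductive OTerm : Type
  | zero : OTerm
  | Omega : OTerm
  | add (s t : OTerm) : OTerm
  | phi (s t : OTerm) : OTerm
  | psi (t : OTerm) : OTerm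

/-- The ordinal denoted by a term. -/
noncomputable def OTerm.val : OTerm → Ordinal.{0}
  | .zero => 0
  | .Omega => Om
  | .add s t => s.val + t.val
  | .phi s t => Ordinal.veblen s.val t.val
  | .psi t => IKPE.psi t.val

/-- The terms of the notation system for `B^Ω(ε_{Ω+1})`, i.e. the terms in normal form: a sum
`s + t` has `s` additively indecomposable, `t ≠ 0` and `s` not absorbed by `t`; in `φ s t` both
arguments are smaller than the value; `ψ t` has its argument below `ε_{Ω+1}` and in
`B^Ω` of itself. -/
def OTerm.IsNF : OTerm → Prop
  | .zero => True
  | .Omega => True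
  | .add s t => s.IsNF ∧ t.IsNF ∧ Ordinal.IsPrincipal (· + ·) s.val ∧ t.val ≠ 0 ∧
      t.val < s.val + t.val
  | .phi s t => s.IsNF ∧ t.IsNF ∧ s.val < Ordinal.veblen s.val t.val ∧
      t.val < Ordinal.veblen s.val t.val
  | .psi t => t.IsNF ∧ t.val < epsOm ∧ t.val ∈ BSet t.val

/-- The Gödel number of an ordinal term. -/
def OTerm.code : OTerm → ℕ
  | .zero => seqCode [0]
  | .Omega => seqCode [1]
  | .add s t => seqCode [2, s.code, t.code]
  | .phi s t => seqCode [3, s.code, t.code]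
  | .psi t => seqCode [4, t.code]

/-! ### Satisfaction and the exponentiation hierarchy -/

def Tm.eval {n : ℕ} (v : ℕ → ZFSet.{0}) (e : Fin n → ZFSet.{0}) : Tm n → ZFSet.{0}
  | .fv i => v i
  | .bv k => e k

/-- Satisfaction in the structure `⟨M, ∈⟩`: all quantifiers range over elements of `M`. The free
variables are interpreted by `v` and the dangling bound variables by `e`; `ZFSet.IsFunc a b x` says
that `x` is a function from `a` to `b`. -/
def Sat (M : Set ZFSet.{0}) (v : ℕ → ZFSet.{0}) : {n : ℕ} → (Fin n → ZFSet.{0}) → Fml n → Prop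
  | _, e, .mem s t => s.eval v e ∈ t.eval v e
  | _, e, .neg A => ¬ Sat M v e A
  | _, e, .and A B => Sat M v e A ∧ Sat M v e B
  | _, e, .or A B => Sat M v e A ∨ Sat M v e B
  | _, e, .imp A B => Sat M v e A → Sat M v e B
  | _, e, .all F => ∀ x ∈ M, Sat M v (Fin.cons x e) F
  | _, e, .ex F => ∃ x ∈ M, Sat M v (Fin.cons x e) F
  | _, e, .ball t F => ∀ x ∈ M, x ∈ t.eval v e → Sat M v (Fin.cons x e) F
  | _, e, .bex t F => ∃ x ∈ M, x ∈ t.eval v e ∧ Sat M v (Fin.cons x e) F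
  | _, e, .eall s t F =>
      ∀ x ∈ M, ZFSet.IsFunc (s.eval v e) (t.eval v e) x → Sat M v (Fin.cons x e) F
  | _, e, .eex s t F =>
      ∃ x ∈ M, ZFSet.IsFunc (s.eval v e) (t.eval v e) x ∧ Sat M v (Fin.cons x e) F

/-- `M ⊨ A`. For a sentence `A` the interpretation of the free variables plays no role. -/
def Models (M : Set ZFSet.{0}) (A : Formula) : Prop := Sat M (fun _ => ∅) Fin.elim0 A

/-- `X` is definable over `⟨M, ∈⟩` with parameters (the values in `M` of the free variables). -/
def DefinableOver (M : Set ZFSet.{0}) (X : ZFSet.{0}) : Prop :=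
  ∃ (F : Fml 1) (v : ℕ → ZFSet.{0}), (∀ i ∈ F.fvs, v i ∈ M) ∧
    ∀ x, x ∈ X ↔ x ∈ M ∧ Sat M v (fun _ => x) F

/-- The exponentiation hierarchy: `E_0 = ∅`; `E_{α+1}` consists of the sets definable over `E_α`
with parameters and, if `α = β + 1`, of the functions between elements of `E_β`;
`E_λ = ⋃_{β<λ} E_β` for limits `λ`. -/
def EHier (α : Ordinal.{0}) : Set ZFSet.{0} :=
  {X | (∃ β, ∃ _ : α = β + 1, DefinableOver (EHier β) X) ∨
    (∃ β, ∃ _ : α = β + 2, ∃ a ∈ EHier β, ∃ b ∈ EHier β, ZFSet.IsFunc a b X) ∨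
    (Order.IsSuccLimit α ∧ ∃ β, ∃ _ : β < α, X ∈ EHier β)}
termination_by α
decreasing_by all_goals (subst_vars; first | assumption | simp)

end IKPE

namespace IKPE

open Ordinal

/-! ### The collapsing function -/

/-! The derivation is read classically, in the universe of sets. At suitable stages the
exponentiation hierarchy is the cumulative hierarchy: a subset of E_μ has a characteristic function,
all functions between available sets are put in, and the subset is definable from its characteristic
function. It therefore appears finitely many stages after μ (`subset_mem_EHier`), and E_ξ = V_ξ for
every countable epsilon number ξ (`EHier_eq_of_good`). So it suffices to make A true in V_ξ for a
suitable value ξ of `psi`. In V_ξ the exponentiation bounded quantifiers are bounded quantifiers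
over a set of functions, and Exponentiation is simply true.

The bound comes from an ordinal analysis with controlled derivations. `Der` is a one-sided classical
infinitary calculus whose parameters are sets and whose control ξ bounds their ranks. Set Induction
at a set is derivable by recursion on its rank, with height below Ω, so every finite derivation
becomes an infinitary one of height Ω + m with finite cut rank (`embeds_of_deriv`). Cut elimination
(`Der.elim`) costs one exponential per rank and stops at cut formulas that are bounded or have one
unbounded quantifier in front of a bounded matrix; these must stay because of the collection rule.

`Der.collapse` reads truth off what remains: a sequent of Σ-formulas derived with height α contains
a formula true in V_δ, where δ = ψ(γ + ω^α). A bounded conjunction may have uncountably many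
premises, but no supremum is taken: each height is controlled separately and `psi` is monotone. A
remaining unbounded cut is resolved by collapsing the existential premise, which yields a witness,
and then collapsing the universal premise inverted at that witness.

Computability needs no decoding. The Gödel number of a derivation exceeds the depth of all its cut
formulas, and Ω + m ≤ ω^(Ω+1) whatever m is, so a tower of exponentials whose height is the Gödel
number plus two is large enough. -/

theorem OTerm.code_injective : Function.Injective OTerm.code := by
  intro s
  induction s with
  | zero => intro t h; cases t <;> simp_all [OTerm.code, seqCode]
  | Omega => intro t h; cases t <;> simp_all [OTerm.code, seqCode]
  | add a b iha ihb =>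
    intro t h
    cases t <;> simp [OTerm.code, seqCode] at h
    rw [iha h.1, ihb h.2]
  | phi a b iha ihb =>
    intro t h
    cases t <;> simp [OTerm.code, seqCode] at h
    rw [iha h.1, ihb h.2]
  | psi a iha =>
    intro t h
    cases t <;> simp [OTerm.code, seqCode] at h
    rw [iha h]

instance : Countable OTerm := OTerm.code_injective.countable

/-- The closure is generated from two constants by finitary operations that all have term
counterparts. The terms need not be normal, since only countability of `BSet α` is wanted. -/
theorem exists_val_eq {α ρ : Ordinal.{0}} (h : ρ ∈ BSet α) : ∃ t : OTerm, t.val = ρ := by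
  induction (show Clos α (fun ξ _ => psi ξ) ρ from h) with
  | zero => exact ⟨.zero, rfl⟩
  | Omega => exact ⟨.Omega, rfl⟩
  | add h1 h2 ih1 ih2 =>
    obtain ⟨s, rfl⟩ := ih1 h1
    obtain ⟨t, rfl⟩ := ih2 h2
    exact ⟨.add s t, rfl⟩
  | phi h1 h2 ih1 ih2 =>
    obtain ⟨s, rfl⟩ := ih1 h1
    obtain ⟨t, rfl⟩ := ih2 h2
    exact ⟨.phi s t, rfl⟩
  | psi hlt h1 ih1 =>
    obtain ⟨s, rfl⟩ := ih1 h1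
    exact ⟨.psi s, rfl⟩

theorem Om_isPrincipal_add : IsPrincipal (· + ·) Om := Ordinal.isPrincipal_add_omega 1

theorem omega0_lt_Om : ω < Om := Ordinal.omega0_lt_omega_one

/-- A countable closure cannot exhaust Ω. This makes the infimum defining `psi` one over a nonempty
set. -/
theorem exists_lt_Om_notMem (α : Ordinal.{0}) : ∃ ρ, ρ < Om ∧ ρ ∉ BSet α := by
  by_contra! h
  -- Terms with value at least Ω are sent to 0, so that the supremum of this countable family stays
  -- below Ω.
  let g : OTerm → Ordinal.{0} := fun t => if t.val < Om then t.val else 0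
  have hg : (⨆ t, g t) < Om := by
    refine Ordinal.iSup_lt_omega_one fun t => ?_
    change g t < Om
    by_cases ht : t.val < Om
    · simp only [g, if_pos ht, ht]
    · simpa [g, ht] using omega0_pos.trans omega0_lt_Om
  have hg' : (⨆ t, g t) + 1 < Om :=
    Om_isPrincipal_add hg (one_lt_omega0.trans omega0_lt_Om)
  obtain ⟨t, ht⟩ := exists_val_eq (h _ hg')
  have : g t ≤ ⨆ t, g t := Ordinal.le_iSup g t
  have h2 : g t = (⨆ t, g t) + 1 := by
    simp only [g]; rw [if_pos (by rw [ht]; exact hg'), ht]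
  rw [h2] at this
  exact absurd this (not_le.2 (lt_add_one _))

theorem psi_spec (α : Ordinal.{0}) : psi α < Om ∧ psi α ∉ BSet α := by
  have h := csInf_mem (s := {ρ | ρ < Om ∧ ρ ∉ BSet α}) (exists_lt_Om_notMem α)
  have e : psi α = sInf {ρ | ρ < Om ∧ ρ ∉ BSet α} := by rw [psi]; rfl
  rwa [← e] at h

theorem psi_lt_Om (α : Ordinal.{0}) : psi α < Om := (psi_spec α).1

theorem psi_notMem (α : Ordinal.{0}) : psi α ∉ BSet α := (psi_spec α).2

theorem mem_BSet_of_lt_psi {α ρ : Ordinal.{0}} (h : ρ < psi α) : ρ ∈ BSet α := by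
  by_contra hn
  have : psi α ≤ ρ := by
    rw [psi]
    exact csInf_le' ⟨h.trans (psi_lt_Om α), hn⟩
  exact absurd h (not_lt.2 this)

theorem BSet_mono {α β : Ordinal.{0}} (h : α ≤ β) : BSet α ⊆ BSet β := by
  intro ρ hρ
  induction (show Clos α (fun ξ _ => psi ξ) ρ from hρ) with
  | zero => exact Clos.zero
  | Omega => exact Clos.Omega
  | add h1 h2 ih1 ih2 => exact Clos.add (ih1 h1) (ih2 h2)
  | phi h1 h2 ih1 ih2 => exact Clos.phi (ih1 h1) (ih2 h2)
  | psi hlt h1 ih1 => exact Clos.psi (p := fun ξ _ => psi ξ) (hlt.trans_le h) (ih1 h1)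

theorem psi_mono {α β : Ordinal.{0}} (h : α ≤ β) : psi α ≤ psi β := by
  by_contra! hn
  exact psi_notMem β (BSet_mono h (mem_BSet_of_lt_psi hn))

theorem psi_isPrincipal_add (α : Ordinal.{0}) : IsPrincipal (· + ·) (psi α) := by
  refine isPrincipal_add_iff_add_lt_ne_self.2 fun b hb c hc h => psi_notMem α ?_
  rw [← h]
  exact Clos.add (mem_BSet_of_lt_psi hb) (mem_BSet_of_lt_psi hc)

theorem psi_ne_zero (α : Ordinal.{0}) : psi α ≠ 0 := fun h =>
  psi_notMem α (h ▸ Clos.zero)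

/-- An additively principal ψ(α) is some ω^μ; if μ were smaller than ψ(α), it would lie in the
closure, and so would ψ(α). -/
theorem omega0_opow_psi (α : Ordinal.{0}) : ω ^ psi α = psi α := by
  rcases isPrincipal_add_iff_zero_or_omega0_opow.1 (psi_isPrincipal_add α) with h | ⟨μ, h⟩
  · exact absurd h (psi_ne_zero α)
  · change ω ^ μ = psi α at h
    rcases (right_le_opow μ one_lt_omega0).lt_or_eq with hlt | heq
    · exfalso
      refine psi_notMem α ?_
      have := Clos.phi (α := α) (p := fun ξ _ => psi ξ) Clos.zero (mem_BSet_of_lt_psi (h ▸ hlt))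
      rwa [veblen_zero_apply, h] at this
    · rw [h] at heq
      rw [← heq, h, heq]

theorem veblen_lt_psi {α ξ η : Ordinal.{0}} (hξ : ξ < psi α) (hη : η < psi α) :
    veblen ξ η < psi α := by
  set δ := psi α with hδ
  have h := veblen_invVeblen₁_invVeblen₂ δ
  rw [omega0_opow_psi α] at h
  have h2 : invVeblen₂ δ < δ := by
    have := invVeblen₂_lt δ
    rwa [omega0_opow_psi α] at this
  rcases (invVeblen₁_le δ).lt_or_eq with h1 | h1
  · exact absurd (h ▸ Clos.phi (mem_BSet_of_lt_psi h1) (mem_BSet_of_lt_psi h2)) (psi_notMem α)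
  -- In the remaining case the Veblen normal form of δ has first component δ itself, so δ is
  -- strongly critical: φ(δ, 0) = δ.
  · rw [h1] at h
    have h3 : veblen δ 0 = δ := by
      refine le_antisymm ?_ (left_le_veblen _ _)
      exact (veblen_le_veblen_iff_right.2 zero_le).trans_eq h
    rw [← h3] at hη ⊢
    exact veblen_lt_veblen_iff.2 (Or.inr (Or.inl ⟨hξ, hη⟩))

/-- With `mem_BSet_of_lt_psi` this says that the countable part of `BSet α` is exactly the initial
segment ψ(α). -/
theorem lt_psi_of_mem {α ρ : Ordinal.{0}} (h : ρ ∈ BSet α) (hρ : ρ < Om) : ρ < psi α := by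
  induction (show Clos α (fun ξ _ => psi ξ) ρ from h) with
  | zero => exact pos_iff_ne_zero.2 (psi_ne_zero α)
  | Omega => exact absurd hρ (lt_irrefl _)
  | add h1 h2 ih1 ih2 =>
    exact psi_isPrincipal_add α (ih1 h1 (le_self_add.trans_lt hρ))
      (ih2 h2 (le_add_self.trans_lt hρ))
  | phi h1 h2 ih1 ih2 =>
    exact veblen_lt_psi (ih1 h1 ((left_le_veblen _ _).trans_lt hρ))
      (ih2 h2 ((right_le_veblen _ _).trans_lt hρ))
  | psi hlt h1 ih1 =>
    refine lt_of_le_of_ne (psi_mono hlt.le) fun he => psi_notMem α ?_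
    rw [← he]
    exact Clos.psi (p := fun ξ _ => psi ξ) hlt h1

/-- In general `psi` is only weakly monotone; strictness needs the smaller argument in the closure.
This is why the heights of infinitary derivations have to be controlled. -/
theorem psi_lt_psi {α β : Ordinal.{0}} (h : α < β) (hα : α ∈ BSet β) : psi α < psi β :=
  lt_psi_of_mem (Clos.psi (p := fun ξ _ => psi ξ) h hα) (psi_lt_Om α)

theorem opow_mem_BSet {α ρ : Ordinal.{0}} (h : ρ ∈ BSet α) : ω ^ ρ ∈ BSet α := by
  rw [← veblen_zero_apply]
  exact Clos.phi Clos.zero h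

theorem add_mem_BSet {α ρ σ : Ordinal.{0}} (h : ρ ∈ BSet α) (h' : σ ∈ BSet α) :
    ρ + σ ∈ BSet α := Clos.add h h'

theorem one_mem_BSet (α : Ordinal.{0}) : 1 ∈ BSet α := by
  simpa using opow_mem_BSet (α := α) Clos.zero

/-- The countable epsilon numbers. -/
structure Good (ξ : Ordinal.{0}) : Prop where
  lt_Om : ξ < Om
  omega0_lt : ω < ξ
  add : ∀ {a b}, a < ξ → b < ξ → a + b < ξ
  opow : ∀ {a}, a < ξ → ω ^ a < ξ

theorem good_psi (α : Ordinal.{0}) : Good (psi α) where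
  lt_Om := psi_lt_Om α
  omega0_lt := by
    refine lt_psi_of_mem ?_ omega0_lt_Om
    simpa using opow_mem_BSet (one_mem_BSet α)
  add h h' := psi_isPrincipal_add α h h'
  opow {a} h := by
    conv_rhs => rw [← omega0_opow_psi α]
    exact (opow_lt_opow_iff_right one_lt_omega0).2 h

theorem Good.one_lt {ξ : Ordinal.{0}} (h : Good ξ) : 1 < ξ := one_lt_omega0.trans h.omega0_lt

theorem Good.pos {ξ : Ordinal.{0}} (h : Good ξ) : 0 < ξ := zero_lt_one.trans h.one_lt

theorem Good.add_one {ξ a : Ordinal.{0}} (h : Good ξ) (ha : a < ξ) : a + 1 < ξ := h.add ha h.one_lt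

/-! ### Towers of exponentials -/

/-- The term for `Ω + 1`, under `n` exponentials with base `ω`. -/
def towerTerm : ℕ → OTerm
  | 0 => .add .Omega (.phi .zero .zero)
  | n + 1 => .phi .zero (towerTerm n)

theorem towerTerm_zero_val : (towerTerm 0).val = Om + 1 := by
  simp [towerTerm, OTerm.val]

theorem towerTerm_succ_val (n : ℕ) : (towerTerm (n + 1)).val = ω ^ (towerTerm n).val := by
  simp [towerTerm, OTerm.val]

/-- The towers are built without `psi`, so they lie in every closure. This yields both the normal
form of ψ applied to a tower and the strict bound below ψ(ε_{Ω+1}). -/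
theorem towerTerm_val_mem (α : Ordinal.{0}) (n : ℕ) : (towerTerm n).val ∈ BSet α := by
  induction n with
  | zero => rw [towerTerm_zero_val]; exact Clos.add Clos.Omega (one_mem_BSet α)
  | succ n ih => rw [towerTerm_succ_val]; exact opow_mem_BSet ih

theorem epsOm_spec : Om < epsOm ∧ ω ^ epsOm = epsOm := by
  have : {η | Om < η ∧ ω ^ η = η}.Nonempty := by
    refine ⟨ε_ (Om + 1), ?_, omega0_opow_epsilon _⟩
    exact (lt_add_one _).trans_le (right_le_veblen _ _)
  exact csInf_mem this

theorem towerTerm_val_lt (n : ℕ) : (towerTerm n).val < epsOm := by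
  induction n with
  | zero =>
    rw [towerTerm_zero_val, ← epsOm_spec.2]
    have h := epsOm_spec.1
    refine isPrincipal_add_omega0_opow _ (h.trans_eq epsOm_spec.2.symm) ?_
    rw [epsOm_spec.2]
    exact (one_lt_omega0.trans omega0_lt_Om).trans h
  | succ n ih =>
    rw [towerTerm_succ_val, ← epsOm_spec.2]
    exact (opow_lt_opow_iff_right one_lt_omega0).2 ih

theorem Om_lt_towerTerm_val (n : ℕ) : Om < (towerTerm n).val := by
  induction n with
  | zero => rw [towerTerm_zero_val]; exact lt_add_one _
  | succ n ih => rw [towerTerm_succ_val]; exact ih.trans_le (right_le_opow _ one_lt_omega0)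

/-- Equality would give a fixed point of exponentiation above Ω and below ε_{Ω+1}. -/
theorem towerTerm_val_lt_succ (n : ℕ) : (towerTerm n).val < (towerTerm (n + 1)).val := by
  rw [towerTerm_succ_val]
  refine lt_of_le_of_ne (right_le_opow _ one_lt_omega0) fun h => ?_
  exact (towerTerm_val_lt n).not_ge (csInf_le' ⟨Om_lt_towerTerm_val n, h.symm⟩)

theorem towerTerm_val_mono : Monotone fun n => (towerTerm n).val :=
  monotone_nat_of_le_succ fun n => (towerTerm_val_lt_succ n).le

theorem towerTerm_isNF (n : ℕ) : (towerTerm n).IsNF := by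
  induction n with
  | zero =>
    refine ⟨trivial, ⟨trivial, trivial, ?_, ?_⟩, Om_isPrincipal_add, ?_, ?_⟩
    · simp [OTerm.val]
    · simp [OTerm.val]
    · simp [OTerm.val]
    · simp only [OTerm.val, veblen_zero_apply, opow_zero]
      exact (one_lt_omega0.trans omega0_lt_Om).trans (lt_add_one _)
  | succ n ih =>
    refine ⟨trivial, ih, ?_, ?_⟩
    · exact veblen_pos
    · exact towerTerm_val_lt_succ n

theorem psi_towerTerm_isNF (n : ℕ) : (OTerm.psi (towerTerm n)).IsNF :=
  ⟨towerTerm_isNF n, towerTerm_val_lt n, towerTerm_val_mem _ n⟩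

theorem psi_towerTerm_val_lt (n : ℕ) : (OTerm.psi (towerTerm n)).val < psi epsOm :=
  psi_lt_psi (towerTerm_val_lt n) (towerTerm_val_mem _ n)

theorem computable_towerTerm_code : Computable fun n => (OTerm.psi (towerTerm n)).code := by
  have h2 : Primrec fun n => (towerTerm n).code := by
    refine (Primrec.nat_rec₁ (towerTerm 0).code
      (f := fun _ c => seqCode [3, OTerm.zero.code, c]) ?_).of_eq fun n => ?_
    · exact Primrec.encode.comp (Primrec.list_cons.comp (Primrec.const 3)
        (Primrec.list_cons.comp (Primrec.const OTerm.zero.code)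
          (Primrec.list_cons.comp Primrec.snd (Primrec.const []))))
    · induction n with
      | zero => rfl
      | succ n ih => simp only [ih]; rfl
  exact (Primrec.encode.comp (Primrec.list_cons.comp (Primrec.const 4)
    (Primrec.list_cons.comp h2 (Primrec.const [])))).to_comp

/-! ### Absoluteness of the defined formulas -/

@[simp] theorem eval_shift {n : ℕ} (v : ℕ → ZFSet.{0}) (x : ZFSet.{0}) (e : Fin n → ZFSet.{0})
    (t : Tm n) : t.shift.eval v (Fin.cons x e : Fin (n + 1) → ZFSet.{0}) = t.eval v e := by
  cases t <;> simp [Tm.shift, Tm.subst, Tm.eval]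

@[simp] theorem eval_fv {n : ℕ} (v : ℕ → ZFSet.{0}) (e : Fin n → ZFSet.{0}) (i : ℕ) :
    (Tm.fv i : Tm n).eval v e = v i := rfl

@[simp] theorem eval_bv {n : ℕ} (v : ℕ → ZFSet.{0}) (e : Fin n → ZFSet.{0}) (k : Fin n) :
    (Tm.bv k : Tm n).eval v e = e k := rfl

section Absolute

variable {M : Set ZFSet.{0}} {v : ℕ → ZFSet.{0}} {n : ℕ}
  {e : Fin n → ZFSet.{0}}

/-- In a transitive M the bounded quantifiers see all elements of their bounds. The same reason
makes the other defined formulas absolute. -/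
theorem sat_eqF (hM : ∀ x ∈ M, ∀ y ∈ x, y ∈ M)
    {s t : Tm n} (hs : s.eval v e ∈ M) (ht : t.eval v e ∈ M) :
    Sat M v e (eqF s t) ↔ s.eval v e = t.eval v e := by
  simp only [eqF, Sat, eval_bv, eval_shift, Fin.cons_zero]
  constructor
  · rintro ⟨h1, h2⟩
    ext z
    exact ⟨fun hz => h1 z (hM _ hs _ hz) hz, fun hz => h2 z (hM _ ht _ hz) hz⟩
  · intro h
    rw [h]
    exact ⟨fun _ _ hx => hx, fun _ _ hx => hx⟩

theorem sat_upairF (hM : ∀ x ∈ M, ∀ y ∈ x, y ∈ M)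
    {u y z : Tm n} (hu : u.eval v e ∈ M) (hy : y.eval v e ∈ M)
    (hz : z.eval v e ∈ M) :
    Sat M v e (upairF u y z) ↔ u.eval v e = {y.eval v e, z.eval v e} := by
  have key : ∀ x ∈ M, Sat M v (Fin.cons x e : Fin (n + 1) → ZFSet.{0})
      (.or (eqF (.bv 0) y.shift) (eqF (.bv 0) z.shift)) ↔ x = y.eval v e ∨ x = z.eval v e := by
    intro x hx
    simp only [Sat]
    rw [sat_eqF hM (by simpa) (by simpa), sat_eqF hM (by simpa) (by simpa)]
    simp
  simp only [upairF, Sat]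
  simp only [Sat] at key
  constructor
  · rintro ⟨h1, h2, h3⟩
    ext x
    rw [ZFSet.mem_pair]
    constructor
    · intro hx
      exact (key x (hM _ hu _ hx)).1 (h3 x (hM _ hu _ hx) hx)
    · rintro (rfl | rfl) <;> assumption
  · intro h
    rw [h]
    refine ⟨by simp, by simp, fun x hx h => (key x hx).2 (ZFSet.mem_pair.1 h)⟩

theorem sat_opairF (hM : ∀ x ∈ M, ∀ y ∈ x, y ∈ M)
    {w y z : Tm n} (hw : w.eval v e ∈ M) (hy : y.eval v e ∈ M)
    (hz : z.eval v e ∈ M) :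
    Sat M v e (opairF w y z) ↔ w.eval v e = ZFSet.pair (y.eval v e) (z.eval v e) := by
  simp only [opairF, Sat]
  have key : ∀ u ∈ M, ∀ u' ∈ M, ∀ r ∈ M,
      let e' : Fin (n + 3) → ZFSet.{0} :=
        Fin.cons r (Fin.cons u' (Fin.cons u e : Fin (n + 1) → _) : Fin (n + 2) → _)
      (Sat M v e' (eqF (.bv 0) (.bv 2)) ↔ r = u) ∧ (Sat M v e' (eqF (.bv 0) (.bv 1)) ↔ r = u') := by
    intro u hu u' hu' r hr
    constructor <;> rw [sat_eqF hM] <;> first | exact Iff.rfl | assumption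
  have key2 : ∀ u ∈ M, ∀ u' ∈ M,
      let e' : Fin (n + 2) → ZFSet.{0} := Fin.cons u' (Fin.cons u e : Fin (n+1) → _)
      (Sat M v e' (upairF (.bv 1) y.shift.shift z.shift.shift) ↔ u = {y.eval v e, z.eval v e}) ∧
      (Sat M v e' (upairF (.bv 0) y.shift.shift y.shift.shift) ↔ u' = {y.eval v e, y.eval v e}) := by
    intro u hu u' hu' e'
    constructor <;> rw [sat_upairF hM] <;> simp [e', Fin.cons_one, *]
  constructor
  · rintro ⟨u, hu, huw, u', hu', huw', h1, h2, h3⟩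
    rw [(key2 u hu u' hu').1] at h1
    rw [(key2 u hu u' hu').2] at h2
    simp only [eval_shift] at huw huw' h3
    ext r
    simp only [ZFSet.pair, ZFSet.mem_pair]
    -- The formula describes the second component as {y, y}, whereas `ZFSet.pair` uses the singleton
    -- {y}.
    have hyy : ({y.eval v e} : ZFSet.{0}) = u' := by rw [h2]; ext; simp
    constructor
    · intro hr
      have hrM := hM _ hw _ hr
      rcases h3 r hrM hr with h | h
      · rw [(key u hu u' hu' r hrM).1] at h; right; rw [h, h1]
      · rw [(key u hu u' hu' r hrM).2] at h; left; rw [h, hyy]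
    · rintro (rfl | rfl)
      · rwa [hyy]
      · rwa [← h1]
  · intro h
    have hu : ({y.eval v e, z.eval v e} : ZFSet.{0}) ∈ w.eval v e := by
      rw [h]; simp [ZFSet.pair]
    have hu' : ({y.eval v e} : ZFSet.{0}) ∈ w.eval v e := by
      rw [h]; simp [ZFSet.pair]
    refine ⟨_, hM _ hw _ hu, hu, _, hM _ hw _ hu', by simpa using hu', ?_, ?_, ?_⟩
    · rw [(key2 _ (hM _ hw _ hu) _ (hM _ hw _ hu')).1]
    · rw [(key2 _ (hM _ hw _ hu) _ (hM _ hw _ hu')).2]; ext; simp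
    · intro r hrM hr
      simp only [eval_shift] at hr
      rw [(key _ (hM _ hw _ hu) _ (hM _ hw _ hu') r hrM).1,
        (key _ (hM _ hw _ hu) _ (hM _ hw _ hu') r hrM).2]
      rw [h] at hr
      simp only [ZFSet.pair, ZFSet.mem_pair] at hr
      exact hr.symm

theorem sat_opairMemF (hM : ∀ x ∈ M, ∀ y ∈ x, y ∈ M)
    {y z x : Tm n} (hx : x.eval v e ∈ M) (hy : y.eval v e ∈ M)
    (hz : z.eval v e ∈ M) :
    Sat M v e (opairMemF y z x) ↔ ZFSet.pair (y.eval v e) (z.eval v e) ∈ x.eval v e := by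
  simp only [opairMemF, Sat]
  constructor
  · rintro ⟨w, hw, hwx, h⟩
    rw [sat_opairF hM (by simpa) (by simpa) (by simpa)] at h
    simp only [eval_bv, Fin.cons_zero, eval_shift] at h
    rwa [← h]
  · intro h
    refine ⟨_, hM _ hx _ h, h, ?_⟩
    rw [sat_opairF hM (by simpa using hM _ hx _ h) (by simpa) (by simpa)]
    simp

theorem sat_funF (hM : ∀ x ∈ M, ∀ y ∈ x, y ∈ M)
    {x a b : Tm n} (hx : x.eval v e ∈ M) (ha : a.eval v e ∈ M)
    (hb : b.eval v e ∈ M) :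
    Sat M v e (funF x a b) ↔ ZFSet.IsFunc (a.eval v e) (b.eval v e) (x.eval v e) := by
  have k1 : ∀ p ∈ M, ∀ y ∈ M, ∀ z ∈ M, Sat M v (Fin.cons z (Fin.cons y (Fin.cons p e :
      Fin (n+1) → _) : Fin (n+2) → _) : Fin (n+3) → _) (opairF (.bv 2) (.bv 1) (.bv 0)) ↔
      p = ZFSet.pair y z := by
    intro p hp y hy z hz
    rw [sat_opairF hM] <;> first | exact Iff.rfl | assumption
  have k2 : ∀ y ∈ M, ∀ z ∈ M, Sat M v (Fin.cons z (Fin.cons y e :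
      Fin (n+1) → _) : Fin (n+2) → _) (opairMemF (.bv 1) (.bv 0) x.shift.shift) ↔
      ZFSet.pair y z ∈ x.eval v e := by
    intro y hy z hz
    rw [sat_opairMemF hM]
    · simp [Fin.cons_one]
    · simpa
    · exact hy
    · exact hz
  have k3 : ∀ y ∈ M, ∀ z ∈ M, ∀ w ∈ M, Sat M v (Fin.cons w (Fin.cons z (Fin.cons y e :
      Fin (n+1) → _) : Fin (n+2) → _) : Fin (n+3) → _) (.imp (.and
        (opairMemF (.bv 2) (.bv 1) x.shift.shift.shift)
        (opairMemF (.bv 2) (.bv 0) x.shift.shift.shift)) (eqF (.bv 1) (.bv 0))) ↔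
      (ZFSet.pair y z ∈ x.eval v e ∧ ZFSet.pair y w ∈ x.eval v e → z = w) := by
    intro y hy z hz w hw
    simp only [Sat]
    rw [sat_opairMemF hM (by simpa) (by exact hy) (by exact hz),
      sat_opairMemF hM (by simpa) (by exact hy) (by exact hw),
      sat_eqF hM (by exact hz) (by exact hw)]
    simp only [eval_shift]
    exact Iff.rfl
  simp only [funF, Sat, eval_shift] at k1 k2 k3 ⊢
  constructor
  · rintro ⟨h1, h2, h3⟩
    have hpr : ∀ p ∈ x.eval v e, ∃ y ∈ a.eval v e, ∃ z ∈ b.eval v e, p = ZFSet.pair y z := by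
      intro p hp
      obtain ⟨y, hy, hya, z, hz, hzb, h⟩ := h1 p (hM _ hx _ hp) hp
      exact ⟨y, hya, z, hzb, (k1 p (hM _ hx _ hp) y hy z hz).1 h⟩
    refine ⟨fun p hp => ZFSet.mem_prod.2 (hpr p hp), fun y hy => ?_⟩
    obtain ⟨z, hz, hzb, h⟩ := h2 y (hM _ ha _ hy) hy
    rw [k2 y (hM _ ha _ hy) z hz] at h
    refine ⟨z, h, fun w hw => ?_⟩
    -- The formula asserts uniqueness only among values in b, `ZFSet.IsFunc` among all sets; the gap
    -- is closed because x ⊆ a × b.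
    obtain ⟨y', _, w', hw', he⟩ := hpr _ hw
    obtain ⟨rfl, rfl⟩ := ZFSet.pair_inj.1 he
    exact (k3 y (hM _ ha _ hy) w (hM _ hb _ hw') z hz).1
      (h3 y (hM _ ha _ hy) hy w (hM _ hb _ hw') hw' z hz hzb) ⟨hw, h⟩
  · rintro ⟨h1, h2⟩
    refine ⟨fun p hp hpx => ?_, fun y hy hya => ?_, fun y hy hya z hz hzb w hw hwb => ?_⟩
    · obtain ⟨y, hya, z, hzb, h⟩ := ZFSet.mem_prod.1 (h1 hpx)
      exact ⟨y, hM _ ha _ hya, hya, z, hM _ hb _ hzb, hzb,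
        (k1 p hp y (hM _ ha _ hya) z (hM _ hb _ hzb)).2 h⟩
    · obtain ⟨z, hz, -⟩ := h2 y hya
      obtain ⟨y', _, z', hz', he⟩ := ZFSet.mem_prod.1 (h1 hz)
      obtain ⟨rfl, rfl⟩ := ZFSet.pair_inj.1 he
      exact ⟨z, hM _ hb _ hz', hz', (k2 y hy z (hM _ hb _ hz')).2 hz⟩
    · exact (k3 y hy z hz w hw).2 fun h => (h2 y hya).unique h.1 h.2

end Absolute

/-! ### The exponentiation hierarchy and the cumulative hierarchy -/

theorem mem_EHier {α : Ordinal.{0}} {X : ZFSet.{0}} : X ∈ EHier α ↔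
    (∃ β, ∃ _ : α = β + 1, DefinableOver (EHier β) X) ∨
    (∃ β, ∃ _ : α = β + 2, ∃ a ∈ EHier β, ∃ b ∈ EHier β, ZFSet.IsFunc a b X) ∨
    (Order.IsSuccLimit α ∧ ∃ β, ∃ _ : β < α, X ∈ EHier β) := by
  rw [EHier]; exact Iff.rfl

theorem EHier_of_definable {β : Ordinal.{0}} {X : ZFSet.{0}} (h : DefinableOver (EHier β) X) :
    X ∈ EHier (β + 1) := mem_EHier.2 (Or.inl ⟨β, rfl, h⟩)

theorem EHier_of_isFunc {β : Ordinal.{0}} {X a b : ZFSet.{0}} (ha : a ∈ EHier β)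
    (hb : b ∈ EHier β) (h : ZFSet.IsFunc a b X) : X ∈ EHier (β + 2) :=
  mem_EHier.2 (Or.inr (Or.inl ⟨β, rfl, a, ha, b, hb, h⟩))

theorem rank_pair_le {x y : ZFSet.{0}} {β : Ordinal.{0}} (hx : x.rank < β) (hy : y.rank < β) :
    (ZFSet.pair x y).rank ≤ β + 1 := by
  simp only [ZFSet.pair, ZFSet.rank_pair, ZFSet.rank_singleton, Order.succ_eq_add_one]
  have h1 : x.rank + 1 ≤ β := Order.add_one_le_of_lt hx
  have h2 : y.rank + 1 ≤ β := Order.add_one_le_of_lt hy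
  refine max_le ?_ ?_ <;> gcongr
  exact max_le h1 h2

theorem rank_isFunc_le {a b x : ZFSet.{0}} {β : Ordinal.{0}} (ha : a.rank ≤ β) (hb : b.rank ≤ β)
    (h : ZFSet.IsFunc a b x) : x.rank ≤ β + 2 := by
  refine ZFSet.rank_le_iff.2 fun p hp => ?_
  obtain ⟨y, hy, z, hz, rfl⟩ := ZFSet.mem_prod.1 (h.1 hp)
  refine (rank_pair_le ((ZFSet.rank_lt_of_mem hy).trans_le ha)
    ((ZFSet.rank_lt_of_mem hz).trans_le hb)).trans_lt ?_
  rw [← one_add_one_eq_two, ← add_assoc]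
  exact lt_add_one _

/-- In the function case, with m < β the larger rank of a and b, every pair has rank at most m + 1 ≤
β. So the function has rank at most β + 1, which fits into the step from β to β + 2. -/
theorem rank_lt_of_mem_EHier (α : Ordinal.{0}) : ∀ X ∈ EHier α, X.rank < α := by
  induction α using WellFoundedLT.induction with
  | _ α ih =>
    intro X hX
    rcases mem_EHier.1 hX with ⟨β, rfl, F, v, -, h⟩ | ⟨β, rfl, a, ha, b, hb, h⟩ | ⟨-, β, hβ, h⟩
    · refine (ZFSet.rank_le_iff.2 fun y hy => ?_).trans_lt (lt_add_one β)
      exact ih β (lt_add_one β) y ((h y).1 hy).1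
    · have hlt : β < β + 2 := by simp
      have ha' := ih β hlt a ha
      have hb' := ih β hlt b hb
      have h1 : X.rank ≤ β + 1 := by
        refine ZFSet.rank_le_iff.2 fun p hp => ?_
        obtain ⟨y, hy, z, hz, rfl⟩ := ZFSet.mem_prod.1 (h.1 hp)
        have hm : max a.rank b.rank < β := max_lt ha' hb'
        refine (rank_pair_le ((ZFSet.rank_lt_of_mem hy).trans_le (le_max_left _ _))
          ((ZFSet.rank_lt_of_mem hz).trans_le (le_max_right _ _))).trans_lt ?_
        exact (Order.add_one_le_of_lt hm).trans_lt (lt_add_one β)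
      refine h1.trans_lt ?_
      rw [← one_add_one_eq_two, ← add_assoc]
      exact lt_add_one _
    · exact (ih β hβ X h).trans hβ

theorem definableOver_of_mem {M : Set ZFSet.{0}} (hM : ∀ x ∈ M, ∀ y ∈ x, y ∈ M) {x : ZFSet.{0}}
    (hx : x ∈ M) : DefinableOver M x := by
  refine ⟨.mem (.bv 0) (.fv 0), fun _ => x, fun _ _ => hx, fun y => ?_⟩
  simp only [Sat, eval_bv, eval_fv]
  exact ⟨fun h => ⟨hM x hx y h, h⟩, fun h => h.2⟩

theorem definableOver_pair {M : Set ZFSet.{0}} (hM : ∀ x ∈ M, ∀ y ∈ x, y ∈ M) {x y : ZFSet.{0}}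
    (hx : x ∈ M) (hy : y ∈ M) : DefinableOver M {x, y} := by
  have hv : ∀ i, (fun i => if i = 0 then x else y : ℕ → ZFSet.{0}) i ∈ M := by
    intro i; dsimp only; split_ifs <;> assumption
  refine ⟨.or (eqF (.bv 0) (.fv 0)) (eqF (.bv 0) (.fv 1)), fun i => if i = 0 then x else y,
    fun i _ => hv i, fun z => ?_⟩
  simp only [ZFSet.mem_pair, Sat]
  constructor
  · intro h
    have hz : z ∈ M := by rcases h with rfl | rfl <;> assumption
    rw [sat_eqF hM (by exact hz) (by exact hv 0), sat_eqF hM (by exact hz) (by exact hv 1)]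
    simpa [hz] using h
  · rintro ⟨hz, h⟩
    rw [sat_eqF hM (by exact hz) (by exact hv 0), sat_eqF hM (by exact hz) (by exact hv 1)] at h
    simpa using h

/-- The delicate case is a function put in at β + 2: its elements are pairs of elements of E_β, and
two definability steps build these, first the components {s} and {s, t}, then the pair. -/
theorem EHier_transitive (α : Ordinal.{0}) : ∀ x ∈ EHier α, ∀ y ∈ x, y ∈ EHier α := by
  induction α using WellFoundedLT.induction with
  | _ α ih =>
    have step : ∀ β < α, EHier β ⊆ EHier (β + 1) := fun β hβ x hx =>
      EHier_of_definable (definableOver_of_mem (ih β hβ) hx)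
    intro X hX y hy
    rcases mem_EHier.1 hX with ⟨β, rfl, F, v, -, h⟩ | ⟨β, rfl, a, ha, b, hb, h⟩ | ⟨hl, β, hβ, h⟩
    · exact step β (lt_add_one β) ((h y).1 hy).1
    · have hlt : β < β + 2 := by simp
      have e2 : β + 1 + 1 = β + 2 := by rw [add_assoc, one_add_one_eq_two]
      have hlt' : β + 1 < β + 2 := e2 ▸ lt_add_one (β + 1)
      obtain ⟨s, hs, t, ht, rfl⟩ := ZFSet.mem_prod.1 (h.1 hy)
      have hs' := ih β hlt a ha s hs
      have ht' := ih β hlt b hb t ht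
      have h1 := EHier_of_definable (definableOver_pair (ih β hlt) hs' ht')
      have h2 := EHier_of_definable (definableOver_pair (ih β hlt) hs' hs')
      have h3 := EHier_of_definable (definableOver_pair (ih (β + 1) hlt') h2 h1)
      rw [e2] at h3
      simpa [ZFSet.pair] using h3
    · exact mem_EHier.2 (Or.inr (Or.inr ⟨hl, β, hβ, ih β hβ X h y hy⟩))

theorem EHier_mono {α β : Ordinal.{0}} (h : α ≤ β) : EHier α ⊆ EHier β := by
  induction β using Ordinal.limitRecOn with
  | zero => rw [nonpos_iff_eq_zero.1 h]
  | add_one β ih =>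
    rcases h.lt_or_eq with h | rfl
    · intro x hx
      exact EHier_of_definable (definableOver_of_mem (EHier_transitive β)
        (ih (Order.lt_add_one_iff.1 h) hx))
    · exact subset_rfl
  | limit β hl ih =>
    rcases h.lt_or_eq with h | rfl
    · intro x hx
      exact mem_EHier.2 (Or.inr (Or.inr ⟨hl, α, h, hx⟩))
    · exact subset_rfl

/-- An arbitrary subset need not be definable, but its characteristic function is added outright at
a function stage, and the subset is definable from it one stage later. -/
theorem subset_mem_EHier {μ : Ordinal.{0}} {X : ZFSet.{0}} (hX : ∀ y ∈ X, y ∈ EHier μ) :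
    ∃ n : ℕ, X ∈ EHier (μ + n) := by
  classical
  -- E_μ as a set; cutting it out of V_μ loses nothing by the rank bound.
  let a : ZFSet.{0} := ZFSet.sep (· ∈ EHier μ) (ZFSet.vonNeumann μ)
  have ha : ∀ y, y ∈ a ↔ y ∈ EHier μ := fun y => by
    simp only [a, ZFSet.mem_sep, ZFSet.mem_vonNeumann, and_iff_right_iff_imp]
    exact rank_lt_of_mem_EHier μ y
  have ha1 : a ∈ EHier (μ + 1) := by
    refine EHier_of_definable ⟨.imp (.mem (.bv 0) (.bv 0)) (.mem (.bv 0) (.bv 0)), fun _ => ∅,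
      by simp [Fml.fvs, Tm.fvs], fun y => ?_⟩
    simp [Sat, ha]
  have h0 : (∅ : ZFSet.{0}) ∈ EHier (μ + 1) := by
    refine EHier_of_definable ⟨.neg (.imp (.mem (.bv 0) (.bv 0)) (.mem (.bv 0) (.bv 0))),
      fun _ => ∅, by simp [Fml.fvs, Tm.fvs], fun y => ?_⟩
    simp [Sat]
  have h1 : ({∅, ∅} : ZFSet.{0}) ∈ EHier (μ + 1 + 1) :=
    EHier_of_definable (definableOver_pair (EHier_transitive _) h0 h0)
  have h2 : ({∅, {∅, ∅}} : ZFSet.{0}) ∈ EHier (μ + 1 + 1 + 1) :=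
    EHier_of_definable (definableOver_pair (EHier_transitive _)
      (EHier_mono le_self_add h0) h1)
  have ha3 : a ∈ EHier (μ + 1 + 1 + 1) :=
    EHier_mono (le_self_add.trans le_self_add) ha1
  let c : ZFSet.{0} → ZFSet.{0} := fun x => if x ∈ X then {∅, ∅} else ∅
  have hc : ∀ x, c x ∈ ({∅, {∅, ∅}} : ZFSet.{0}) := fun x => by
    simp only [c]; split_ifs <;> simp
  let f : ZFSet.{0} := ZFSet.sep (fun p => ∃ x, p = ZFSet.pair x (c x))
    (ZFSet.prod a {∅, {∅, ∅}})
  have hf : ∀ x y, ZFSet.pair x y ∈ f ↔ x ∈ a ∧ y = c x := fun x y => by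
    simp only [f, ZFSet.mem_sep, ZFSet.pair_mem_prod, ZFSet.pair_inj]
    constructor
    · rintro ⟨⟨h, -⟩, x', rfl, rfl⟩
      exact ⟨h, rfl⟩
    · rintro ⟨h, rfl⟩
      exact ⟨⟨h, hc x⟩, x, rfl, rfl⟩
  have hfun : ZFSet.IsFunc a {∅, {∅, ∅}} f := by
    refine ⟨fun p hp => (ZFSet.mem_sep.1 hp).1, fun x hx => ⟨c x, (hf _ _).2 ⟨hx, rfl⟩, ?_⟩⟩
    intro y hy
    exact ((hf _ _).1 hy).2
  have hfE := EHier_of_isFunc ha3 h2 hfun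
  set κ := μ + 1 + 1 + 1 + 2 with hκ
  have h1E : ({∅, ∅} : ZFSet.{0}) ∈ EHier κ :=
    EHier_mono (le_self_add.trans le_self_add) h1
  have hne : (∅ : ZFSet.{0}) ≠ {∅, ∅} := by
    intro h
    have : (∅ : ZFSet.{0}) ∈ ({∅, ∅} : ZFSet.{0}) := by simp
    rw [← h] at this
    simp at this
  have hv : ∀ i, (fun i => if i = 0 then f else {∅, ∅} : ℕ → ZFSet.{0}) i ∈ EHier κ := by
    intro i; dsimp only; split_ifs <;> assumption
  -- Three stages provide the domain and the two-element codomain, two more the function, and one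
  -- more the definition of X.
  refine ⟨6, ?_⟩
  have hμ : μ + (6 : ℕ) = κ + 1 := by
    rw [hκ]; simp only [add_assoc]; congr 1; norm_num
  rw [hμ]
  refine EHier_of_definable ⟨opairMemF (.bv 0) (.fv 1) (.fv 0),
    fun i => if i = 0 then f else {∅, ∅}, fun i _ => hv i, fun y => ?_⟩
  constructor
  · intro hy
    have hyE : y ∈ EHier κ :=
      EHier_mono (by rw [hκ]; simp only [add_assoc]; exact le_self_add) (hX y hy)
    refine ⟨hyE, ?_⟩
    rw [sat_opairMemF (EHier_transitive κ) (by exact hv 0) (by exact hyE) (by exact hv 1)]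
    change ZFSet.pair y {∅, ∅} ∈ f
    rw [hf]
    exact ⟨(ha y).2 (hX y hy), by simp [c, hy]⟩
  · rintro ⟨hyE, h⟩
    rw [sat_opairMemF (EHier_transitive κ) (by exact hv 0) (by exact hyE) (by exact hv 1)] at h
    change ZFSet.pair y {∅, ∅} ∈ f at h
    rw [hf] at h
    by_contra hn
    simp only [c, if_neg hn] at h
    exact hne h.2.symm

/-- Each level of rank costs finitely many stages, hence at most ω. -/
theorem mem_EHier_rank (X : ZFSet.{0}) : X ∈ EHier (ω * (X.rank + 1)) := by
  induction X using ZFSet.inductionOn with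
  | _ X ih =>
    have h : ∀ y ∈ X, y ∈ EHier (ω * X.rank) := fun y hy =>
      EHier_mono (mul_le_mul_right (Order.add_one_le_of_lt (ZFSet.rank_lt_of_mem hy)) ω) (ih y hy)
    obtain ⟨n, hn⟩ := subset_mem_EHier h
    refine EHier_mono ?_ hn
    rw [mul_add_one]
    gcongr
    exact (natCast_lt_omega0 n).le

/-- An epsilon number absorbs the delay: ω · (ρ + 1) ≤ ω^(1 + (ρ + 1)) < ξ for every ρ < ξ. -/
theorem EHier_eq_of_good {ξ : Ordinal.{0}} (h : Good ξ) : EHier ξ = {x | x.rank < ξ} := by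
  ext x
  refine ⟨rank_lt_of_mem_EHier ξ x, fun hx => EHier_mono ?_ (mem_EHier_rank x)⟩
  calc ω * (x.rank + 1) ≤ ω ^ (1 : Ordinal.{0}) * ω ^ (x.rank + 1) := by
        rw [opow_one]; gcongr; exact right_le_opow _ one_lt_omega0
    _ = ω ^ (1 + (x.rank + 1)) := (opow_add _ _ _).symm
    _ ≤ ξ := (h.opow (h.add h.one_lt (h.add_one hx))).le

/-! ### Infinitary formulas -/

/-- Infinitary formulas in negation normal form. Atoms are truth values; the conjunctions and
disjunctions range over the elements of a set, or over all sets of countable rank (`none`). -/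
inductive IFml : Type 1
  | atom (p : Prop) : IFml
  | conj (o : Option ZFSet.{0}) (F : ZFSet.{0} → IFml) : IFml
  | disj (o : Option ZFSet.{0}) (F : ZFSet.{0} → IFml) : IFml

/-- The range of a quantifier. -/
def InRange (o : Option ZFSet.{0}) (x : ZFSet.{0}) : Prop := ∀ a ∈ o, x ∈ a

@[simp] theorem inRange_none (x : ZFSet.{0}) : InRange none x := by simp [InRange]

@[simp] theorem inRange_some {a x : ZFSet.{0}} : InRange (some a) x ↔ x ∈ a := by simp [InRange]

namespace IFml

def dual : IFml → IFml
  | atom p => atom (¬ p)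
  | conj o F => disj o fun x => (F x).dual
  | disj o F => conj o fun x => (F x).dual

@[simp] theorem dual_dual (A : IFml) : A.dual.dual = A := by
  induction A with
  | atom p => simp [dual]
  | conj o F ih => simp [dual, ih]
  | disj o F ih => simp [dual, ih]

/-- Satisfaction, the unbounded quantifiers ranging over the sets of rank below `δ`. -/
def ISat (δ : Ordinal.{0}) : IFml → Prop
  | atom p => p
  | conj none F => ∀ x, x.rank < δ → (F x).ISat δ
  | conj (some a) F => ∀ x ∈ a, (F x).ISat δ
  | disj none F => ∃ x, x.rank < δ ∧ (F x).ISat δ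
  | disj (some a) F => ∃ x ∈ a, (F x).ISat δ

theorem isat_dual {δ : Ordinal.{0}} (A : IFml) : A.dual.ISat δ ↔ ¬ A.ISat δ := by
  induction A with
  | atom p => simp [dual, ISat]
  | conj o F ih => cases o <;> simp [dual, ISat, ih]
  | disj o F ih => cases o <;> simp [dual, ISat, ih]

/-- No unbounded quantifier occurs. -/
inductive Bdd : IFml → Prop
  | atom (p : Prop) : Bdd (atom p)
  | conj {a : ZFSet.{0}} {F : ZFSet.{0} → IFml} : (∀ x, Bdd (F x)) → Bdd (conj (some a) F)
  | disj {a : ZFSet.{0}} {F : ZFSet.{0} → IFml} : (∀ x, Bdd (F x)) → Bdd (disj (some a) F)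

theorem Bdd.dual {A : IFml} (h : A.Bdd) : A.dual.Bdd := by
  induction h with
  | atom p => exact .atom _
  | conj _ ih => exact .disj ih
  | disj _ ih => exact .conj ih

theorem Bdd.isat_iff {A : IFml} (h : A.Bdd) (δ δ' : Ordinal.{0}) : A.ISat δ ↔ A.ISat δ' := by
  induction h with
  | atom p => rfl
  | conj _ ih => simp [ISat, ih]
  | disj _ ih => simp [ISat, ih]

/-- `Σ`-formulas. -/
inductive Sig : IFml → Prop
  | atom (p : Prop) : Sig (atom p)
  | conj {a : ZFSet.{0}} {F : ZFSet.{0} → IFml} : (∀ x, Sig (F x)) → Sig (conj (some a) F)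
  | disj {o : Option ZFSet.{0}} {F : ZFSet.{0} → IFml} : (∀ x, Sig (F x)) → Sig (disj o F)

theorem Bdd.sig {A : IFml} (h : A.Bdd) : A.Sig := by
  induction h with
  | atom p => exact .atom _
  | conj _ ih => exact .conj ih
  | disj _ ih => exact .disj ih

theorem Sig.isat_mono {A : IFml} (h : A.Sig) {δ δ' : Ordinal.{0}} (hδ : δ ≤ δ')
    (hA : A.ISat δ) : A.ISat δ' := by
  induction h with
  | atom p => exact hA
  | conj _ ih => exact fun x hx => ih x (hA x hx)
  | @disj o F _ ih =>
    cases o with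
    | none =>
      obtain ⟨x, hx, h⟩ := hA
      exact ⟨x, hx.trans_le hδ, ih x h⟩
    | some a =>
      obtain ⟨x, hx, h⟩ := hA
      exact ⟨x, hx, ih x h⟩

/-- The cut formulas that survive cut elimination. -/
def Basic (C : IFml) : Prop :=
  C.Bdd ∨ ∃ F : ZFSet.{0} → IFml, (∀ x, (F x).Bdd) ∧ (C = conj none F ∨ C = disj none F)

/-- Formulas of rank at most `k`. -/
def RankLE : ℕ → IFml → Prop
  | 0, C => C.Basic
  | k + 1, C => RankLE k C ∨
      ∃ o F, (∀ x, RankLE k (F x)) ∧ (C = conj o F ∨ C = disj o F)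

theorem RankLE.mono {k l : ℕ} (h : k ≤ l) {C : IFml} (hC : RankLE k C) : RankLE l C := by
  induction h with
  | refl => exact hC
  | step _ ih => exact Or.inl ih

theorem Basic.dual {C : IFml} (h : C.Basic) : C.dual.Basic := by
  rcases h with h | ⟨F, hF, rfl | rfl⟩
  · exact Or.inl h.dual
  · exact Or.inr ⟨_, fun x => (hF x).dual, Or.inr rfl⟩
  · exact Or.inr ⟨_, fun x => (hF x).dual, Or.inl rfl⟩

theorem RankLE.dual {k : ℕ} {C : IFml} (h : RankLE k C) : RankLE k C.dual := by
  induction k generalizing C with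
  | zero => exact Basic.dual h
  | succ k ih =>
    rcases h with h | ⟨o, F, hF, rfl | rfl⟩
    · exact Or.inl (ih h)
    · exact Or.inr ⟨o, _, fun x => ih (hF x), Or.inr rfl⟩
    · exact Or.inr ⟨o, _, fun x => ih (hF x), Or.inl rfl⟩

end IFml

open IFml

/-! ### The infinitary calculus -/

/-- The closure of `ξ ∪ {Ω}` under addition and exponentiation with base `ω`. -/
inductive Control (ξ : Ordinal.{0}) : Ordinal.{0} → Prop
  | base {ρ : Ordinal.{0}} : ρ < ξ → Control ξ ρ
  | Omega : Control ξ Om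
  | add {ρ σ : Ordinal.{0}} : Control ξ ρ → Control ξ σ → Control ξ (ρ + σ)
  | opow {ρ : Ordinal.{0}} : Control ξ ρ → Control ξ (ω ^ ρ)

theorem Control.mono {ξ ξ' : Ordinal.{0}} (h : ξ ≤ ξ') {ρ : Ordinal.{0}} (hρ : Control ξ ρ) :
    Control ξ' ρ := by
  induction hρ with
  | base h' => exact .base (h'.trans_le h)
  | Omega => exact .Omega
  | add _ _ ih ih' => exact .add ih ih'
  | opow _ ih => exact .opow ih

/-- This connects control with collapsing: heights generated from ordinals below ξ ≤ ψ(γ) lie in the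
closure at γ, where `psi_lt_psi` can use them. -/
theorem Control.mem_BSet {ξ γ : Ordinal.{0}} (h : ξ ≤ psi γ) {ρ : Ordinal.{0}}
    (hρ : Control ξ ρ) : ρ ∈ BSet γ := by
  induction hρ with
  | base h' => exact mem_BSet_of_lt_psi (h'.trans_le h)
  | Omega => exact Clos.Omega
  | add _ _ ih ih' => exact add_mem_BSet ih ih'
  | opow _ ih => exact opow_mem_BSet ih

/-- Derivability of the sequent `Γ` (read disjunctively) with height `α`, controlled by `ξ`, with
cut formulas of rank at most `k`. Besides the logical rules there is a rule for collection. -/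
inductive Der (k : ℕ) : Ordinal.{0} → Ordinal.{0} → Set IFml → Prop
  | ax {ξ α : Ordinal.{0}} {Γ : Set IFml} {p : Prop} (hp : p) (hmem : atom p ∈ Γ) : Der k ξ α Γ
  | conjB {ξ α : Ordinal.{0}} {Γ : Set IFml} {a : ZFSet.{0}} {F : ZFSet.{0} → IFml}
      (β : ZFSet.{0} → Ordinal.{0}) (hmem : conj (some a) F ∈ Γ) (ha : a.rank < ξ)
      (hβ : ∀ x ∈ a, β x < α) (hc : ∀ x ∈ a, Control ξ (β x))
      (h : ∀ x ∈ a, Der k ξ (β x) (insert (F x) Γ)) : Der k ξ α Γ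
  -- Premises are required for every larger control, because the quantifier ranges over all sets of
  -- countable rank while ξ admits only parameters of rank below ξ. After collapsing has produced a
  -- witness, the control can be raised and the conjunction inverted there.
  | conjU {ξ α : Ordinal.{0}} {Γ : Set IFml} {F : ZFSet.{0} → IFml}
      (β : Ordinal.{0} → ZFSet.{0} → Ordinal.{0}) (hmem : conj none F ∈ Γ)
      (hβ : ∀ ξ', Good ξ' → ξ ≤ ξ' → ∀ x : ZFSet.{0}, x.rank < ξ' → β ξ' x < α)
      (hc : ∀ ξ', Good ξ' → ξ ≤ ξ' → ∀ x : ZFSet.{0}, x.rank < ξ' → Control ξ' (β ξ' x))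
      (h : ∀ ξ', Good ξ' → ξ ≤ ξ' → ∀ x : ZFSet.{0}, x.rank < ξ' →
        Der k ξ' (β ξ' x) (insert (F x) Γ)) : Der k ξ α Γ
  | disj {ξ α β : Ordinal.{0}} {Γ : Set IFml} {o : Option ZFSet.{0}} {F : ZFSet.{0} → IFml}
      (x : ZFSet.{0}) (hmem : disj o F ∈ Γ) (hx : x.rank < ξ) (hxo : InRange o x)
      (hβ : β < α) (hc : Control ξ β) (h : Der k ξ β (insert (F x) Γ)) : Der k ξ α Γ
  -- Boundedness of B makes the matrix of the principal formula bounded, so this formula is `Basic`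
  -- and is never the one removed in cut reduction.
  | coll {ξ α β : Ordinal.{0}} {Γ : Set IFml} {a : ZFSet.{0}}
      {B : ZFSet.{0} → ZFSet.{0} → IFml} (hB : ∀ x y, (B x y).Bdd)
      (hmem : disj none (fun z => conj (some a) fun x => disj (some z) fun y => B x y) ∈ Γ)
      (hβ : β < α) (hc : Control ξ β)
      (h : Der k ξ β (insert (conj (some a) fun x => disj none fun y => B x y) Γ)) : Der k ξ α Γ
  | cut {ξ α β β' : Ordinal.{0}} {Γ : Set IFml} (C : IFml) (hC : RankLE k C)
      (hβ : β < α) (hc : Control ξ β) (hβ' : β' < α) (hc' : Control ξ β')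
      (h : Der k ξ β (insert C Γ)) (h' : Der k ξ β' (insert C.dual Γ)) : Der k ξ α Γ

theorem Der.weaken {k : ℕ} {ξ α : Ordinal.{0}} {Γ : Set IFml} (h : Der k ξ α Γ) :
    ∀ {l : ℕ} {ξ' α' : Ordinal.{0}} {Γ' : Set IFml}, k ≤ l → ξ ≤ ξ' → α ≤ α' → Γ ⊆ Γ' →
      Der l ξ' α' Γ' := by
  induction h with
  | ax hp hmem =>
    intro l ξ' α' Γ' _ _ _ hΓ
    exact .ax hp (hΓ hmem)
  | conjB β hmem ha hβ hc h ih =>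
    intro l ξ' α' Γ' hk hξ hα hΓ
    exact .conjB β (hΓ hmem) (ha.trans_le hξ) (fun x hx => (hβ x hx).trans_le hα)
      (fun x hx => (hc x hx).mono hξ)
      fun x hx => ih x hx hk hξ le_rfl (Set.insert_subset_insert hΓ)
  | conjU β hmem hβ hc h ih =>
    intro l ξ' α' Γ' hk hξ hα hΓ
    exact .conjU β (hΓ hmem) (fun η hη hle x hx => (hβ η hη (hξ.trans hle) x hx).trans_le hα)
      (fun η hη hle x hx => hc η hη (hξ.trans hle) x hx)
      fun η hη hle x hx => ih η hη (hξ.trans hle) x hx hk le_rfl le_rfl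
        (Set.insert_subset_insert hΓ)
  | disj x hmem hx hxo hβ hc h ih =>
    intro l ξ' α' Γ' hk hξ hα hΓ
    exact .disj x (hΓ hmem) (hx.trans_le hξ) hxo (hβ.trans_le hα) (hc.mono hξ)
      (ih hk hξ le_rfl (Set.insert_subset_insert hΓ))
  | coll hB hmem hβ hc h ih =>
    intro l ξ' α' Γ' hk hξ hα hΓ
    exact .coll hB (hΓ hmem) (hβ.trans_le hα) (hc.mono hξ)
      (ih hk hξ le_rfl (Set.insert_subset_insert hΓ))
  | cut C hC hβ hc hβ' hc' h h' ih ih' =>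
    intro l ξ' α' Γ' hk hξ hα hΓ
    exact .cut C (hC.mono hk) (hβ.trans_le hα) (hc.mono hξ) (hβ'.trans_le hα) (hc'.mono hξ)
      (ih hk hξ le_rfl (Set.insert_subset_insert hΓ))
      (ih' hk hξ le_rfl (Set.insert_subset_insert hΓ))

theorem Der.mono {k : ℕ} {ξ α : Ordinal.{0}} {Γ Γ' : Set IFml} (h : Der k ξ α Γ)
    (hΓ : Γ ⊆ Γ') : Der k ξ α Γ' := h.weaken le_rfl le_rfl le_rfl hΓ

theorem Der.height {k : ℕ} {ξ α α' : Ordinal.{0}} {Γ : Set IFml} (h : Der k ξ α Γ)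
    (hα : α ≤ α') : Der k ξ α' Γ := h.weaken le_rfl le_rfl hα subset_rfl

theorem insert_subset_swap {C D : IFml} {Γ Δ Θ : Set IFml} (h : Δ ⊆ insert C (Γ ∪ Θ)) :
    insert D Δ ⊆ insert C (insert D Γ ∪ Θ) := by
  rintro X (rfl | hX)
  · simp
  · rcases h hX with rfl | h | h <;> simp [h]

/-- The formula `C` in a derivable sequent may be replaced by `Θ`, provided that this is so in
each inference with principal formula `C`. -/
theorem Der.replace {k : ℕ} {C : IFml} {ξ₀ : Ordinal.{0}} {Θ : Set IFml}
    (hatom : ∀ p, C = atom p → ¬ p)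
    (hconj : ∀ o F, C = conj o F → ∃ x, InRange o x ∧ x.rank < ξ₀ ∧ F x ∈ Θ)
    (hdisj : ∀ o F, C = IFml.disj o F → (∃ a, o = some a) ∧ ∀ x, InRange o x → F x ∈ Θ)
    {ξ α : Ordinal.{0}} {Δ : Set IFml} (h : Der k ξ α Δ) :
    ∀ {Γ : Set IFml}, Good ξ → ξ₀ ≤ ξ → Δ ⊆ insert C (Γ ∪ Θ) → Der k ξ α (Γ ∪ Θ) := by
  have absorb : ∀ {D : IFml} {Γ : Set IFml}, D ∈ Θ → insert D Γ ∪ Θ = Γ ∪ Θ := by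
    intro D Γ hD
    ext X; simp only [Set.mem_union, Set.mem_insert_iff]
    constructor
    · rintro ((rfl | h) | h) <;> tauto
    · tauto
  have push : ∀ {D : IFml} {Γ : Set IFml}, insert D Γ ∪ Θ ⊆ insert D (Γ ∪ Θ) := by
    intro D Γ
    rw [Set.insert_union]
  induction h with
  | ax hp hmem =>
    intro Γ hg hξ hΔ
    rcases hΔ hmem with h | h
    · exact absurd hp (hatom _ h.symm)
    · exact .ax hp h
  | @conjB ξ α Δ a F β hmem ha hβ hc h ih =>
    intro Γ hg hξ hΔ
    rcases hΔ hmem with hp | hp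
    · obtain ⟨x, hxo, hx, hxΘ⟩ := hconj _ _ hp.symm
      have hxa : x ∈ a := inRange_some.1 hxo
      have := ih x hxa hg hξ (insert_subset_swap hΔ)
      rw [absorb hxΘ] at this
      exact this.height (hβ x hxa).le
    · exact .conjB β hp ha hβ hc fun x hx =>
        (ih x hx hg hξ (insert_subset_swap hΔ)).mono push
  | @conjU ξ α Δ F β hmem hβ hc h ih =>
    intro Γ hg hξ hΔ
    rcases hΔ hmem with hp | hp
    · obtain ⟨x, hxo, hx, hxΘ⟩ := hconj _ _ hp.symm
      -- Of the premises for all larger controls, the one at ξ itself is used.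
      have := ih ξ hg le_rfl x (hx.trans_le hξ) hg hξ (insert_subset_swap hΔ)
      rw [absorb hxΘ] at this
      exact this.height (hβ ξ hg le_rfl x (hx.trans_le hξ)).le
    · exact .conjU β hp hβ hc fun η hη hle x hx =>
        (ih η hη hle x hx hη (hξ.trans hle) (insert_subset_swap hΔ)).mono push
  | disj x hmem hx hxo hβ hc h ih =>
    intro Γ hg hξ hΔ
    have := ih hg hξ (insert_subset_swap hΔ)
    rcases hΔ hmem with hp | hp
    · rw [absorb ((hdisj _ _ hp.symm).2 x hxo)] at this
      exact this.height hβ.le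
    · exact .disj x hp hx hxo hβ hc (this.mono push)
  | coll hB hmem hβ hc h ih =>
    intro Γ hg hξ hΔ
    rcases hΔ hmem with hp | hp
    -- Collection introduces an unbounded disjunction without an instance of it; this is why only
    -- bounded disjunctions may be replaced.
    · obtain ⟨⟨a, ha⟩, -⟩ := hdisj _ _ hp.symm
      cases ha
    · exact .coll hB hp hβ hc ((ih hg hξ (insert_subset_swap hΔ)).mono push)
  | cut C' hC hβ hc hβ' hc' h h' ih ih' =>
    intro Γ hg hξ hΔ
    exact .cut C' hC hβ hc hβ' hc' ((ih hg hξ (insert_subset_swap hΔ)).mono push)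
      ((ih' hg hξ (insert_subset_swap hΔ)).mono push)

/-- Inversion for conjunctions. -/
theorem Der.inv_conj {k : ℕ} {ξ α : Ordinal.{0}} {Γ : Set IFml} {o : Option ZFSet.{0}}
    {F : ZFSet.{0} → IFml} (hg : Good ξ) (h : Der k ξ α (insert (conj o F) Γ)) {x : ZFSet.{0}}
    (hx : x.rank < ξ) (hxo : InRange o x) : Der k ξ α (insert (F x) Γ) := by
  refine (Der.replace (C := conj o F) (ξ₀ := ξ) (Θ := {F x}) ?_ ?_ ?_ h (Γ := Γ) hg le_rfl
    ?_).mono ?_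
  · rintro p ⟨⟩
  · rintro o F ⟨⟩
    exact ⟨x, hxo, hx, rfl⟩
  · rintro o F ⟨⟩
  · exact Set.insert_subset_insert Set.subset_union_left
  · rintro X (h | h)
    · exact Or.inr h
    · exact Or.inl h

/-- Inversion for bounded disjunctions. -/
theorem Der.inv_disj {k : ℕ} {ξ α : Ordinal.{0}} {Γ : Set IFml} {a : ZFSet.{0}}
    {F : ZFSet.{0} → IFml} (hg : Good ξ) (h : Der k ξ α (insert (IFml.disj (some a) F) Γ)) :
    Der k ξ α (Γ ∪ {A | ∃ x ∈ a, A = F x}) := by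
  refine Der.replace (C := IFml.disj (some a) F) (ξ₀ := ξ) ?_ ?_ ?_ h hg le_rfl ?_
  · rintro p ⟨⟩
  · rintro o F ⟨⟩
  · rintro o F ⟨⟩
    exact ⟨⟨a, rfl⟩, fun x hx => ⟨x, inRange_some.1 hx, rfl⟩⟩
  · exact Set.insert_subset_insert Set.subset_union_left

/-! ### Cut elimination -/

/-- Induction runs over the derivation with the disjunctive cut formula, since the dual conjunction
is invertible. The other derivation is added at the leaves, so the heights add up. -/
theorem Der.reduce {k : ℕ} {o : Option ZFSet.{0}} {F : ZFSet.{0} → IFml}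
    (hF : ∀ x, RankLE k (F x)) (hb : ¬ (IFml.disj o F).Basic) {ξ β : Ordinal.{0}} {Δ : Set IFml}
    (h : Der k ξ β Δ) : ∀ {α : Ordinal.{0}} {Γ : Set IFml}, Good ξ → Control ξ α →
      Der k ξ α (insert (IFml.disj o F).dual Γ) → Δ ⊆ insert (IFml.disj o F) Γ →
        Der k ξ (α + β) Γ := by
  have swap : ∀ {C D : IFml} {Γ Δ : Set IFml}, Δ ⊆ insert C Γ →
      insert D Δ ⊆ insert C (insert D Γ) := by
    intro C D Γ Δ h
    rw [Set.insert_comm]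
    exact Set.insert_subset_insert h
  have weak : ∀ {α ξ : Ordinal.{0}} {C D : IFml} {Γ : Set IFml}, Der k ξ α (insert C Γ) →
      Der k ξ α (insert C (insert D Γ)) := fun h =>
    h.mono (Set.insert_subset_insert (Set.subset_insert _ _))
  induction h with
  | ax hp hmem =>
    intro α Γ hg hα hd hΔ
    rcases hΔ hmem with h | h
    · cases h
    · exact .ax hp h
  | conjB β hmem ha hβ hc h ih =>
    intro α Γ hg hα hd hΔ
    rcases hΔ hmem with hp | hp
    · cases hp
    · exact .conjB (fun x => α + β x) hp ha (fun x hx => add_lt_add_right (hβ x hx) α)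
        (fun x hx => .add hα (hc x hx)) fun x hx => ih x hx hg hα (weak hd) (swap hΔ)
  | conjU β hmem hβ hc h ih =>
    intro α Γ hg hα hd hΔ
    rcases hΔ hmem with hp | hp
    · cases hp
    · exact .conjU (fun η x => α + β η x) hp
        (fun η hη hle x hx => add_lt_add_right (hβ η hη hle x hx) α)
        (fun η hη hle x hx => .add (hα.mono hle) (hc η hη hle x hx))
        fun η hη hle x hx => ih η hη hle x hx hη (hα.mono hle)
          (weak (hd.weaken le_rfl hle le_rfl subset_rfl)) (swap hΔ)
  | disj x hmem hx hxo hβ hc h ih =>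
    intro α Γ hg hα hd hΔ
    have h1 := ih hg hα (weak hd) (swap hΔ)
    rcases hΔ hmem with hp | hp
    · cases hp
      -- The principal inference becomes a cut of lower rank, on the instance F x, against the
      -- conjunction inverted at the same x.
      have h2 := hd.inv_conj hg hx hxo
      exact .cut (F x) (hF x) (add_lt_add_right hβ α) (.add hα hc) (add_lt_add_right hβ α)
        (.add hα hc) h1 (h2.height le_self_add)
    · exact .disj x hp hx hxo (add_lt_add_right hβ α) (.add hα hc) h1
  | coll hB hmem hβ hc h ih =>
    intro α Γ hg hα hd hΔ
    rcases hΔ hmem with hp | hp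
    -- The formula introduced by collection has a bounded matrix, contradicting that the cut formula
    -- is not basic.
    · refine absurd ?_ hb
      rw [← hp]
      exact Or.inr ⟨_, fun z => .conj fun x => .disj fun y => hB x y, Or.inr rfl⟩
    · exact .coll hB hp (add_lt_add_right hβ α) (.add hα hc) (ih hg hα (weak hd) (swap hΔ))
  | cut C hC hβ hc hβ' hc' h h' ih ih' =>
    intro α Γ hg hα hd hΔ
    exact .cut C hC (add_lt_add_right hβ α) (.add hα hc) (add_lt_add_right hβ' α) (.add hα hc')
      (ih hg hα (weak hd) (swap hΔ)) (ih' hg hα (weak hd) (swap hΔ))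

/-- After reduction the height is a sum of two ordinals below ω^α, which is additively principal;
this is the reason for one exponential per rank. -/
theorem Der.elim {k : ℕ} {ξ α : Ordinal.{0}} {Γ : Set IFml} (h : Der (k + 1) ξ α Γ) :
    Good ξ → Der k ξ (ω ^ α) Γ := by
  have mo : ∀ {a b : Ordinal.{0}}, a < b → ω ^ a < ω ^ b := fun h =>
    (opow_lt_opow_iff_right one_lt_omega0).2 h
  induction h with
  | ax hp hmem => exact fun _ => .ax hp hmem
  | conjB β hmem ha hβ hc h ih =>
    exact fun hg => .conjB (fun x => ω ^ β x) hmem ha (fun x hx => mo (hβ x hx))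
      (fun x hx => .opow (hc x hx)) fun x hx => ih x hx hg
  | conjU β hmem hβ hc h ih =>
    exact fun hg => .conjU (fun η x => ω ^ β η x) hmem
      (fun η hη hle x hx => mo (hβ η hη hle x hx))
      (fun η hη hle x hx => .opow (hc η hη hle x hx)) fun η hη hle x hx => ih η hη hle x hx hη
  | disj x hmem hx hxo hβ hc h ih =>
    exact fun hg => .disj x hmem hx hxo (mo hβ) (.opow hc) (ih hg)
  | coll hB hmem hβ hc h ih =>
    exact fun hg => .coll hB hmem (mo hβ) (.opow hc) (ih hg)
  | @cut ξ α β β' Γ C hC hβ hc hβ' hc' h h' ih ih' =>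
    intro hg
    have h1 := ih hg
    have h2 := ih' hg
    by_cases hk : RankLE k C
    · exact .cut C hk (mo hβ) (.opow hc) (mo hβ') (.opow hc') h1 h2
    have hb : ¬ C.Basic := fun hb => hk (RankLE.mono (Nat.zero_le k) (k := 0) hb)
    rcases hC with hC | ⟨o, F, hF, rfl | rfl⟩
    · exact absurd hC hk
    -- For a conjunctive cut formula the two premises exchange roles, the dual being the disjunction
    -- to reduce.
    · have hb' : ¬ (IFml.disj o fun x => (F x).dual).Basic := fun h => hb (by
        simpa [IFml.dual] using h.dual)
      refine (Der.reduce (fun x => (hF x).dual) hb' h2 hg (.opow hc) ?_ subset_rfl).height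
        (isPrincipal_add_omega0_opow α (mo hβ) (mo hβ')).le
      simpa [IFml.dual] using h1
    · exact (Der.reduce hF hb h1 hg (.opow hc') h2 subset_rfl).height
        (isPrincipal_add_omega0_opow α (mo hβ') (mo hβ)).le

/-! ### Collapsing -/

/-- Truth is read off by induction on the height: by persistence of Σ-formulas a true side formula
of a premise settles the conclusion, so only true principal instances need treatment. The parameter
γ records the collapsing already spent. -/
theorem Der.collapse {α : Ordinal.{0}} : ∀ {ξ γ : Ordinal.{0}} {Γ : Set IFml}, Der 0 ξ α Γ →
    Good ξ → ξ ≤ psi γ → γ ∈ BSet γ → (∀ A ∈ Γ, A.Sig) →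
      ∃ A ∈ Γ, A.ISat (psi (γ + ω ^ α)) := by
  induction α using WellFoundedLT.induction with
  | _ α ih =>
  intro ξ γ Γ h hg hξ hγ hΓ
  by_contra! hno
  have mo : ∀ {β : Ordinal.{0}}, β < α → γ + ω ^ β < γ + ω ^ α := fun h =>
    add_lt_add_right ((opow_lt_opow_iff_right one_lt_omega0).2 h) γ
  -- If no formula of Γ is true at the final stage, persistence rules out all side formulas in a
  -- collapsed premise, leaving its new formula C as the true one.
  have prem : ∀ {η γ' β : Ordinal.{0}} {C : IFml}, β < α → Der 0 η β (insert C Γ) → Good η →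
      η ≤ psi γ' → γ' ∈ BSet γ' → γ' + ω ^ β ≤ γ + ω ^ α → C.Sig →
      C.ISat (psi (γ' + ω ^ β)) := by
    intro η γ' β C hβ hd hη hle hγ' hb hC
    obtain ⟨A, hA, hs⟩ := ih β hβ hd hη hle hγ' (by
      rintro A (rfl | hA)
      · exact hC
      · exact hΓ A hA)
    rcases hA with rfl | hA
    · exact hs
    · exact absurd ((hΓ A hA).isat_mono (psi_mono hb) hs) (hno A hA)
  have prem' : ∀ {β : Ordinal.{0}} {C : IFml}, β < α → Der 0 ξ β (insert C Γ) → C.Sig →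
      C.ISat (psi (γ + ω ^ β)) := fun hβ hd hC => prem hβ hd hg hξ hγ (mo hβ).le hC
  have premα : ∀ {β : Ordinal.{0}} {C : IFml}, β < α → Der 0 ξ β (insert C Γ) → C.Sig →
      C.ISat (psi (γ + ω ^ α)) := fun hβ hd hC =>
    hC.isat_mono (psi_mono (mo hβ).le) (prem' hβ hd hC)
  -- Control of β puts γ + ω^β into the relevant closure, the condition under which `psi` is
  -- strictly increasing.
  have hmemB : ∀ {β : Ordinal.{0}}, Control ξ β → ∀ {ζ : Ordinal.{0}}, γ ≤ ζ →
      γ + ω ^ β ∈ BSet ζ := fun hc ζ hζ =>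
    add_mem_BSet (BSet_mono hζ hγ) (opow_mem_BSet (BSet_mono hζ (hc.mem_BSet hξ)))
  cases h with
  | ax hp hmem => exact hno _ hmem hp
  | @conjB _ _ _ a F β hmem ha hβ hc h =>
    cases hΓ _ hmem with
    | conj hS => exact hno _ hmem fun x hx => premα (hβ x hx) (h x hx) (hS x)
  | conjU β hmem hβ hc h => cases hΓ _ hmem
  | @disj _ _ β _ o F x hmem hx hxo hβ hc h =>
    cases hΓ _ hmem with
    | disj hS =>
      have h1 := premα hβ h (hS x)
      refine hno _ hmem ?_
      cases o with
      | none => exact ⟨x, (hx.trans_le hξ).trans_le (psi_mono le_self_add), h1⟩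
      | some a => exact ⟨x, inRange_some.1 hxo, h1⟩
  | @coll _ _ β _ a B hB hmem hβ hc h =>
    have h1 := prem' hβ h (.conj fun x => .disj fun y => (hB x y).sig)
    -- The collecting set is V_δ with δ = ψ(γ + ω^β), where the premise was already true. Strictness
    -- of `psi` is essential here: V_δ must itself have rank below the new stage.
    refine hno _ hmem ⟨ZFSet.vonNeumann (psi (γ + ω ^ β)), ?_, fun x hx => ?_⟩
    · rw [ZFSet.rank_vonNeumann]
      exact psi_lt_psi (mo hβ) (hmemB hc le_self_add)
    · obtain ⟨y, hy, h2⟩ := h1 x hx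
      exact ⟨y, ZFSet.mem_vonNeumann.2 hy, ((hB x y).isat_iff _ _).1 h2⟩
  | @cut _ _ β β' _ C hC hβ hc hβ' hc' h h' =>
    -- The cut formula may be taken to be an existential formula.
    have main : ∀ {β β' : Ordinal.{0}} {F : ZFSet.{0} → IFml}, (∀ x, (F x).Bdd) → β < α →
        β' < α → Control ξ β → Control ξ β' → Der 0 ξ β (insert (IFml.disj none F) Γ) →
        Der 0 ξ β' (insert (IFml.disj none F).dual Γ) → False := by
      intro β β' F hF hβ hβ' hc hc' h h'
      obtain ⟨x, hx, hs⟩ := prem' hβ h (.disj fun x => (hF x).sig)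
      -- The witness x has rank below ψ(γ + ω^β), so it is a parameter admissible for the control
      -- ψ(γ'). The universal premise is inverted there and collapsed starting from γ'.
      set γ' := γ + ω ^ β + 1 with hγ'
      have hlt : γ + ω ^ β < γ' := lt_add_one _
      have hle : γ ≤ γ' := le_self_add.trans hlt.le
      have h1 : psi (γ + ω ^ β) < psi γ' := psi_lt_psi hlt (hmemB hc hle)
      have h2 := (h'.weaken le_rfl (hξ.trans (psi_mono hle)) le_rfl subset_rfl).inv_conj
        (good_psi γ') (hx.trans h1) (inRange_none x)
      have hα : (1 : Ordinal.{0}) < ω ^ α := by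
        have := (opow_lt_opow_iff_right one_lt_omega0).2 ((zero_le (a := β)).trans_lt hβ)
        rwa [opow_zero] at this
      have h3 := prem hβ' h2 (good_psi γ') le_rfl
        (add_mem_BSet (hmemB hc hle) (one_mem_BSet _)) ?_ (hF x).dual.sig
      · exact (isat_dual _).1 h3 (((hF x).isat_iff _ _).1 hs)
      -- The two successive collapses fit into one because ω^β + 1 + ω^β' stays below the additively
      -- principal ω^α.
      · rw [hγ', add_assoc, add_assoc]
        refine add_le_add_right (le_of_lt ?_) γ
        exact isPrincipal_add_omega0_opow α ((opow_lt_opow_iff_right one_lt_omega0).2 hβ)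
          (isPrincipal_add_omega0_opow α hα ((opow_lt_opow_iff_right one_lt_omega0).2 hβ'))
    rcases hC with hC | ⟨F, hF, rfl | rfl⟩
    · exact (isat_dual C).1 (premα hβ' h' hC.dual.sig) (premα hβ h hC.sig)
    · refine main (F := fun x => (F x).dual) (fun x => (hF x).dual) hβ' hβ hc' hc h' ?_
      simpa [IFml.dual] using h
    · exact main hF hβ hβ' hc hc' h h'

/-! ### Binary connectives -/

/-- The index set of the binary connectives. -/
def two : ZFSet.{0} := {∅, {∅}}

theorem rank_two_lt {ξ : Ordinal.{0}} (h : Good ξ) : two.rank < ξ := by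
  simp only [two, ZFSet.rank_pair, ZFSet.rank_singleton, ZFSet.rank_empty, Order.succ_eq_add_one]
  exact max_lt (h.add_one h.pos) (h.add_one (h.add_one h.pos))

theorem singleton_empty_ne : ({∅} : ZFSet.{0}) ≠ ∅ := by
  intro h
  have : (∅ : ZFSet.{0}) ∈ ({∅} : ZFSet.{0}) := ZFSet.mem_singleton.2 rfl
  rw [h] at this
  exact ZFSet.notMem_empty _ this

namespace IFml

open Classical in
/-- Binary conjunction. -/
noncomputable def and (A B : IFml) : IFml := conj (some two) fun x => if x = ∅ then A else B

open Classical in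
/-- Binary disjunction. -/
noncomputable def or (A B : IFml) : IFml := disj (some two) fun x => if x = ∅ then A else B

@[simp] theorem dual_and (A B : IFml) : (and A B).dual = or A.dual B.dual := by
  simp only [and, or, dual]
  congr 1; funext x; split_ifs <;> rfl

@[simp] theorem dual_or (A B : IFml) : (or A B).dual = and A.dual B.dual := by
  simp only [and, or, dual]
  congr 1; funext x; split_ifs <;> rfl

@[simp] theorem isat_and {δ : Ordinal.{0}} (A B : IFml) :
    (and A B).ISat δ ↔ A.ISat δ ∧ B.ISat δ := by
  simp [and, ISat, two, singleton_empty_ne]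

@[simp] theorem isat_or {δ : Ordinal.{0}} (A B : IFml) :
    (or A B).ISat δ ↔ A.ISat δ ∨ B.ISat δ := by
  simp [or, ISat, two, singleton_empty_ne]

theorem Bdd.and {A B : IFml} (hA : A.Bdd) (hB : B.Bdd) : (IFml.and A B).Bdd :=
  .conj fun x => by split_ifs <;> assumption

theorem Bdd.or {A B : IFml} (hA : A.Bdd) (hB : B.Bdd) : (IFml.or A B).Bdd :=
  .disj fun x => by split_ifs <;> assumption

theorem Sig.and {A B : IFml} (hA : A.Sig) (hB : B.Sig) : (IFml.and A B).Sig :=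
  .conj fun x => by split_ifs <;> assumption

theorem Sig.or {A B : IFml} (hA : A.Sig) (hB : B.Sig) : (IFml.or A B).Sig :=
  .disj fun x => by split_ifs <;> assumption

theorem RankLE.and {k : ℕ} {A B : IFml} (hA : RankLE k A) (hB : RankLE k B) :
    RankLE (k + 1) (IFml.and A B) :=
  Or.inr ⟨_, _, fun x => by split_ifs <;> assumption, Or.inl rfl⟩

theorem RankLE.or {k : ℕ} {A B : IFml} (hA : RankLE k A) (hB : RankLE k B) :
    RankLE (k + 1) (IFml.or A B) :=
  Or.inr ⟨_, _, fun x => by split_ifs <;> assumption, Or.inr rfl⟩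

/-- `A` has depth at most `n`, and its parameters have rank below `ξ`. -/
inductive Below : Ordinal.{0} → ℕ → IFml → Prop
  | atom {ξ : Ordinal.{0}} {n : ℕ} (p : Prop) : Below ξ n (atom p)
  | conjB {ξ : Ordinal.{0}} {n : ℕ} {a : ZFSet.{0}} {F : ZFSet.{0} → IFml} (ha : a.rank < ξ)
      (h : ∀ x ∈ a, Below ξ n (F x)) : Below ξ (n + 1) (conj (some a) F)
  | disjB {ξ : Ordinal.{0}} {n : ℕ} {a : ZFSet.{0}} {F : ZFSet.{0} → IFml} (ha : a.rank < ξ)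
      (h : ∀ x ∈ a, Below ξ n (F x)) : Below ξ (n + 1) (disj (some a) F)
  | conjU {ξ : Ordinal.{0}} {n : ℕ} {F : ZFSet.{0} → IFml}
      (h : ∀ ξ', Good ξ' → ξ ≤ ξ' → ∀ x : ZFSet.{0}, x.rank < ξ' → Below ξ' n (F x)) :
      Below ξ (n + 1) (conj none F)
  | disjU {ξ : Ordinal.{0}} {n : ℕ} {F : ZFSet.{0} → IFml}
      (h : ∀ ξ', Good ξ' → ξ ≤ ξ' → ∀ x : ZFSet.{0}, x.rank < ξ' → Below ξ' n (F x)) :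
      Below ξ (n + 1) (disj none F)

theorem Below.mono {ξ : Ordinal.{0}} {n m : ℕ} {A : IFml} (h : Below ξ n A) (hnm : n ≤ m) :
    Below ξ m A := by
  induction h generalizing m with
  | atom p => exact .atom p
  | conjB ha h ih =>
    obtain ⟨m, rfl⟩ := Nat.exists_eq_add_of_le' (Nat.one_le_of_lt hnm)
    exact .conjB ha fun x hx => ih x hx (Nat.le_of_succ_le_succ hnm)
  | disjB ha h ih =>
    obtain ⟨m, rfl⟩ := Nat.exists_eq_add_of_le' (Nat.one_le_of_lt hnm)
    exact .disjB ha fun x hx => ih x hx (Nat.le_of_succ_le_succ hnm)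
  | conjU h ih =>
    obtain ⟨m, rfl⟩ := Nat.exists_eq_add_of_le' (Nat.one_le_of_lt hnm)
    exact .conjU fun η hη hle x hx => ih η hη hle x hx (Nat.le_of_succ_le_succ hnm)
  | disjU h ih =>
    obtain ⟨m, rfl⟩ := Nat.exists_eq_add_of_le' (Nat.one_le_of_lt hnm)
    exact .disjU fun η hη hle x hx => ih η hη hle x hx (Nat.le_of_succ_le_succ hnm)

theorem Below.dual {ξ : Ordinal.{0}} {n : ℕ} {A : IFml} (h : Below ξ n A) : Below ξ n A.dual := by
  induction h with
  | atom p => exact .atom _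
  | conjB ha h ih => exact .disjB ha ih
  | disjB ha h ih => exact .conjB ha ih
  | conjU h ih => exact .disjU ih
  | disjU h ih => exact .conjU ih

theorem Below.and {ξ : Ordinal.{0}} {n : ℕ} {A B : IFml} (hg : Good ξ) (hA : Below ξ n A)
    (hB : Below ξ n B) : Below ξ (n + 1) (IFml.and A B) :=
  .conjB (rank_two_lt hg) fun x _ => by split_ifs <;> assumption

theorem Below.or {ξ : Ordinal.{0}} {n : ℕ} {A B : IFml} (hg : Good ξ) (hA : Below ξ n A)
    (hB : Below ξ n B) : Below ξ (n + 1) (IFml.or A B) :=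
  .disjB (rank_two_lt hg) fun x _ => by split_ifs <;> assumption

end IFml

/-! ### Derived rules -/

theorem control_nat {ξ : Ordinal.{0}} (hg : Good ξ) (n : ℕ) : Control ξ n :=
  .base ((natCast_lt_omega0 n).trans hg.omega0_lt)

/-- True bounded formulas are derivable. -/
theorem der_of_isat {k : ℕ} {ξ : Ordinal.{0}} {n : ℕ} {A : IFml} (h : A.Below ξ n) (hb : A.Bdd)
    (hg : Good ξ) (hs : A.ISat ξ) {Γ : Set IFml} (hA : A ∈ Γ) : Der k ξ n Γ := by
  induction h generalizing Γ with
  | atom p => exact .ax hs hA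
  | @conjB ξ n a F ha h ih =>
    cases hb with
    | conj hb =>
      exact .conjB (fun _ => n) hA ha (fun _ _ => by exact_mod_cast Nat.lt_succ_self n)
        (fun _ _ => control_nat hg n) fun x hx => ih x hx (hb x) hg (hs x hx) (Set.mem_insert _ _)
  | @disjB ξ n a F ha h ih =>
    cases hb with
    | disj hb =>
      obtain ⟨x, hx, hs⟩ := hs
      exact .disj (β := n) x hA ((ZFSet.rank_lt_of_mem hx).trans ha) (inRange_some.2 hx)
        (by exact_mod_cast Nat.lt_succ_self n) (control_nat hg n)
        (ih x hx (hb x) hg hs (Set.mem_insert _ _))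
  | conjU h ih => cases hb
  | disjU h ih => cases hb

/-- The law of excluded middle. -/
theorem der_identity {k : ℕ} {ξ : Ordinal.{0}} {n : ℕ} {A : IFml} (h : A.Below ξ n) (hg : Good ξ)
    {Γ : Set IFml} (hA : A ∈ Γ) (hA' : A.dual ∈ Γ) : Der k ξ (2 * n : ℕ) Γ := by
  -- Each level of depth costs two inferences: the conjunction opens an arbitrary instance x, and
  -- the dual disjunction is then instantiated at the same x.
  have step : ∀ {ξ : Ordinal.{0}} {n : ℕ} {o : Option ZFSet.{0}} {F : ZFSet.{0} → IFml}
      {Γ : Set IFml} {x : ZFSet.{0}}, Good ξ → x.rank < ξ → InRange o x → IFml.disj o F ∈ Γ →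
      (∀ {Δ : Set IFml}, F x ∈ Δ → (F x).dual ∈ Δ → Der k ξ (2 * n : ℕ) Δ) →
      Der k ξ (2 * n + 1 : ℕ) (insert (F x).dual Γ) := by
    intro ξ n o F Γ x hg hx hxo hd h
    exact .disj (β := (2 * n : ℕ)) x (Set.mem_insert_of_mem _ hd) hx hxo
      (by exact_mod_cast Nat.lt_succ_self _) (control_nat hg _)
      (h (Set.mem_insert _ _) (Set.mem_insert_of_mem _ (Set.mem_insert _ _)))
  have step' : ∀ {ξ : Ordinal.{0}} {n : ℕ} {o : Option ZFSet.{0}} {F : ZFSet.{0} → IFml}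
      {Γ : Set IFml} {x : ZFSet.{0}}, Good ξ → x.rank < ξ → InRange o x →
      (IFml.conj o F).dual ∈ Γ →
      (∀ {Δ : Set IFml}, F x ∈ Δ → (F x).dual ∈ Δ → Der k ξ (2 * n : ℕ) Δ) →
      Der k ξ (2 * n + 1 : ℕ) (insert (F x) Γ) := by
    intro ξ n o F Γ x hg hx hxo hd h
    have := step (F := fun x => (F x).dual) hg hx hxo hd (n := n)
      fun h1 h2 => h (by simpa using h2) h1
    simpa using this
  have lt : ∀ n : ℕ, ((2 * n + 1 : ℕ) : Ordinal.{0}) < (2 * (n + 1) : ℕ) := fun n => by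
    exact_mod_cast (by omega : 2 * n + 1 < 2 * (n + 1))
  induction h generalizing Γ with
  | atom p =>
    by_cases hp : p
    · exact .ax hp hA
    · exact .ax hp hA'
  | @conjB ξ n a F ha h ih =>
    exact .conjB (fun _ => (2 * n + 1 : ℕ)) hA ha (fun _ _ => lt n) (fun _ _ => control_nat hg _)
      fun x hx => step' hg ((ZFSet.rank_lt_of_mem hx).trans ha) (inRange_some.2 hx) hA'
        (ih x hx hg)
  | @disjB ξ n a F ha h ih =>
    exact .conjB (fun _ => (2 * n + 1 : ℕ)) hA' ha (fun _ _ => lt n) (fun _ _ => control_nat hg _)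
      fun x hx => step hg ((ZFSet.rank_lt_of_mem hx).trans ha) (inRange_some.2 hx) hA (ih x hx hg)
  | @conjU ξ n F h ih =>
    exact .conjU (fun _ _ => (2 * n + 1 : ℕ)) hA (fun _ _ _ _ _ => lt n)
      (fun η hη _ _ _ => control_nat hη _)
      fun η hη hle x hx => step' hη hx (inRange_none x) hA' (ih η hη hle x hx hη)
  | @disjU ξ n F h ih =>
    exact .conjU (fun _ _ => (2 * n + 1 : ℕ)) hA' (fun _ _ _ _ _ => lt n)
      (fun η hη _ _ _ => control_nat hη _)
      fun η hη hle x hx => step hη hx (inRange_none x) hA (ih η hη hle x hx hη)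

theorem Der.and_intro {k : ℕ} {ξ α : Ordinal.{0}} {Γ : Set IFml} {A B : IFml} (hg : Good ξ)
    (hc : Control ξ α) (hmem : IFml.and A B ∈ Γ) (hA : Der k ξ α (insert A Γ))
    (hB : Der k ξ α (insert B Γ)) : Der k ξ (α + 1) Γ :=
  .conjB (fun _ => α) hmem (rank_two_lt hg) (fun _ _ => lt_add_one α) (fun _ _ => hc)
    fun x _ => by split_ifs <;> assumption

theorem Der.or_left {k : ℕ} {ξ α : Ordinal.{0}} {Γ : Set IFml} {A B : IFml} (hg : Good ξ)
    (hc : Control ξ α) (hmem : IFml.or A B ∈ Γ) (hA : Der k ξ α (insert A Γ)) :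
    Der k ξ (α + 1) Γ :=
  .disj ∅ hmem (by simpa using hg.pos) (by simp [two]) (lt_add_one α) hc (by simpa using hA)

theorem Der.or_right {k : ℕ} {ξ α : Ordinal.{0}} {Γ : Set IFml} {A B : IFml} (hg : Good ξ)
    (hc : Control ξ α) (hmem : IFml.or A B ∈ Γ) (hB : Der k ξ α (insert B Γ)) :
    Der k ξ (α + 1) Γ :=
  .disj {∅} hmem (by simpa using hg.one_lt) (by simp [two]) (lt_add_one α) hc
    (by simpa [singleton_empty_ne] using hB)

theorem Der.and_left {k : ℕ} {ξ α : Ordinal.{0}} {Γ : Set IFml} {A B : IFml} (hg : Good ξ)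
    (h : Der k ξ α (insert (IFml.and A B) Γ)) : Der k ξ α (insert A Γ) := by
  have := h.inv_conj hg (x := ∅) (by simpa using hg.pos) (by simp [two])
  simpa using this

theorem Der.and_right {k : ℕ} {ξ α : Ordinal.{0}} {Γ : Set IFml} {A B : IFml} (hg : Good ξ)
    (h : Der k ξ α (insert (IFml.and A B) Γ)) : Der k ξ α (insert B Γ) := by
  have := h.inv_conj hg (x := {∅}) (by simpa using hg.one_lt) (by simp [two])
  simpa [singleton_empty_ne] using this

theorem Der.inv_or {k : ℕ} {ξ α : Ordinal.{0}} {Γ : Set IFml} {A B : IFml} (hg : Good ξ)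
    (h : Der k ξ α (insert (IFml.or A B) Γ)) : Der k ξ α (insert A (insert B Γ)) := by
  refine (h.inv_disj hg).mono ?_
  rintro X (hX | ⟨x, -, rfl⟩)
  · exact Or.inr (Or.inr hX)
  · split_ifs
    · exact Or.inl rfl
    · exact Or.inr (Or.inl rfl)

/-- The heights `Ω + m` of the embedded finite derivations. -/
noncomputable def hgt (m : ℕ) : Ordinal.{0} := Om + m

theorem hgt_succ (m : ℕ) : hgt m + 1 = hgt (m + 1) := by simp [hgt, add_assoc]

theorem hgt_mono {m n : ℕ} (h : m ≤ n) : hgt m ≤ hgt n := by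
  unfold hgt; gcongr

theorem hgt_lt {m n : ℕ} (h : m < n) : hgt m < hgt n := by
  unfold hgt; gcongr

theorem nat_le_hgt {m n : ℕ} (h : m ≤ n) : (m : Ordinal.{0}) ≤ hgt n :=
  (Nat.cast_le.2 h).trans le_add_self

theorem control_hgt {ξ : Ordinal.{0}} (hg : Good ξ) (m : ℕ) : Control ξ (hgt m) :=
  .add .Omega (control_nat hg m)

/-- False bounded formulas may be dropped. -/
theorem Der.drop_bdd {k : ℕ} {ξ : Ordinal.{0}} {Γ : Set IFml} {A : IFml} {m n : ℕ} (hg : Good ξ)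
    (hb : A.Bdd) (hn : A.Below ξ n) (hs : ¬ A.ISat ξ) (h : Der k ξ (hgt m) (insert A Γ)) :
    Der k ξ (hgt (m + n + 1)) Γ := by
  refine .cut A (RankLE.mono (Nat.zero_le k) (k := 0) (Or.inl hb)) (β := hgt (m + n))
    (β' := hgt (m + n)) (hgt_lt (Nat.lt_succ_self _)) (control_hgt hg _)
    (hgt_lt (Nat.lt_succ_self _)) (control_hgt hg _) (h.height (hgt_mono (by omega))) ?_
  exact (der_of_isat hn.dual hb.dual hg ((isat_dual A).2 hs) (Set.mem_insert _ _)).height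
    (nat_le_hgt (by omega))

/-- A bounded universal quantifier from its guarded instances. -/
theorem Der.guarded_conj {k : ℕ} {ξ : Ordinal.{0}} {Γ : Set IFml} {m n : ℕ} {a : ZFSet.{0}}
    {F g : ZFSet.{0} → IFml} (hg : Good ξ) (hmem : conj (some a) F ∈ Γ) (ha : a.rank < ξ)
    (h : ∀ x ∈ a, (g x).Bdd ∧ (g x).Below ξ n ∧ (g x).ISat ξ ∧
      Der k ξ (hgt m) (insert (IFml.or (g x).dual (F x)) Γ)) :
    Der k ξ (hgt (m + n + 2)) Γ := by
  refine .conjB (fun _ => hgt (m + n + 1)) hmem ha (fun _ _ => hgt_lt (Nat.lt_succ_self _))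
    (fun _ _ => control_hgt hg _) fun x hx => ?_
  obtain ⟨hb, hn, hs, hd⟩ := h x hx
  exact (hd.inv_or hg).drop_bdd hg hb.dual hn.dual fun h => (isat_dual _).1 h hs

/-- A bounded existential quantifier from a guarded instance. -/
theorem Der.guarded_disj {k : ℕ} {ξ : Ordinal.{0}} {Γ : Set IFml} {m n : ℕ} {a x : ZFSet.{0}}
    {F : ZFSet.{0} → IFml} {g : IFml} (hg : Good ξ) (hmem : IFml.disj (some a) F ∈ Γ)
    (hx : x.rank < ξ) (hb : g.Bdd) (hn : g.Below ξ n) (hs : g.ISat ξ → x ∈ a)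
    (h : Der k ξ (hgt m) (insert (IFml.and g (F x)) Γ)) :
    Der k ξ (hgt (m + n + 2)) Γ := by
  -- Outside a the guard is false, so the left conjunct of the premise can be cut away and Γ follows
  -- without the quantifier.
  by_cases hxa : x ∈ a
  · exact .disj (β := hgt m) x hmem hx (inRange_some.2 hxa) (hgt_lt (by omega)) (control_hgt hg m)
      (h.and_right hg)
  · exact ((h.and_left hg).drop_bdd hg hb hn fun h => hxa (hs h)).height (hgt_mono (by omega))

/-- A true existential formula with bounded matrix. -/
theorem der_ex_of_isat {k : ℕ} {ξ : Ordinal.{0}} {Γ : Set IFml} {n : ℕ} {F : ZFSet.{0} → IFml}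
    (hg : Good ξ) (hmem : IFml.disj none F ∈ Γ) {x : ZFSet.{0}} (hx : x.rank < ξ)
    (hb : (F x).Bdd) (hn : (F x).Below ξ n) (hs : (F x).ISat ξ) : Der k ξ (hgt (n + 1)) Γ :=
  .disj (β := hgt n) x hmem hx (inRange_none x) (hgt_lt (Nat.lt_succ_self n)) (control_hgt hg n)
    ((der_of_isat hn hb hg hs (Set.mem_insert _ _)).height (nat_le_hgt le_rfl))

/-- Transfinite induction along the membership relation. -/
theorem der_set_induction {k n : ℕ} {F : ZFSet.{0} → IFml} {ξ : Ordinal.{0}} (hg : Good ξ)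
    (hF : ∀ x : ZFSet.{0}, x.rank < ξ → (F x).Below ξ n) (s : ZFSet.{0}) :
    s.rank < ξ → ∀ {Γ : Set IFml},
      IFml.disj none (fun u => IFml.and (conj (some u) F) (F u).dual) ∈ Γ → F s ∈ Γ →
      Der k ξ (ω ^ (s.rank + 1)) Γ := by
  induction s using ZFSet.inductionOn with
  | _ s ih =>
    intro hs Γ hP hG
    have h0 : ω ^ s.rank < ω ^ (s.rank + 1) :=
      (opow_lt_opow_iff_right one_lt_omega0).2 (lt_add_one _)
    have hω : ∀ j : ℕ, (j : Ordinal.{0}) < ω ^ (s.rank + 1) := fun j => by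
      refine (natCast_lt_omega0 j).trans_le ?_
      conv_lhs => rw [← opow_one ω]
      exact opow_le_opow_right omega0_pos le_add_self
    have hlt : ∀ j : ℕ, ω ^ s.rank + j < ω ^ (s.rank + 1) := fun j =>
      isPrincipal_add_omega0_opow _ h0 (hω j)
    have hξ : ω ^ (s.rank + 1) < ξ := hg.opow (hg.add_one hs)
    have hcon : ∀ j : ℕ, Control ξ (ω ^ s.rank + j) := fun j => .base ((hlt j).trans hξ)
    -- The set s itself is offered as failure of progressiveness. Its elements satisfy F by
    -- induction with heights at most ω^(rank s), and excluded middle for F s costs 2n; the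
    -- remaining summand pays for the connectives.
    refine .disj (β := ω ^ s.rank + (2 * n + 2 : ℕ)) s hP hs (inRange_none s) (hlt _) (hcon _) ?_
    have e : ω ^ s.rank + ((2 * n + 2 : ℕ) : Ordinal.{0}) = ω ^ s.rank + (2 * n + 1 : ℕ) + 1 := by
      rw [add_assoc]; congr 1
    rw [e]
    refine Der.and_intro hg (hcon _) (Set.mem_insert _ _) ?_ ?_
    · refine .conjB (fun x => ω ^ (x.rank + 1)) (Set.mem_insert _ _) hs (fun x hx => ?_)
        (fun x hx => ?_) fun x hx => ?_
      · refine (opow_le_opow_right omega0_pos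
          (Order.add_one_le_of_lt (ZFSet.rank_lt_of_mem hx))).trans_lt ?_
        push_cast
        rw [← add_assoc]
        exact le_self_add.trans_lt (lt_add_one _)
      · exact .base (hg.opow (hg.add_one ((ZFSet.rank_lt_of_mem hx).trans hs)))
      · exact ih x hx ((ZFSet.rank_lt_of_mem hx).trans hs) (by simp [hP]) (Set.mem_insert _ _)
    · refine (der_identity (hF s hs) hg (Γ := _) (by simp [hG]) (Set.mem_insert _ _)).height ?_
      refine (Nat.cast_le.2 (Nat.le_succ (2 * n))).trans le_add_self

/-! ### Translation of the finite language -/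

/-- The infinitary formula expressed by `A` under an assignment. -/
noncomputable def tr (v : ℕ → ZFSet.{0}) : {n : ℕ} → (Fin n → ZFSet.{0}) → Fml n → IFml
  | _, e, .mem s t => atom (s.eval v e ∈ t.eval v e)
  | _, e, .neg A => (tr v e A).dual
  | _, e, .and A B => IFml.and (tr v e A) (tr v e B)
  | _, e, .or A B => IFml.or (tr v e A) (tr v e B)
  | _, e, .imp A B => IFml.or (tr v e A).dual (tr v e B)
  | _, e, .all F => conj none fun x => tr v (Fin.cons x e) F
  | _, e, .ex F => disj none fun x => tr v (Fin.cons x e) F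
  | _, e, .ball t F => conj (some (t.eval v e)) fun x => tr v (Fin.cons x e) F
  | _, e, .bex t F => disj (some (t.eval v e)) fun x => tr v (Fin.cons x e) F
  | _, e, .eall s t F =>
      conj (some (ZFSet.funs (s.eval v e) (t.eval v e))) fun x => tr v (Fin.cons x e) F
  | _, e, .eex s t F =>
      disj (some (ZFSet.funs (s.eval v e) (t.eval v e))) fun x => tr v (Fin.cons x e) F

/-- The depth of a formula, not counting negations. -/
def Fml.depth : {n : ℕ} → Fml n → ℕ
  | _, .mem _ _ => 0
  | _, .neg A => A.depth
  | _, .and A B => max A.depth B.depth + 1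
  | _, .or A B => max A.depth B.depth + 1
  | _, .imp A B => max A.depth B.depth + 1
  | _, .all F => F.depth + 1
  | _, .ex F => F.depth + 1
  | _, .ball _ F => F.depth + 1
  | _, .bex _ F => F.depth + 1
  | _, .eall _ _ F => F.depth + 1
  | _, .eex _ _ F => F.depth + 1

theorem eval_subst {n m : ℕ} (v : ℕ → ZFSet.{0}) (e : Fin m → ZFSet.{0}) (σ : Fin n → Tm m)
    (t : Tm n) : (t.subst σ).eval v e = t.eval v fun k => (σ k).eval v e := by
  cases t <;> rfl

theorem eval_upSubst {n m : ℕ} (v : ℕ → ZFSet.{0}) (e : Fin m → ZFSet.{0}) (σ : Fin n → Tm m)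
    (x : ZFSet.{0}) : (fun k => (upSubst σ k).eval v (Fin.cons x e : Fin (m + 1) → ZFSet.{0})) =
      (Fin.cons x fun k => (σ k).eval v e : Fin (n + 1) → ZFSet.{0}) := by
  funext k
  refine Fin.cases ?_ (fun k => ?_) k
  · rfl
  · simp [upSubst]

theorem tr_subst {n m : ℕ} (v : ℕ → ZFSet.{0}) (e : Fin m → ZFSet.{0}) (σ : Fin n → Tm m)
    (A : Fml n) : tr v e (A.subst σ) = tr v (fun k => (σ k).eval v e) A := by
  induction A generalizing m with
  | mem s t => simp [Fml.subst, tr, eval_subst]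
  | neg A ih => simp [Fml.subst, tr, ih]
  | and A B ihA ihB => simp [Fml.subst, tr, ihA, ihB]
  | or A B ihA ihB => simp [Fml.subst, tr, ihA, ihB]
  | imp A B ihA ihB => simp [Fml.subst, tr, ihA, ihB]
  | all F ih => simp [Fml.subst, tr, ih, eval_upSubst]
  | ex F ih => simp [Fml.subst, tr, ih, eval_upSubst]
  | ball t F ih => simp [Fml.subst, tr, ih, eval_upSubst, eval_subst]
  | bex t F ih => simp [Fml.subst, tr, ih, eval_upSubst, eval_subst]
  | eall s t F ih => simp [Fml.subst, tr, ih, eval_upSubst, eval_subst]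
  | eex s t F ih => simp [Fml.subst, tr, ih, eval_upSubst, eval_subst]

theorem isDelta0_subst {n m : ℕ} (σ : Fin n → Tm m) (A : Fml n) :
    (A.subst σ).IsDelta0 ↔ A.IsDelta0 := by
  induction A generalizing m <;> simp [Fml.subst, Fml.IsDelta0, *]

theorem eval_congr {n : ℕ} {v v' : ℕ → ZFSet.{0}} {e : Fin n → ZFSet.{0}} {t : Tm n}
    (h : ∀ i ∈ t.fvs, v i = v' i) : t.eval v e = t.eval v' e := by
  cases t with
  | fv i => exact h i (by simp [Tm.fvs])
  | bv k => rfl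

theorem tr_congr {n : ℕ} {v v' : ℕ → ZFSet.{0}} {e : Fin n → ZFSet.{0}} {A : Fml n}
    (h : ∀ i ∈ A.fvs, v i = v' i) : tr v e A = tr v' e A := by
  induction A with
  | mem s t =>
    simp only [Fml.fvs, Finset.mem_union] at h
    simp only [tr]
    rw [eval_congr fun i hi => h i (Or.inl hi), eval_congr fun i hi => h i (Or.inr hi)]
  | neg A ih => simp only [tr, ih h]
  | and A B ihA ihB | or A B ihA ihB | imp A B ihA ihB =>
    simp only [Fml.fvs, Finset.mem_union] at h
    simp only [tr, ihA fun i hi => h i (Or.inl hi), ihB fun i hi => h i (Or.inr hi)]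
  | all F ih | ex F ih => simp only [tr, ih h]
  | ball t F ih | bex t F ih =>
    simp only [Fml.fvs, Finset.mem_union] at h
    simp only [tr, ih fun i hi => h i (Or.inr hi), eval_congr fun i hi => h i (Or.inl hi)]
  | eall s t F ih | eex s t F ih =>
    simp only [Fml.fvs, Finset.mem_union] at h
    have hs : s.eval v e = s.eval v' e := eval_congr fun i hi => h i (Or.inl (Or.inl hi))
    have ht : t.eval v e = t.eval v' e := eval_congr fun i hi => h i (Or.inl (Or.inr hi))
    simp only [tr, ih fun i hi => h i (Or.inr hi), hs, ht]

theorem tr_bdd {n : ℕ} {v : ℕ → ZFSet.{0}} {e : Fin n → ZFSet.{0}} {A : Fml n}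
    (h : A.IsDelta0) : (tr v e A).Bdd := by
  induction A with
  | mem s t => exact .atom _
  | neg A ih => exact (ih h).dual
  | and A B ihA ihB => exact (ihA h.1).and (ihB h.2)
  | or A B ihA ihB => exact (ihA h.1).or (ihB h.2)
  | imp A B ihA ihB => exact (ihA h.1).dual.or (ihB h.2)
  | all F ih => exact h.elim
  | ex F ih => exact h.elim
  | ball t F ih => exact .conj fun _ => ih h
  | bex t F ih => exact .disj fun _ => ih h
  | eall s t F ih => exact .conj fun _ => ih h
  | eex s t F ih => exact .disj fun _ => ih h

/-- Negation is translated by dualization, so the Π case amounts to the dual being a Σ-formula, and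
both cases go through one induction. -/
theorem tr_sig {p : Polarity} {n : ℕ} {A : Fml n} (h : InClass p A) (v : ℕ → ZFSet.{0})
    (e : Fin n → ZFSet.{0}) :
    match p with
    | .sigma => (tr v e A).Sig
    | .pi => (tr v e A).dual.Sig := by
  induction h with
  | @delta0 p _ _ h => cases p <;> [exact (tr_bdd h).sig; exact (tr_bdd h).dual.sig]
  | @and p _ _ _ _ _ ih ih' =>
    cases p
    · exact (ih e).and (ih' e)
    · simpa [tr] using (ih e).or (ih' e)
  | @or p _ _ _ _ _ ih ih' =>
    cases p
    · exact (ih e).or (ih' e)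
    · simpa [tr] using (ih e).and (ih' e)
  | @ball p _ _ _ _ ih => cases p <;> [exact .conj fun _ => ih _; exact .disj fun _ => ih _]
  | @bex p _ _ _ _ ih => cases p <;> [exact .disj fun _ => ih _; exact .conj fun _ => ih _]
  | @eall p _ _ _ _ _ ih => cases p <;> [exact .conj fun _ => ih _; exact .disj fun _ => ih _]
  | @eex p _ _ _ _ _ ih => cases p <;> [exact .disj fun _ => ih _; exact .conj fun _ => ih _]
  | ex _ ih => exact .disj fun _ => ih _
  | all _ ih => exact .disj fun _ => ih _
  | @neg p _ _ _ ih =>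
    cases p
    · exact ih e
    · simpa [tr, Polarity.dual] using ih e
  | @imp p _ _ _ _ _ ih ih' =>
    cases p
    · exact (show Sig _ from ih e).or (ih' e)
    · simpa [tr, Polarity.dual] using (show Sig _ from ih e).and (ih' e)

theorem tr_rankLE {n : ℕ} (v : ℕ → ZFSet.{0}) (e : Fin n → ZFSet.{0}) (A : Fml n) :
    RankLE A.depth (tr v e A) := by
  induction A with
  | mem s t => exact Or.inl (.atom _)
  | neg A ih => exact (ih e).dual
  | and A B ihA ihB => exact ((ihA e).mono (le_max_left _ _)).and ((ihB e).mono (le_max_right _ _))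
  | or A B ihA ihB => exact ((ihA e).mono (le_max_left _ _)).or ((ihB e).mono (le_max_right _ _))
  | imp A B ihA ihB =>
    exact ((ihA e).dual.mono (le_max_left _ _)).or ((ihB e).mono (le_max_right _ _))
  | all F ih | ball t F ih | eall s t F ih => exact Or.inr ⟨_, _, fun _ => ih _, Or.inl rfl⟩
  | ex F ih | bex t F ih | eex s t F ih => exact Or.inr ⟨_, _, fun _ => ih _, Or.inr rfl⟩

theorem eval_rank_lt {n : ℕ} {ξ : Ordinal.{0}} {v : ℕ → ZFSet.{0}} {e : Fin n → ZFSet.{0}}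
    (hv : ∀ i, (v i).rank < ξ) (he : ∀ i, (e i).rank < ξ) (t : Tm n) : (t.eval v e).rank < ξ := by
  cases t with
  | fv i => exact hv i
  | bv k => exact he k

theorem cons_rank_lt {n : ℕ} {ξ : Ordinal.{0}} {e : Fin n → ZFSet.{0}}
    (he : ∀ i, (e i).rank < ξ) {x : ZFSet.{0}} (hx : x.rank < ξ) (i : Fin (n + 1)) :
    ((Fin.cons x e : Fin (n + 1) → ZFSet.{0}) i).rank < ξ :=
  Fin.cases hx he i

theorem rank_isFunc_lt {ξ : Ordinal.{0}} (hg : Good ξ) {a b x : ZFSet.{0}} (ha : a.rank < ξ)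
    (hb : b.rank < ξ) (h : ZFSet.IsFunc a b x) : x.rank < ξ :=
  (rank_isFunc_le (le_max_left _ _) (le_max_right _ _) h).trans_lt
    (hg.add (max_lt ha hb) (by exact_mod_cast (natCast_lt_omega0 2).trans hg.omega0_lt))

/-- Passing to a function set raises the rank by at most three, which an epsilon number does not
notice. This allows exponentiation bounded quantifiers to be treated as bounded ones. -/
theorem rank_funs_lt {ξ : Ordinal.{0}} (hg : Good ξ) {a b : ZFSet.{0}} (ha : a.rank < ξ)
    (hb : b.rank < ξ) : (ZFSet.funs a b).rank < ξ := by
  have h2 : max a.rank b.rank + 2 < ξ :=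
    hg.add (max_lt ha hb) (by exact_mod_cast (natCast_lt_omega0 2).trans hg.omega0_lt)
  refine lt_of_le_of_lt (ZFSet.rank_le_iff.2 fun x hx => ?_) (hg.add_one h2)
  exact (rank_isFunc_le (le_max_left _ _) (le_max_right _ _) (ZFSet.mem_funs.1 hx)).trans_lt
    (lt_add_one _)

theorem tr_below {n : ℕ} {ξ : Ordinal.{0}} {v : ℕ → ZFSet.{0}} {e : Fin n → ZFSet.{0}}
    (hg : Good ξ) (hv : ∀ i, (v i).rank < ξ) (he : ∀ i, (e i).rank < ξ) (A : Fml n) :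
    (tr v e A).Below ξ A.depth := by
  have up : ∀ {ξ' : Ordinal.{0}}, ξ ≤ ξ' → ∀ i, (v i).rank < ξ' := fun h i => (hv i).trans_le h
  induction A generalizing ξ with
  | mem s t => exact .atom _
  | neg A ih => exact (ih hg hv he up).dual
  | and A B ihA ihB =>
    exact ((ihA hg hv he up).mono (le_max_left _ _)).and hg
      ((ihB hg hv he up).mono (le_max_right _ _))
  | or A B ihA ihB =>
    exact ((ihA hg hv he up).mono (le_max_left _ _)).or hg
      ((ihB hg hv he up).mono (le_max_right _ _))
  | imp A B ihA ihB =>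
    exact ((ihA hg hv he up).dual.mono (le_max_left _ _)).or hg
      ((ihB hg hv he up).mono (le_max_right _ _))
  | all F ih =>
    exact .conjU fun η hη hle x hx => ih hη (up hle)
      (cons_rank_lt (fun i => (he i).trans_le hle) hx) fun h => up (hle.trans h)
  | ex F ih =>
    exact .disjU fun η hη hle x hx => ih hη (up hle)
      (cons_rank_lt (fun i => (he i).trans_le hle) hx) fun h => up (hle.trans h)
  | ball t F ih =>
    have ht := eval_rank_lt hv he t
    exact .conjB ht fun x hx => ih hg hv
      (cons_rank_lt he ((ZFSet.rank_lt_of_mem hx).trans ht)) up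
  | bex t F ih =>
    have ht := eval_rank_lt hv he t
    exact .disjB ht fun x hx => ih hg hv
      (cons_rank_lt he ((ZFSet.rank_lt_of_mem hx).trans ht)) up
  | eall s t F ih =>
    have ht := rank_funs_lt hg (eval_rank_lt hv he s) (eval_rank_lt hv he t)
    exact .conjB ht fun x hx => ih hg hv
      (cons_rank_lt he ((ZFSet.rank_lt_of_mem hx).trans ht)) up
  | eex s t F ih =>
    have ht := rank_funs_lt hg (eval_rank_lt hv he s) (eval_rank_lt hv he t)
    exact .disjB ht fun x hx => ih hg hv
      (cons_rank_lt he ((ZFSet.rank_lt_of_mem hx).trans ht)) up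

/-- V_ξ contains all elements of its members and all functions between its members, so restricting
bounded and exponentiation bounded quantifiers to V_ξ changes nothing. -/
theorem isat_tr_iff {n : ℕ} {ξ : Ordinal.{0}} {v : ℕ → ZFSet.{0}} {e : Fin n → ZFSet.{0}}
    (hg : Good ξ) (hv : ∀ i, (v i).rank < ξ) (he : ∀ i, (e i).rank < ξ) (A : Fml n) :
    (tr v e A).ISat ξ ↔ Sat {x | x.rank < ξ} v e A := by
  induction A with
  | mem s t => rfl
  | neg A ih => simp [tr, Sat, isat_dual, ih he]
  | and A B ihA ihB => simp [tr, Sat, ihA he, ihB he]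
  | or A B ihA ihB => simp [tr, Sat, ihA he, ihB he]
  | imp A B ihA ihB => simp [tr, Sat, isat_dual, ihA he, ihB he, imp_iff_not_or]
  | all F ih => exact forall₂_congr fun x hx => ih (cons_rank_lt he hx)
  | ex F ih => exact exists_congr fun x => and_congr_right fun hx => ih (cons_rank_lt he hx)
  | ball t F ih =>
    have ht := eval_rank_lt hv he t
    refine forall_congr' fun x => ⟨fun h hx hxt => (ih (cons_rank_lt he hx)).1 (h hxt),
      fun h hxt => ?_⟩
    have hx := (ZFSet.rank_lt_of_mem hxt).trans ht
    exact (ih (cons_rank_lt he hx)).2 (h hx hxt)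
  | bex t F ih =>
    have ht := eval_rank_lt hv he t
    refine exists_congr fun x => ⟨fun ⟨hxt, h⟩ => ?_,
      fun ⟨hx, hxt, h⟩ => ⟨hxt, (ih (cons_rank_lt he hx)).2 h⟩⟩
    have hx := (ZFSet.rank_lt_of_mem hxt).trans ht
    exact ⟨hx, hxt, (ih (cons_rank_lt he hx)).1 h⟩
  | eall s t F ih =>
    refine forall_congr' fun x => ⟨fun h hx hxt => (ih (cons_rank_lt he hx)).1
      (h (ZFSet.mem_funs.2 hxt)), fun h hxt => ?_⟩
    have hx := rank_isFunc_lt hg (eval_rank_lt hv he s) (eval_rank_lt hv he t)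
      (ZFSet.mem_funs.1 hxt)
    exact (ih (cons_rank_lt he hx)).2 (h hx (ZFSet.mem_funs.1 hxt))
  | eex s t F ih =>
    refine exists_congr fun x => ⟨fun ⟨hxt, h⟩ => ?_,
      fun ⟨hx, hxt, h⟩ => ⟨ZFSet.mem_funs.2 hxt, (ih (cons_rank_lt he hx)).2 h⟩⟩
    have hx := rank_isFunc_lt hg (eval_rank_lt hv he s) (eval_rank_lt hv he t)
      (ZFSet.mem_funs.1 hxt)
    exact ⟨hx, ZFSet.mem_funs.1 hxt, (ih (cons_rank_lt he hx)).1 h⟩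

theorem isDelta0_opairMemF {n : ℕ} (y z x : Tm n) : (opairMemF y z x).IsDelta0 := by
  simp [opairMemF, opairF, upairF, eqF, Fml.IsDelta0]

theorem isDelta0_funF {n : ℕ} (x a b : Tm n) : (funF x a b).IsDelta0 := by
  simp only [funF, Fml.IsDelta0, isDelta0_opairMemF]
  simp [opairF, upairF, eqF, Fml.IsDelta0]

/-! ### Sequents -/

theorem cons_elim0 (x : ZFSet.{0}) :
    (Fin.cons x Fin.elim0 : Fin 1 → ZFSet.{0}) = fun _ => x := by
  funext i
  exact Fin.cases rfl (fun k => k.elim0) i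

/-- The translation of formulas without dangling bound variables. -/
noncomputable def tr₀ (v : ℕ → ZFSet.{0}) (A : Formula) : IFml := tr v Fin.elim0 A

theorem tr₀_app (v : ℕ → ZFSet.{0}) (F : Fml 1) (a : ℕ) :
    tr₀ v (F.app (.fv a)) = tr v (fun _ => v a) F := by
  rw [tr₀, Fml.app, tr_subst]; rfl

/-- The infinitary sequent expressed by `Γ ⇒ Δ`. -/
def sequent (v : ℕ → ZFSet.{0}) (Γ : Finset Formula) (Δ : Option Formula) : Set IFml :=
  {X | (∃ A ∈ Γ, X = (tr₀ v A).dual) ∨ ∃ A ∈ Δ, X = tr₀ v A}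

theorem sequent_insert (v : ℕ → ZFSet.{0}) (A : Formula) (Γ : Finset Formula)
    (Δ : Option Formula) : sequent v (insert A Γ) Δ = insert (tr₀ v A).dual (sequent v Γ Δ) := by
  ext X
  simp only [sequent, Finset.mem_insert, Set.mem_ofPred_eq, Set.mem_insert_iff]
  constructor
  · rintro (⟨B, rfl | hB, rfl⟩ | h)
    · exact Or.inl rfl
    · exact Or.inr (Or.inl ⟨B, hB, rfl⟩)
    · exact Or.inr (Or.inr h)
  · rintro (rfl | ⟨B, hB, rfl⟩ | h)
    · exact Or.inl ⟨A, Or.inl rfl, rfl⟩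
    · exact Or.inl ⟨B, Or.inr hB, rfl⟩
    · exact Or.inr h

theorem sequent_some (v : ℕ → ZFSet.{0}) (A : Formula) (Γ : Finset Formula) :
    sequent v Γ (some A) = insert (tr₀ v A) (sequent v Γ none) := by
  ext X
  simp only [sequent, Set.mem_ofPred_eq, Set.mem_insert_iff, Option.mem_def, Option.some.injEq,
    exists_eq_left', reduceCtorEq, false_and, exists_false, or_false]
  exact or_comm

theorem sequent_none_subset (v : ℕ → ZFSet.{0}) (Γ : Finset Formula) (Δ : Option Formula) :
    sequent v Γ none ⊆ sequent v Γ Δ := by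
  rintro X (h | ⟨B, hB, -⟩)
  · exact Or.inl h
  · cases hB

theorem sequent_fresh {v : ℕ → ZFSet.{0}} {c : ℕ} {Γ : Finset Formula} {Δ : Option Formula}
    (h : Fresh c Γ Δ) (x : ZFSet.{0}) :
    sequent (Function.update v c x) Γ Δ = sequent v Γ Δ := by
  have key : ∀ A : Formula, c ∉ A.fvs → tr₀ (Function.update v c x) A = tr₀ v A := by
    intro A hA
    refine tr_congr fun i hi => ?_
    rw [Function.update_of_ne]
    rintro rfl
    exact hA hi
  ext X
  simp only [sequent, Set.mem_ofPred_eq]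
  constructor
  · rintro (⟨A, hA, rfl⟩ | ⟨A, hA, rfl⟩)
    · exact Or.inl ⟨A, hA, by rw [key A (h.1 A hA)]⟩
    · exact Or.inr ⟨A, hA, by rw [key A (h.2 A hA)]⟩
  · rintro (⟨A, hA, rfl⟩ | ⟨A, hA, rfl⟩)
    · exact Or.inl ⟨A, hA, by rw [key A (h.1 A hA)]⟩
    · exact Or.inr ⟨A, hA, by rw [key A (h.2 A hA)]⟩

/-! ### Gödel numbers bound depths -/

theorem lt_seqCode {l : List ℕ} {x : ℕ} (h : x ∈ l) : x < seqCode l := by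
  induction l with
  | nil => simp at h
  | cons a l ih =>
    simp only [seqCode, Encodable.encode_list_cons, Encodable.encode_nat] at ih ⊢
    rcases List.mem_cons.1 h with rfl | h
    · exact Nat.lt_succ_of_le (Nat.left_le_pair _ _)
    · exact (ih h).trans (Nat.lt_succ_of_le (Nat.right_le_pair _ _))

/-- Bounds the cut rank by the Gödel number, so the ordinal can be computed without parsing the
derivation. -/
theorem depth_le_code {n : ℕ} (A : Fml n) : A.depth ≤ A.code := by
  induction A with
  | mem s t => exact Nat.zero_le _
  | neg A ih => exact ih.trans (lt_seqCode (by simp)).le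
  | and A B ihA ihB | or A B ihA ihB | imp A B ihA ihB =>
    refine Nat.succ_le_of_lt (max_lt (ihA.trans_lt (lt_seqCode ?_)) (ihB.trans_lt (lt_seqCode ?_)))
      <;> simp
  | all F ih | ex F ih | ball t F ih | bex t F ih | eall s t F ih | eex s t F ih =>
    exact Nat.succ_le_of_lt (ih.trans_lt (lt_seqCode (by simp)))

/-! ### Embedding of the finite calculus -/

/-- The sequent `Γ ⇒ Δ` is derivable in the infinitary calculus with height `Ω + m`, uniformly in
the assignment. -/
def Embeds (k m : ℕ) (Γ : Finset Formula) (Δ : Option Formula) : Prop :=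
  ∀ ⦃ξ : Ordinal.{0}⦄ ⦃v : ℕ → ZFSet.{0}⦄, Good ξ → (∀ i, (v i).rank < ξ) →
    Der k ξ (hgt m) (sequent v Γ Δ)

section Rules

variable {k m m' : ℕ} {Γ : Finset Formula} {Δ : Option Formula}

theorem Embeds.left {A : Formula} {ξ : Ordinal.{0}} {v : ℕ → ZFSet.{0}}
    (h : Embeds k m (insert A Γ) Δ) (hg : Good ξ) (hv : ∀ i, (v i).rank < ξ) (B : Formula) :
    Der k ξ (hgt m) (insert (tr₀ v A).dual (sequent v (insert B Γ) Δ)) := by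
  have := h hg hv
  rw [sequent_insert] at this ⊢
  exact this.mono (Set.insert_subset_insert (Set.subset_insert _ _))

theorem Embeds.right {A : Formula} {ξ : Ordinal.{0}} {v : ℕ → ZFSet.{0}}
    (h : Embeds k m Γ (some A)) (hg : Good ξ) (hv : ∀ i, (v i).rank < ξ) (Δ : Option Formula) :
    Der k ξ (hgt m) (insert (tr₀ v A) (sequent v Γ Δ)) := by
  have := h hg hv
  rw [sequent_some] at this
  exact this.mono (Set.insert_subset_insert (sequent_none_subset v Γ Δ))

theorem mem_sequent_left (v : ℕ → ZFSet.{0}) (B : Formula) (Γ : Finset Formula)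
    (Δ : Option Formula) : (tr₀ v B).dual ∈ sequent v (insert B Γ) Δ := by
  rw [sequent_insert]; exact Set.mem_insert _ _

theorem mem_sequent_right (v : ℕ → ZFSet.{0}) (B : Formula) (Γ : Finset Formula) :
    tr₀ v B ∈ sequent v Γ (some B) := by
  rw [sequent_some]; exact Set.mem_insert _ _

theorem update_rank_lt {ξ : Ordinal.{0}} {v : ℕ → ZFSet.{0}} (hv : ∀ i, (v i).rank < ξ)
    {x : ZFSet.{0}} (hx : x.rank < ξ) (c i : ℕ) : (Function.update v c x i).rank < ξ := by
  by_cases h : i = c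
  · subst h; simpa
  · simpa [h] using hv i

theorem tr_update {n : ℕ} {v : ℕ → ZFSet.{0}} {e : Fin n → ZFSet.{0}} {F : Fml n} {c : ℕ}
    (h : c ∉ F.fvs) (x : ZFSet.{0}) : tr (Function.update v c x) e F = tr v e F := by
  refine tr_congr fun i hi => ?_
  rw [Function.update_of_ne]
  rintro rfl
  exact h hi

/-- The eigenvariable of a left rule takes any value. -/
theorem Embeds.eigen_left {A B : Formula} {c : ℕ} {ξ : Ordinal.{0}} {v : ℕ → ZFSet.{0}}
    (h : Embeds k m (insert A Γ) Δ) (hc : Fresh c (insert B Γ) Δ) (hg : Good ξ)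
    (hv : ∀ i, (v i).rank < ξ) {x : ZFSet.{0}} (hx : x.rank < ξ) :
    Der k ξ (hgt m)
      (insert (tr₀ (Function.update v c x) A).dual (sequent v (insert B Γ) Δ)) := by
  have := h.left hg (update_rank_lt hv hx c) B
  rwa [sequent_fresh hc] at this

/-- The eigenvariable of a right rule takes any value. -/
theorem Embeds.eigen_right {A B : Formula} {c : ℕ} {ξ : Ordinal.{0}} {v : ℕ → ZFSet.{0}}
    (h : Embeds k m Γ (some A)) (hc : Fresh c Γ (some B)) (hg : Good ξ)
    (hv : ∀ i, (v i).rank < ξ) {x : ZFSet.{0}} (hx : x.rank < ξ) :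
    Der k ξ (hgt m) (insert (tr₀ (Function.update v c x) A) (sequent v Γ (some B))) := by
  have := h.right hg (update_rank_lt hv hx c) (some B)
  rwa [sequent_fresh hc] at this

theorem elim0_rank_lt {ξ : Ordinal.{0}} (i : Fin 0) :
    ((Fin.elim0 i : ZFSet.{0})).rank < ξ := i.elim0

/-! ### The axioms of the finite calculus -/

theorem embeds_delta0 {A : Formula} (hA : A.IsDelta0)
    (h : ∀ ⦃ξ : Ordinal.{0}⦄ ⦃v : ℕ → ZFSet.{0}⦄, (tr₀ v A).ISat ξ) :
    Embeds k A.depth Γ (some A) := fun _ v hg hv =>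
  (der_of_isat (tr_below hg hv elim0_rank_lt A) (tr_bdd hA) hg (h (v := v))
    (mem_sequent_right v A Γ)).height (nat_le_hgt le_rfl)

theorem embeds_logical (A : Formula) :
    Embeds k (2 * A.depth) (insert A Γ) (some A) := fun _ v hg hv =>
  (der_identity (tr_below hg hv elim0_rank_lt A) hg (mem_sequent_right v A _)
    (mem_sequent_left v A Γ _)).height (nat_le_hgt le_rfl)

/-- Serves Pair, Union, Infinity, Separation and Exponentiation: each is an existential statement
with bounded matrix, true with a witness of rank below ξ. -/
theorem embeds_ex {F : Fml 1} (hF : F.IsDelta0)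
    (h : ∀ ⦃ξ : Ordinal.{0}⦄ ⦃v : ℕ → ZFSet.{0}⦄, Good ξ → (∀ i, (v i).rank < ξ) →
      ∃ x : ZFSet.{0}, x.rank < ξ ∧ (tr v (Fin.cons x Fin.elim0) F).ISat ξ) :
    Embeds k (F.depth + 1) Γ (some (.ex F)) := by
  intro ξ v hg hv
  obtain ⟨x, hx, hs⟩ := h hg hv
  exact der_ex_of_isat hg (mem_sequent_right v (.ex F) Γ) hx (tr_bdd hF)
    (tr_below hg hv (cons_rank_lt elim0_rank_lt hx) F) hs

theorem isat_tr_eqF {n : ℕ} {ξ : Ordinal.{0}} {v : ℕ → ZFSet.{0}} {e : Fin n → ZFSet.{0}}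
    {s t : Tm n} (h : (tr v e (eqF s t)).ISat ξ) : s.eval v e = t.eval v e := by
  simp only [eqF, tr, isat_and, ISat, eval_bv, Fin.cons_zero, eval_shift] at h
  ext z
  exact ⟨h.1 z, h.2 z⟩

theorem embeds_ext (a b : ℕ) {B : Fml 1} (hB : B.IsDelta0) :
    Embeds k (extAx a b B).depth Γ (some (extAx a b B)) := by
  refine embeds_delta0 ?_ fun ξ v => ?_
  · simp only [extAx, eqF, Fml.IsDelta0, Fml.app, isDelta0_subst]
    simp [hB]
  · simp only [extAx, tr₀, tr, isat_or, isat_dual, isat_and, ← imp_iff_not_or]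
    rintro ⟨h1, h2⟩
    have h3 := isat_tr_eqF h1
    simp only [eval_fv] at h3
    change (tr₀ v (B.app (.fv b))).ISat ξ
    change (tr₀ v (B.app (.fv a))).ISat ξ at h2
    rw [tr₀_app] at h2 ⊢
    rwa [← h3]

theorem embeds_pair (a b : ℕ) : ∃ m, Embeds k m Γ (some (pairAx a b)) := by
  refine ⟨_, embeds_ex (by simp [Fml.IsDelta0]) fun ξ v hg hv => ⟨{v a, v b}, ?_, ?_⟩⟩
  · rw [ZFSet.rank_pair]
    exact max_lt (hg.add_one (hv a)) (hg.add_one (hv b))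
  · simp [tr, ISat]

theorem embeds_union (a : ℕ) : ∃ m, Embeds k m Γ (some (unionAx a)) := by
  refine ⟨_, embeds_ex (by simp [Fml.IsDelta0]) fun ξ v hg hv => ⟨ZFSet.sUnion (v a), ?_, ?_⟩⟩
  · exact (ZFSet.rank_sUnion_le _).trans_lt (hv a)
  · intro y hy z hz
    exact ZFSet.mem_sUnion.2 ⟨y, hy, hz⟩

theorem embeds_infinity : ∃ m, Embeds k m Γ (some infAx) := by
  refine ⟨_, embeds_ex (by simp [Fml.IsDelta0]) fun ξ v hg hv => ⟨ZFSet.vonNeumann ω, ?_, ?_⟩⟩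
  · rw [ZFSet.rank_vonNeumann]
    exact hg.omega0_lt
  · simp only [tr, isat_and]
    refine ⟨⟨∅, ?_, ?_⟩, fun y hy => ⟨{y}, ?_, ?_⟩⟩
    · simp [ZFSet.mem_vonNeumann]
    · exact ZFSet.mem_vonNeumann.2 (by simp)
    · simp only [eval_bv, Fin.cons_zero, ZFSet.mem_vonNeumann] at hy
      change {y} ∈ ZFSet.vonNeumann ω
      rw [ZFSet.mem_vonNeumann, ZFSet.rank_singleton]
      exact isSuccLimit_omega0.succ_lt hy
    · exact ZFSet.mem_singleton.2 rfl

theorem embeds_sep (a : ℕ) {A : Fml 1} (hA : A.IsDelta0) :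
    ∃ m, Embeds k m Γ (some (sepAx a A)) := by
  refine ⟨_, embeds_ex ?_ fun ξ v hg hv =>
    ⟨ZFSet.sep (fun y => (tr v (fun _ => y) A).ISat ξ) (v a), ?_, ?_⟩⟩
  · simp only [Fml.IsDelta0, Fml.app, isDelta0_subst]
    simp [hA]
  · exact (ZFSet.rank_mono fun y hy => (ZFSet.mem_sep.1 hy).1).trans_lt (hv a)
  · simp only [tr, Fml.app, tr_subst, isat_and]
    refine ⟨fun y hy => ?_, fun y hy => ?_⟩
    · simp only [eval_bv, Fin.cons_zero, ZFSet.mem_sep] at hy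
      rw [isat_and]
      exact hy
    · rw [isat_or, isat_dual, ← imp_iff_not_or]
      intro h
      exact ZFSet.mem_sep (p := fun y => (tr v (fun _ => y) A).ISat ξ).2 ⟨hy, h⟩

theorem embeds_exp (a b : ℕ) : ∃ m, Embeds k m Γ (some (expAx a b)) := by
  refine ⟨_, embeds_ex (by simp [Fml.IsDelta0]) fun ξ v hg hv =>
    ⟨ZFSet.funs (v a) (v b), rank_funs_lt hg (hv a) (hv b), fun x hx => hx⟩⟩

/-- The antecedent comes from excluded middle, and the collection rule turns it into the consequent.
The constant 3 counts that rule and the two disjunction inferences of the implication. -/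
theorem embeds_coll (a : ℕ) {B : Fml 2} (hB : B.IsDelta0) :
    ∃ m, Embeds k m Γ (some (collAx a B)) := by
  refine ⟨2 * (collAx a B).depth + 3, fun ξ v hg hv => ?_⟩
  have hmem := mem_sequent_right v (collAx a B) Γ
  generalize hS : sequent v Γ (some (collAx a B)) = S at hmem ⊢
  set n := (collAx a B).depth with hn
  have hbel : (tr₀ v (.ball (.fv a) (.ex (B.app₂ (.bv 1) (.bv 0))))).Below ξ n :=
    (tr_below hg hv elim0_rank_lt _).mono (by
      rw [hn, collAx]
      simp only [Fml.depth]
      omega)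
  let b : ZFSet.{0} → ZFSet.{0} → IFml := fun x y => tr v ![y, x] B
  have hb : ∀ x y, (b x y).Bdd := fun x y => tr_bdd hB
  have e1 : tr₀ v (.ball (.fv a) (.ex (B.app₂ (.bv 1) (.bv 0)))) =
      conj (some (v a)) fun x => disj none fun y => b x y := by
    simp only [tr₀, tr, Fml.app₂, tr_subst, eval_fv, b]
    congr! with x y i
    fin_cases i <;> rfl
  have e2 : tr₀ v (.ex (.ball (.fv a) (.bex (.bv 1) (B.app₂ (.bv 1) (.bv 0))))) =
      disj none fun z => conj (some (v a)) fun x => disj (some z) fun y => b x y := by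
    simp only [tr₀, tr, Fml.app₂, tr_subst, eval_fv, b]
    congr! with z x y i
    fin_cases i <;> rfl
  have e : tr₀ v (collAx a B) = IFml.or (tr₀ v (.ball (.fv a) (.ex (B.app₂ (.bv 1) (.bv 0))))).dual
      (tr₀ v (.ex (.ball (.fv a) (.bex (.bv 1) (B.app₂ (.bv 1) (.bv 0)))))) := rfl
  rw [e] at hmem
  rw [← hgt_succ]
  refine Der.or_left hg (control_hgt hg _) hmem ?_
  rw [← hgt_succ]
  refine Der.or_right hg (control_hgt hg _) (Set.mem_insert_of_mem _ hmem) ?_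
  refine .coll (β := hgt (2 * n)) hb (a := v a) ?_ (hgt_lt (Nat.lt_succ_self _))
    (control_hgt hg _) ?_
  · rw [e2]; exact Set.mem_insert _ _
  · rw [← e1]
    refine (der_identity hbel hg (Set.mem_insert _ _) ?_).height (nat_le_hgt le_rfl)
    exact Set.mem_insert_of_mem _ (Set.mem_insert_of_mem _ (Set.mem_insert _ _))

/-- At each set the height is a countable ordinal, but these are bounded uniformly in all controls
only by Ω. This is the source of the heights Ω + m. -/
theorem embeds_ind (G : Fml 1) : Embeds k 2 Γ (some (indAx G)) := by
  intro ξ v hg hv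
  have hmem := mem_sequent_right v (indAx G) Γ
  generalize hS : sequent v Γ (some (indAx G)) = S at hmem ⊢
  let g : ZFSet.{0} → IFml := fun x => tr v (fun _ => x) G
  have e : tr₀ v (indAx G) = IFml.or
      (disj none fun u => IFml.and (conj (some u) g) (g u).dual) (conj none g) := by
    have h1 : ∀ (n : ℕ) (x : ZFSet.{0}) (e : Fin n → ZFSet.{0}),
        tr v (Fin.cons x e : Fin (n + 1) → ZFSet.{0}) (G.app (.bv 0)) = g x := by
      intro n x e
      rw [Fml.app, tr_subst]; rfl
    simp only [indAx, tr₀, tr, h1, IFml.dual, dual_or, dual_dual]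
    rfl
  rw [e] at hmem
  rw [← hgt_succ]
  refine Der.or_left hg (control_hgt hg _) hmem ?_
  rw [← hgt_succ]
  refine Der.or_right hg (control_hgt hg _) (Set.mem_insert_of_mem _ hmem) ?_
  refine .conjU (fun _ x => ω ^ (x.rank + 1)) (Set.mem_insert _ _) (fun η hη hle x hx => ?_)
    (fun η hη hle x hx => .base (hη.opow (hη.add_one hx))) fun η hη hle x hx => ?_
  · exact ((hη.opow (hη.add_one hx)).trans hη.lt_Om).trans_le le_self_add
  · refine der_set_induction hη (n := G.depth) (fun y hy => ?_) x hx ?_ (Set.mem_insert _ _)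
    · exact tr_below hη (fun i => (hv i).trans_le hle) (fun _ => hy) G
    · exact Set.mem_insert_of_mem _ (Set.mem_insert_of_mem _ (Set.mem_insert _ _))

end Rules

/-! ### The inference rules of the finite calculus -/

section Rules

variable {k m m' : ℕ} {Γ : Finset Formula} {Δ : Option Formula}

theorem Embeds.mono (h : Embeds k m Γ Δ) (hm : m ≤ m') : Embeds k m' Γ Δ := fun _ _ hg hv =>
  (h hg hv).height (hgt_mono hm)

theorem Embeds.andL {A B C : Formula} (hC : C = A ∨ C = B) (h : Embeds k m (insert C Γ) Δ) :
    Embeds k (m + 1) (insert (.and A B) Γ) Δ := by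
  intro ξ v hg hv
  have hmem := mem_sequent_left v (.and A B) Γ Δ
  rw [show (tr₀ v (.and A B)).dual = IFml.or (tr₀ v A).dual (tr₀ v B).dual from
    dual_and _ _] at hmem
  rw [← hgt_succ]
  rcases hC with rfl | rfl
  · exact Der.or_left hg (control_hgt hg m) hmem (h.left hg hv _)
  · exact Der.or_right hg (control_hgt hg m) hmem (h.left hg hv _)

theorem Embeds.andR {A B : Formula} (h : Embeds k m Γ (some A)) (h' : Embeds k m' Γ (some B)) :
    Embeds k (max m m' + 1) Γ (some (.and A B)) := by
  intro ξ v hg hv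
  rw [← hgt_succ]
  exact Der.and_intro hg (control_hgt hg _) (mem_sequent_right v (.and A B) Γ)
    ((h.mono (le_max_left _ _)).right hg hv _) ((h'.mono (le_max_right _ _)).right hg hv _)

theorem Embeds.orL {A B : Formula} (h : Embeds k m (insert A Γ) Δ)
    (h' : Embeds k m' (insert B Γ) Δ) : Embeds k (max m m' + 1) (insert (.or A B) Γ) Δ := by
  intro ξ v hg hv
  have hmem := mem_sequent_left v (.or A B) Γ Δ
  rw [show (tr₀ v (.or A B)).dual = IFml.and (tr₀ v A).dual (tr₀ v B).dual from
    dual_or _ _] at hmem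
  rw [← hgt_succ]
  exact Der.and_intro hg (control_hgt hg _) hmem
    ((h.mono (le_max_left _ _)).left hg hv _) ((h'.mono (le_max_right _ _)).left hg hv _)

theorem Embeds.orR {A B C : Formula} (hC : C = A ∨ C = B) (h : Embeds k m Γ (some C)) :
    Embeds k (m + 1) Γ (some (.or A B)) := by
  intro ξ v hg hv
  have hmem := mem_sequent_right v (.or A B) Γ
  rw [← hgt_succ]
  rcases hC with rfl | rfl
  · exact Der.or_left hg (control_hgt hg m) hmem (h.right hg hv _)
  · exact Der.or_right hg (control_hgt hg m) hmem (h.right hg hv _)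

/-- In the one-sided calculus the double dual is the formula itself, so the sequent does not change
and no inference is needed. -/
theorem Embeds.negL {A : Formula} (h : Embeds k m Γ (some A)) :
    Embeds k m (insert (.neg A) Γ) none := by
  intro ξ v hg hv
  have := h hg hv
  rw [sequent_some] at this
  rw [sequent_insert]
  exact (dual_dual (tr₀ v A)).symm ▸ this

theorem Embeds.negR {A : Formula} (h : Embeds k m (insert A Γ) none) :
    Embeds k m Γ (some (.neg A)) := by
  intro ξ v hg hv
  have := h hg hv
  rw [sequent_insert] at this
  rw [sequent_some]
  exact this

theorem Embeds.bot {A : Formula} (h : Embeds k m Γ none) : Embeds k m Γ (some A) :=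
  fun _ v hg hv => (h hg hv).mono (sequent_none_subset v Γ _)

theorem Embeds.impL {A B : Formula} (h : Embeds k m (insert B Γ) Δ)
    (h' : Embeds k m' Γ (some A)) : Embeds k (max m m' + 1) (insert (.imp A B) Γ) Δ := by
  intro ξ v hg hv
  have hmem := mem_sequent_left v (.imp A B) Γ Δ
  rw [show (tr₀ v (.imp A B)).dual = IFml.and (tr₀ v A) (tr₀ v B).dual by
    simp [tr₀, tr]] at hmem
  rw [← hgt_succ]
  refine Der.and_intro hg (control_hgt hg _) hmem ?_ ((h.mono (le_max_left _ _)).left hg hv _)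
  refine ((h'.mono (le_max_right _ _)).right hg hv Δ).mono (Set.insert_subset_insert ?_)
  rw [sequent_insert]
  exact Set.subset_insert _ _

theorem Embeds.impR {A B : Formula} (h : Embeds k m (insert A Γ) (some B)) :
    Embeds k (m + 2) Γ (some (.imp A B)) := by
  intro ξ v hg hv
  have hmem := mem_sequent_right v (.imp A B) Γ
  have hd := h hg hv
  rw [sequent_insert, sequent_some] at hd
  rw [← hgt_succ]
  refine Der.or_left hg (control_hgt hg _) hmem ?_
  rw [← hgt_succ]
  refine Der.or_right hg (control_hgt hg _) (Set.mem_insert_of_mem _ hmem) (hd.mono ?_)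
  rw [Set.insert_comm]
  exact Set.insert_subset_insert (Set.insert_subset_insert (sequent_none_subset v Γ _))

theorem Embeds.cut {A : Formula} (hA : A.depth ≤ k) (h : Embeds k m Γ (some A))
    (h' : Embeds k m' (insert A Γ) Δ) : Embeds k (max m m' + 1) Γ Δ := by
  intro ξ v hg hv
  have hd := h'.mono (le_max_right m m') hg hv
  rw [sequent_insert] at hd
  exact .cut (tr₀ v A) ((tr_rankLE v _ A).mono hA) (hgt_lt (Nat.lt_succ_self _))
    (control_hgt hg _) (hgt_lt (Nat.lt_succ_self _)) (control_hgt hg _)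
    ((h.mono (le_max_left _ _)).right hg hv Δ) hd

theorem tr₀_app_update {v : ℕ → ZFSet.{0}} {F : Fml 1} {c : ℕ} (h : c ∉ F.fvs)
    (x : ZFSet.{0}) :
    tr₀ (Function.update v c x) (F.app (.fv c)) = tr v (Fin.cons x Fin.elim0) F := by
  rw [tr₀_app, tr_update h, Function.update_self, cons_elim0]

theorem tr₀_app' {v : ℕ → ZFSet.{0}} (F : Fml 1) (c : ℕ) :
    tr₀ v (F.app (.fv c)) = tr v (Fin.cons (v c) Fin.elim0) F := by
  rw [tr₀_app, cons_elim0]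

/-- The embedding is uniform in control and assignment, so the eigenvariable may take any value x at
any larger control η; freshness keeps the side formulas fixed. -/
theorem Embeds.exL {c : ℕ} {F : Fml 1} (hc : Fresh c (insert (.ex F) Γ) Δ)
    (h : Embeds k m (insert (F.app (.fv c)) Γ) Δ) : Embeds k (m + 1) (insert (.ex F) Γ) Δ := by
  intro ξ v hg hv
  have hF : c ∉ F.fvs := hc.1 (.ex F) (Finset.mem_insert_self _ _)
  refine .conjU (fun _ _ => hgt m) (mem_sequent_left v (.ex F) Γ Δ)
    (fun _ _ _ _ _ => hgt_lt (Nat.lt_succ_self _)) (fun η hη _ _ _ => control_hgt hη _)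
    fun η hη hle x hx => ?_
  have := h.eigen_left hc hη (fun i => (hv i).trans_le hle) hx
  rwa [tr₀_app_update hF] at this

theorem Embeds.allR {c : ℕ} {F : Fml 1} (hc : Fresh c Γ (some (.all F)))
    (h : Embeds k m Γ (some (F.app (.fv c)))) : Embeds k (m + 1) Γ (some (.all F)) := by
  intro ξ v hg hv
  have hF : c ∉ F.fvs := hc.2 (.all F) rfl
  refine .conjU (fun _ _ => hgt m) (mem_sequent_right v (.all F) Γ)
    (fun _ _ _ _ _ => hgt_lt (Nat.lt_succ_self _)) (fun η hη _ _ _ => control_hgt hη _)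
    fun η hη hle x hx => ?_
  have := h.eigen_right hc hη (fun i => (hv i).trans_le hle) hx
  rwa [tr₀_app_update hF] at this

theorem Embeds.exR {c : ℕ} {F : Fml 1} (h : Embeds k m Γ (some (F.app (.fv c)))) :
    Embeds k (m + 1) Γ (some (.ex F)) := by
  intro ξ v hg hv
  refine .disj (β := hgt m) (v c) (mem_sequent_right v (.ex F) Γ) (hv c) (inRange_none _)
    (hgt_lt (Nat.lt_succ_self _)) (control_hgt hg _) ?_
  have := h.right hg hv (some (.ex F))
  rwa [tr₀_app'] at this

theorem Embeds.allL {c : ℕ} {F : Fml 1} (h : Embeds k m (insert (F.app (.fv c)) Γ) Δ) :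
    Embeds k (m + 1) (insert (.all F) Γ) Δ := by
  intro ξ v hg hv
  refine .disj (β := hgt m) (v c) (mem_sequent_left v (.all F) Γ Δ) (hv c) (inRange_none _)
    (hgt_lt (Nat.lt_succ_self _)) (control_hgt hg _) ?_
  have := h.left hg hv (.all F)
  rwa [tr₀_app'] at this

/-- `G` is a bounded formula that says of the value of the variable `c` that it belongs to the set
`D v`, where `D v` depends on the variables in `s` only. -/
structure Guard (G : Formula) (c : ℕ) (s : Finset ℕ) (D : (ℕ → ZFSet.{0}) → ZFSet.{0}) :
    Prop where
  isDelta0 : G.IsDelta0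
  rank_lt : ∀ {ξ : Ordinal.{0}} {v : ℕ → ZFSet.{0}}, Good ξ → (∀ i, (v i).rank < ξ) →
    (D v).rank < ξ
  isat_iff : ∀ {ξ : Ordinal.{0}} {v : ℕ → ZFSet.{0}}, Good ξ → (∀ i, (v i).rank < ξ) →
    ((tr₀ v G).ISat ξ ↔ v c ∈ D v)
  update : ∀ (v : ℕ → ZFSet.{0}) (x : ZFSet.{0}), c ∉ s → D (Function.update v c x) = D v

theorem guard_mem (c b : ℕ) : Guard (.mem (.fv c) (.fv b)) c {b} fun v => v b where
  isDelta0 := trivial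
  rank_lt _ hv := hv b
  isat_iff _ _ := Iff.rfl
  update v x h := Function.update_of_ne (fun hb => h (by simp [hb])) _ _

/-- V_ξ is transitive, so the bounded formula `funF` expresses there that the set really is a
function. -/
theorem guard_fun (c a b : ℕ) : Guard (funF (.fv c) (.fv a) (.fv b)) c ({a} ∪ {b})
    fun v => ZFSet.funs (v a) (v b) where
  isDelta0 := isDelta0_funF _ _ _
  rank_lt hg hv := rank_funs_lt hg (hv a) (hv b)
  isat_iff {ξ v} hg hv := by
    rw [tr₀, isat_tr_iff hg hv elim0_rank_lt, sat_funF ?_ (hv c) (hv a) (hv b), ZFSet.mem_funs]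
    · rfl
    · intro x hx y hy
      exact (ZFSet.rank_lt_of_mem hy).trans hx
  update v x h := by
    rw [Function.update_of_ne fun hb => h (by simp [hb]),
      Function.update_of_ne fun hb => h (by simp [hb])]

/-- For x in the range the guard is true, so its negation in the premise is removed by a cut on a
bounded formula, which costs the depth of the guard. -/
theorem Embeds.guarded_exL {c : ℕ} {s : Finset ℕ} {G Q : Formula} {F : Fml 1}
    {D : (ℕ → ZFSet.{0}) → ZFSet.{0}} (hG : Guard G c s D) (hQs : Q.fvs = s ∪ F.fvs)
    (hQ : ∀ v, tr₀ v Q = disj (some (D v)) fun x => tr v (Fin.cons x Fin.elim0) F)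
    (hc : Fresh c (insert Q Γ) Δ)
    (h : Embeds k m (insert (.and G (F.app (.fv c))) Γ) Δ) :
    Embeds k (m + G.depth + 2) (insert Q Γ) Δ := by
  intro ξ v hg hv
  have hcQ : c ∉ s ∪ F.fvs := hQs ▸ hc.1 Q (Finset.mem_insert_self _ _)
  rw [Finset.mem_union, not_or] at hcQ
  have hmem := mem_sequent_left v Q Γ Δ
  rw [hQ] at hmem
  refine Der.guarded_conj (g := fun x => tr₀ (Function.update v c x) G) hg hmem
    (hG.rank_lt hg hv) fun x hx => ?_
  have hxr := (ZFSet.rank_lt_of_mem hx).trans (hG.rank_lt hg hv)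
  have hv' := update_rank_lt hv hxr c
  refine ⟨tr_bdd hG.isDelta0, tr_below hg hv' elim0_rank_lt G, ?_, ?_⟩
  · rw [hG.isat_iff hg hv', hG.update v x hcQ.1, Function.update_self]
    exact hx
  · have := h.eigen_left hc hg hv hxr
    rwa [tr₀, tr, dual_and, ← tr₀, ← tr₀, tr₀_app_update hcQ.2] at this

theorem Embeds.guarded_allR {c : ℕ} {s : Finset ℕ} {G Q : Formula} {F : Fml 1}
    {D : (ℕ → ZFSet.{0}) → ZFSet.{0}} (hG : Guard G c s D) (hQs : Q.fvs = s ∪ F.fvs)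
    (hQ : ∀ v, tr₀ v Q = conj (some (D v)) fun x => tr v (Fin.cons x Fin.elim0) F)
    (hc : Fresh c Γ (some Q))
    (h : Embeds k m Γ (some (.imp G (F.app (.fv c))))) :
    Embeds k (m + G.depth + 2) Γ (some Q) := by
  intro ξ v hg hv
  have hcQ : c ∉ s ∪ F.fvs := hQs ▸ hc.2 Q rfl
  rw [Finset.mem_union, not_or] at hcQ
  have hmem := mem_sequent_right v Q Γ
  rw [hQ] at hmem
  refine Der.guarded_conj (g := fun x => tr₀ (Function.update v c x) G) hg hmem
    (hG.rank_lt hg hv) fun x hx => ?_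
  have hxr := (ZFSet.rank_lt_of_mem hx).trans (hG.rank_lt hg hv)
  have hv' := update_rank_lt hv hxr c
  refine ⟨tr_bdd hG.isDelta0, tr_below hg hv' elim0_rank_lt G, ?_, ?_⟩
  · rw [hG.isat_iff hg hv', hG.update v x hcQ.1, Function.update_self]
    exact hx
  · have := h.eigen_right hc hg hv hxr
    rwa [tr₀, tr, ← tr₀, ← tr₀, tr₀_app_update hcQ.2] at this

theorem Embeds.guarded_exR {c : ℕ} {s : Finset ℕ} {G Q : Formula} {F : Fml 1}
    {D : (ℕ → ZFSet.{0}) → ZFSet.{0}} (hG : Guard G c s D)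
    (hQ : ∀ v, tr₀ v Q = disj (some (D v)) fun x => tr v (Fin.cons x Fin.elim0) F)
    (h : Embeds k m Γ (some (.and G (F.app (.fv c))))) :
    Embeds k (m + G.depth + 2) Γ (some Q) := by
  intro ξ v hg hv
  have hmem := mem_sequent_right v Q Γ
  rw [hQ] at hmem
  refine Der.guarded_disj hg hmem (hv c) (tr_bdd hG.isDelta0) (tr_below hg hv elim0_rank_lt G)
    (hG.isat_iff hg hv).1 ?_
  have := h.right hg hv (some Q)
  rw [tr₀, tr, ← tr₀, ← tr₀, tr₀_app'] at this
  exact this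

theorem Embeds.guarded_allL {c : ℕ} {s : Finset ℕ} {G Q : Formula} {F : Fml 1}
    {D : (ℕ → ZFSet.{0}) → ZFSet.{0}} (hG : Guard G c s D)
    (hQ : ∀ v, tr₀ v Q = conj (some (D v)) fun x => tr v (Fin.cons x Fin.elim0) F)
    (h : Embeds k m (insert (.imp G (F.app (.fv c))) Γ) Δ) :
    Embeds k (m + G.depth + 2) (insert Q Γ) Δ := by
  intro ξ v hg hv
  have hmem := mem_sequent_left v Q Γ Δ
  rw [hQ] at hmem
  refine Der.guarded_disj hg hmem (hv c) (tr_bdd hG.isDelta0) (tr_below hg hv elim0_rank_lt G)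
    (hG.isat_iff hg hv).1 ?_
  have := h.left hg hv Q
  rw [tr₀, tr, dual_or, dual_dual, ← tr₀, ← tr₀, tr₀_app'] at this
  exact this

end Rules

/-- The cut rank is bounded explicitly because it determines the final ordinal; of m only existence
is needed. -/
theorem embeds_of_deriv {Γ : Finset Formula} {Δ : Option Formula} (d : Deriv Γ Δ) {k : ℕ}
    (hk : d.code ≤ k) : ∃ m, Embeds k m Γ Δ := by
  have lt : ∀ {l : List ℕ} {x : ℕ}, seqCode l ≤ k → x ∈ l → x ≤ k := fun h hx =>
    (lt_seqCode hx).le.trans h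
  induction d with
  | logical Γ A _ => exact ⟨_, embeds_logical A⟩
  | ext Γ a b B h => exact ⟨_, embeds_ext a b h⟩
  | pair Γ a b => exact embeds_pair a b
  | union Γ a => exact embeds_union a
  | infinity Γ => exact embeds_infinity
  | sep Γ a A h => exact embeds_sep a h
  | coll Γ a B h => exact embeds_coll a h
  | ind Γ G => exact ⟨_, embeds_ind G⟩
  | exp Γ a b => exact embeds_exp a b
  | andL₁ Γ Δ A B d ih =>
    obtain ⟨m, h⟩ := ih (lt hk (by simp))
    exact ⟨_, h.andL (Or.inl rfl)⟩
  | andL₂ Γ Δ A B d ih =>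
    obtain ⟨m, h⟩ := ih (lt hk (by simp))
    exact ⟨_, h.andL (Or.inr rfl)⟩
  | andR Γ A B d e ih ih' =>
    obtain ⟨m, h⟩ := ih (lt hk (by simp))
    obtain ⟨m', h'⟩ := ih' (lt hk (by simp))
    exact ⟨_, h.andR h'⟩
  | orL Γ Δ A B d e ih ih' =>
    obtain ⟨m, h⟩ := ih (lt hk (by simp))
    obtain ⟨m', h'⟩ := ih' (lt hk (by simp))
    exact ⟨_, h.orL h'⟩
  | orR₁ Γ A B d ih =>
    obtain ⟨m, h⟩ := ih (lt hk (by simp))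
    exact ⟨_, h.orR (Or.inl rfl)⟩
  | orR₂ Γ A B d ih =>
    obtain ⟨m, h⟩ := ih (lt hk (by simp))
    exact ⟨_, h.orR (Or.inr rfl)⟩
  | negL Γ A d ih =>
    obtain ⟨m, h⟩ := ih (lt hk (by simp))
    exact ⟨_, h.negL⟩
  | negR Γ A d ih =>
    obtain ⟨m, h⟩ := ih (lt hk (by simp))
    exact ⟨_, h.negR⟩
  | bot Γ A d ih =>
    obtain ⟨m, h⟩ := ih (lt hk (by simp))
    exact ⟨_, h.bot⟩
  | impL Γ Δ A B d e ih ih' =>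
    obtain ⟨m, h⟩ := ih (lt hk (by simp))
    obtain ⟨m', h'⟩ := ih' (lt hk (by simp))
    exact ⟨_, h.impL h'⟩
  | impR Γ A B d ih =>
    obtain ⟨m, h⟩ := ih (lt hk (by simp))
    exact ⟨_, h.impR⟩
  | bexL Γ Δ a b F hc d ih =>
    obtain ⟨m, h⟩ := ih (lt hk (by simp))
    exact ⟨_, h.guarded_exL (guard_mem a b) rfl (fun _ => rfl) hc⟩
  | bexR Γ a b F d ih =>
    obtain ⟨m, h⟩ := ih (lt hk (by simp))
    exact ⟨_, h.guarded_exR (guard_mem a b) fun _ => rfl⟩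
  | ballL Γ Δ a b F d ih =>
    obtain ⟨m, h⟩ := ih (lt hk (by simp))
    exact ⟨_, h.guarded_allL (guard_mem a b) fun _ => rfl⟩
  | ballR Γ a b F hc d ih =>
    obtain ⟨m, h⟩ := ih (lt hk (by simp))
    exact ⟨_, h.guarded_allR (guard_mem a b) rfl (fun _ => rfl) hc⟩
  | exL Γ Δ a F hc d ih =>
    obtain ⟨m, h⟩ := ih (lt hk (by simp))
    exact ⟨_, h.exL hc⟩
  | exR Γ a F d ih =>
    obtain ⟨m, h⟩ := ih (lt hk (by simp))
    exact ⟨_, h.exR⟩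
  | allL Γ Δ a F d ih =>
    obtain ⟨m, h⟩ := ih (lt hk (by simp))
    exact ⟨_, h.allL⟩
  | allR Γ a F hc d ih =>
    obtain ⟨m, h⟩ := ih (lt hk (by simp))
    exact ⟨_, h.allR hc⟩
  | eexL Γ Δ c a b F hc d ih =>
    obtain ⟨m, h⟩ := ih (lt hk (by simp))
    exact ⟨_, h.guarded_exL (guard_fun c a b) rfl (fun _ => rfl) hc⟩
  | eexR Γ c a b F d ih =>
    obtain ⟨m, h⟩ := ih (lt hk (by simp))
    exact ⟨_, h.guarded_exR (guard_fun c a b) fun _ => rfl⟩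
  | eallL Γ Δ c a b F d ih =>
    obtain ⟨m, h⟩ := ih (lt hk (by simp))
    exact ⟨_, h.guarded_allL (guard_fun c a b) fun _ => rfl⟩
  | eallR Γ c a b F hc d ih =>
    obtain ⟨m, h⟩ := ih (lt hk (by simp))
    exact ⟨_, h.guarded_allR (guard_fun c a b) rfl (fun _ => rfl) hc⟩
  | cut Γ Δ A d e ih ih' =>
    obtain ⟨m, h⟩ := ih (lt hk (by simp))
    obtain ⟨m', h'⟩ := ih' (lt hk (by simp))
    exact ⟨_, h.cut ((depth_le_code A).trans (lt hk (by simp))) h'⟩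

/-! ### The main theorem -/

/-- Complete elimination of the cuts that are not basic. -/
theorem Der.elim_tower {k n : ℕ} {ξ α : Ordinal.{0}} {Γ : Set IFml} (hg : Good ξ)
    (h : Der k ξ α Γ) (hα : α ≤ (towerTerm n).val) :
    Der 0 ξ (towerTerm (n + k)).val Γ := by
  induction k generalizing n α with
  | zero => exact h.height hα
  | succ k ih =>
    have h1 := ih (n := n + 1) (h.elim hg) (by
      rw [towerTerm_succ_val]
      exact opow_le_opow_right omega0_pos hα)
    rwa [Nat.add_right_comm] at h1

/-- The bound is independent of m since ω^(Ω+1) is additively principal and exceeds both Ω and m. -/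
theorem hgt_le_towerTerm (m : ℕ) : hgt m ≤ (towerTerm 1).val := by
  have hlt : ∀ j : ℕ, (j : Ordinal.{0}) < Om := fun j => (natCast_lt_omega0 j).trans omega0_lt_Om
  have h0 : Om < (towerTerm 1).val := Om_lt_towerTerm_val 1
  rw [towerTerm_succ_val] at h0 ⊢
  exact (isPrincipal_add_omega0_opow _ h0 ((hlt m).trans h0)).le

theorem models_of_deriv {A : Formula} (hA : IsSigma A) (d : Deriv ∅ (some A)) {n : ℕ}
    (hn : d.code + 2 ≤ n) : Models (EHier (psi (towerTerm n).val)) A := by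
  obtain ⟨m, h⟩ := embeds_of_deriv d le_rfl
  have hg := good_psi 0
  have hv : ∀ {γ : Ordinal.{0}} (_ : ℕ), (∅ : ZFSet.{0}).rank < psi γ := fun {γ} _ => by
    simpa using (good_psi γ).pos
  have h1 := (h (v := fun _ => ∅) hg hv).elim_tower hg (hgt_le_towerTerm m)
  obtain ⟨B, hB, hs⟩ := h1.collapse hg le_rfl Clos.zero (by
    rintro B (⟨C, hC, -⟩ | ⟨C, hC, rfl⟩)
    · simp at hC
    · cases hC
      exact tr_sig hA _ _)
  rcases hB with ⟨C, hC, -⟩ | ⟨C, hC, rfl⟩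
  · simp at hC
  cases hC
  -- One exponential bounds the initial height, the Gödel number of d counts the cut eliminations,
  -- and collapsing adds a last one; hence the Gödel number plus two.
  have hle : psi (0 + ω ^ (towerTerm (1 + d.code)).val) ≤ psi (towerTerm n).val := by
    rw [zero_add, ← towerTerm_succ_val]
    exact psi_mono (towerTerm_val_mono (by omega))
  have h2 := (tr_sig hA _ _ : (tr₀ (fun _ => ∅) A).Sig).isat_mono hle hs
  rw [Models, EHier_eq_of_good (good_psi _)]
  exact (isat_tr_iff (good_psi _) hv elim0_rank_lt A).1 h2

end IKPE

theorem mainTheorem2 :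
    ∃ f : ℕ → ℕ, Computable f ∧
      ∀ (A : IKPE.Formula), IKPE.IsSentence A → IKPE.IsSigma A →
        ∀ d : IKPE.Deriv ∅ (some A),
          ∃ t : IKPE.OTerm, f d.code = t.code ∧ t.IsNF ∧
            t.val < IKPE.psi IKPE.epsOm ∧
            IKPE.Models (IKPE.EHier t.val) A := by
  refine ⟨fun c => (IKPE.OTerm.psi (IKPE.towerTerm (c + 2))).code,
    IKPE.computable_towerTerm_code.comp
      (Primrec.nat_add.comp Primrec.id (Primrec.const 2)).to_comp, fun A _ hA d => ?_⟩
  exact ⟨_, rfl, IKPE.psi_towerTerm_isNF _, IKPE.psi_towerTerm_val_lt _,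
    IKPE.models_of_deriv hA d le_rfl⟩
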